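/- Fix a relational schema $\Sigma$ (a finite set of relation symbols with positive arities), an infinite set of constants, each written as a binary string by a fixed injective code, and a Boolean UCQ$^\neg$ $q$ over $\Sigma$: a finite disjunction of queries $\exists \bar x\,(\alpha_1\wedge\dots\wedge\alpha_n)$ in which each $\alpha_i$ is an atom $R(\bar t)$, a negated atom $\neg R(\bar t)$, or an inequality $t\neq t'$ (terms being variables or constants), and in which every variable of a negated atom or inequality also occurs in a positive atom of the same disjunct. Let $\Sigma^\pm$ be the schema with two relations $+R$ and $-R$, of the arity of $R$, for each $R\in\Sigma$. For a database $D$ (a finite set of facts over $\Sigma$) with active domain $\mathrm{const}(D)$ (the set of constants occurring in $D$), let $$D^\pm=\{+R(\bar c) : R(\bar c)\in D\}\cup\{-R(\bar c) : R\in\Sigma,\ \bar c\in \mathrm{const}(D)^{\mathrm{arity}(R)},\ R(\bar c)\notin D\},$$ and let $q^\pm$ be the query over $\Sigma^\pm$ obtained from $q$ by replacing every negated atom $\neg R(\bar t)$ by $-R(\bar t)$ and every positive atom $R(\bar t)$ by $+R(\bar t)$, inequalities being kept. For a set $S$ of signed facts, let $\xi^{\mathrm{ms}}_{q^\pm}(S)$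 be the number of inclusion-minimal subsets $T\subseteq S$ with $T\models q^\pm$. For a finite set $E$, a function $\xi:2^E\to\mathbb R$ and $\alpha\in E$, let the Shapley value $$\mathrm{Sh}(E,\xi,\alpha)=\frac1{|E|!}\sum_{<}\Big(\xi(\{\beta\in E:\beta<\alpha\}\cup\{\alpha\})-\xi(\{\beta\in E:\beta<\alpha\})\Big),$$ the sum being over all linear orderings $<$ of $E$. Then the function that maps a database $D$ over $\Sigma$ (given as a list of its facts) and a signed fact $\alpha\in D^\pm$ to the value $\mathrm{Sh}(D^\pm,\xi^{\mathrm{ms}}_{q^\pm},\alpha)$ is rational-valued and can be computed, as a reduced fraction in binary, by a deterministic multi-tape (multi-stack) Turing machine in time polynomial in the length of the encoding of $(D,\alpha)$. The machine and the polynomial may depend on $\Sigma$, $q$ and the code of the constants, but not on $D$ and $\alpha$. -/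

import Mathlib

namespace SignedShapley

/-! ### Schemas, facts, databases -/

/-- A relational schema: a finite set of relation symbols, each with a positive arity. -/
structure Schema where
  Rel : Type
  [finRel : Fintype Rel]
  arity : Rel → ℕ
  arity_pos : ∀ R, 0 < arity R

attribute [instance] Schema.finRel

/-- Atoms `R(t₁, …, t_k)` over a schema, with arguments taken from `T`. -/
abbrev Atom (S : Schema) (T : Type*) := Σ R : S.Rel, (Fin (S.arity R) → T)

/-- Facts: atoms that contain only constants. -/
abbrev Fact (S : Schema) (Const : Type*) := Atom S Const

/-- Databases: finite sets of facts. -/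
abbrev Database (S : Schema) (Const : Type*) := Finset (Fact S Const)

open scoped Classical in
/-- The active domain of a database: the set of constants that occur in it. -/
noncomputable def activeDomain {S : Schema} {Const : Type*} (D : Database S Const) :
    Finset Const :=
  D.biUnion fun f => Finset.univ.image f.2

/-! ### Unions of conjunctive queries with safe negation and inequalities -/

/-- Terms: constants or variables. -/
inductive Term (Const Var : Type*)
  | const (c : Const)
  | var (x : Var)

/-- The constant denoted by a term under a valuation of the variables. -/
def Term.eval {Const Var : Type*} (ν : Var → Const) : Term Const Var → Const
  | .const c => c
  | .var x => ν x

/-- The fact obtained from an atom by applying a valuation. -/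
def Atom.eval {S : Schema} {Const Var : Type*} (ν : Var → Const)
    (A : Atom S (Term Const Var)) : Fact S Const :=
  ⟨A.1, fun i => (A.2 i).eval ν⟩

/-- The variable `x` occurs in the atom `A`. -/
def Atom.HasVar {S : Schema} {Const Var : Type*} (A : Atom S (Term Const Var)) (x : Var) : Prop :=
  ∃ i, A.2 i = Term.var x

/-- A Boolean conjunctive query with negated atoms and inequality atoms: the existential closure
of the conjunction of the atoms in `pos`, the negations of the atoms in `neg`, and the inequalities
`t ≠ t'` for `(t, t')` in `ineq`. Negations and inequalities are safe. -/
structure CQneg (S : Schema) (Const Var : Type*) where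
  pos : List (Atom S (Term Const Var))
  neg : List (Atom S (Term Const Var))
  ineq : List (Term Const Var × Term Const Var)
  safe_neg : ∀ A ∈ neg, ∀ x, Atom.HasVar A x → ∃ B ∈ pos, Atom.HasVar B x
  safe_ineq : ∀ p ∈ ineq, ∀ x, p.1 = Term.var x ∨ p.2 = Term.var x → ∃ B ∈ pos, Atom.HasVar B x

/-- A Boolean UCQ¬: a finite union (disjunction) of `CQneg`s. -/
abbrev UCQneg (S : Schema) (Const Var : Type*) := List (CQneg S Const Var)

/-- The valuation `ν` satisfies the conjunctive query `p` on `D`. -/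
def CQneg.SatisfiedBy {S : Schema} {Const Var : Type*} (p : CQneg S Const Var)
    (D : Database S Const) (ν : Var → Const) : Prop :=
  (∀ A ∈ p.pos, Atom.eval ν A ∈ D) ∧ (∀ A ∈ p.neg, Atom.eval ν A ∉ D) ∧
    ∀ t ∈ p.ineq, t.1.eval ν ≠ t.2.eval ν

/-- `D ⊨ q`. -/
def Models {S : Schema} {Const Var : Type*} (D : Database S Const)
    (q : UCQneg S Const Var) : Prop :=
  ∃ p ∈ q, ∃ ν : Var → Const, p.SatisfiedBy D ν

/-! ### Supports and the Shapley value -/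

/-- `T` is a support of `q` in `D`. -/
def IsSupport {S : Schema} {Const Var : Type*} (q : UCQneg S Const Var) (D T : Database S Const) :
    Prop :=
  T ⊆ D ∧ Models T q

/-- `T` is a minimal support of `q` in `D`, with respect to set inclusion. -/
def IsMinimalSupport {S : Schema} {Const Var : Type*} (q : UCQneg S Const Var)
    (D T : Database S Const) : Prop :=
  Minimal (IsSupport q D) T

open scoped Classical in
/-- The MS wealth function `ξ^ms_q`: the number of minimal supports of `q` inside `D`. -/
noncomputable def msScore {S : Schema} {Const Var : Type*} (q : UCQneg S Const Var)
    (D : Database S Const) : ℝ :=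
  ((D.powerset.filter (IsMinimalSupport q D)).card : ℝ)

open scoped Classical in
/-- The Shapley value `Sh(D, ξ, α)`: the average of `ξ({β | β < α} ∪ {α}) - ξ({β | β < α})` over all
linear orderings of the finite set `D`, an ordering being given by its order isomorphism `e`
onto `{0, …, |D| - 1}` (so that `β < α` means `e β < e α`). -/
noncomputable def shapley {F : Type*} (D : Finset F) (ξ : Finset F → ℝ) (α : D) : ℝ :=
  (∑ e : D ≃ Fin D.card,
      (ξ (insert α.1 ((Finset.univ.filter fun β : D => e β < e α).map
            (Function.Embedding.subtype _)))
        - ξ ((Finset.univ.filter fun β : D => e β < e α).map (Function.Embedding.subtype _)))) /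
    (Fintype.card (D ≃ Fin D.card) : ℝ)

/-! ### Signed facts -/

/-- The schema `Σ^±`, with a relation `+R` (`Sum.inl R`) and a relation `-R` (`Sum.inr R`) for each
relation `R` of `Σ`, both of the same arity as `R`. -/
abbrev Schema.signed (S : Schema) : Schema where
  Rel := S.Rel ⊕ S.Rel
  arity := Sum.elim S.arity S.arity
  arity_pos := by
    rintro (R | R)
    · exact S.arity_pos R
    · exact S.arity_pos R

/-- The atom `+R(t)` of the atom `R(t)`. -/
def Atom.plus {S : Schema} {T : Type*} (A : Atom S T) : Atom S.signed T := ⟨Sum.inl A.1, A.2⟩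

/-- The atom `-R(t)` of the atom `R(t)`. -/
def Atom.minus {S : Schema} {T : Type*} (A : Atom S T) : Atom S.signed T := ⟨Sum.inr A.1, A.2⟩

open scoped Classical in
/-- The signed database `D^±`: all `+R(c)` with `R(c) ∈ D`, and all `-R(c)` such that `R(c) ∉ D`
and the constants `c` belong to the active domain of `D`. -/
noncomputable def signedDatabase {S : Schema} {Const : Type*} (D : Database S Const) :
    Database S.signed Const :=
  D.image Atom.plus ∪
    ((Finset.univ.sigma fun R : S.Rel =>
      Fintype.piFinset fun _ : Fin (S.arity R) => activeDomain D) \ D).image Atom.minus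

/-- The signed version of a conjunctive query: each negated atom `¬R(t)` becomes the atom `-R(t)`
and each atom `R(t)` becomes `+R(t)`; inequalities are kept. -/
def CQneg.signed {S : Schema} {Const Var : Type*} (p : CQneg S Const Var) :
    CQneg S.signed Const Var where
  pos := p.pos.map Atom.plus ++ p.neg.map Atom.minus
  neg := []
  ineq := p.ineq
  safe_neg := by simp
  safe_ineq := by
    intro t ht x hx
    obtain ⟨B, hB, i, hi⟩ := p.safe_ineq t ht x hx
    exact ⟨Atom.plus B, by simp only [List.mem_append, List.mem_map]; exact Or.inl ⟨B, hB, rfl⟩,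
      i, hi⟩

/-- The signed version `q^±` of a union of conjunctive queries. -/
def UCQneg.signed {S : Schema} {Const Var : Type*} (q : UCQneg S Const Var) :
    UCQneg S.signed Const Var :=
  q.map CQneg.signed

/-! ### Encoding of inputs and outputs -/

open scoped Classical in
/-- An input of the problem: a database `D`, presented as a list of its facts without repetitions
and in any order, and a signed fact `α ∈ D^±`. -/
structure Input (S : Schema) (Const : Type) where
  facts : List (Fact S Const)
  nodup : facts.Nodup
  α : Fact S.signed Const
  mem : α ∈ signedDatabase facts.toFinset

open scoped Classical in
/-- The database of an input. -/
noncomputable def Input.database {S : Schema} {Const : Type} (I : Input S Const) :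
    Database S Const :=
  I.facts.toFinset

/-- The finite input alphabet: signs, relation symbols, the bits that constants are written with,
and an end marker for constants. -/
inductive InSymbol (Rel : Type)
  | sign (positive : Bool)
  | rel (R : Rel)
  | bit (b : Bool)
  | sep

/-- A fact is written as its relation symbol followed by the binary codes of its arguments, each
followed by an end marker. -/
def encodeFact {S : Schema} {Const : Type} (enc : Computability.Encoding Const Bool)
    (f : Fact S Const) : List (InSymbol S.Rel) :=
  InSymbol.rel f.1 ::
    (List.ofFn f.2).flatMap fun c => (enc.encode c).map InSymbol.bit ++ [InSymbol.sep]

/-- A signed fact is written as its sign followed by the underlying fact. -/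
def encodeSignedFact {S : Schema} {Const : Type} (enc : Computability.Encoding Const Bool) :
    Fact S.signed Const → List (InSymbol S.Rel)
  | ⟨Sum.inl R, c⟩ => InSymbol.sign true :: encodeFact (S := S) enc ⟨R, c⟩
  | ⟨Sum.inr R, c⟩ => InSymbol.sign false :: encodeFact (S := S) enc ⟨R, c⟩

/-- An input is written as the signed fact `α` followed by the facts of the database. -/
def encodeInput {S : Schema} {Const : Type} (enc : Computability.Encoding Const Bool)
    (I : Input S Const) : List (InSymbol S.Rel) :=
  encodeSignedFact enc I.α ++ I.facts.flatMap (encodeFact enc)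

/-- The output alphabet, for fractions in binary. -/
inductive OutSymbol
  | bit (b : Bool)
  | minus
  | slash

/-- A rational number is written as its sign (if negative), the binary numerator, a slash and the
binary denominator of the reduced fraction. -/
def encodeRat (r : ℚ) : List OutSymbol :=
  (if r < 0 then [OutSymbol.minus] else []) ++
    (Computability.encodeNat r.num.natAbs).map OutSymbol.bit ++
    OutSymbol.slash :: (Computability.encodeNat r.den).map OutSymbol.bit

end SignedShapley

/-! Why the value has a simple form. The minimal supports inside a subset of `D^±` are exactly the
minimal supports of `D^±` that lie in this subset (`isMinimalSupport_iff`). So `ξ^ms` is a sum of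
unanimity games, one for each minimal support `T` of `D^±`. Among all orderings, every element of
`T` is the last one of `T` equally often; hence the Shapley value of `α` is the sum of `1/|T|` over
the minimal supports `T` that contain `α` (`shapley_eq_sum`, `shapley_msScore`).

Why the sum is tractable. The query `q^±` has no negated atoms, so each minimal support is the set
of facts that the atoms of one disjunct become under a valuation, and safety confines the relevant
values to the active domain (`exists_valid`). For fixed `q` there are polynomially many pairs of a
disjunct and a valuation, and `|T|` is at most a constant `k`. Several pairs may yield the same `T`;
the pair of least rank represents it (`sum_image_least`), and being a representative of a minimal
support is a condition that quantifies over one further valuation (`Canonical`). With weights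
`k!/|T|` the sum becomes a natural number, and the value is this number divided by `k!`
(`total_div_factorial`).

Why a machine can compute it. `Canonical` is a fixed Boolean combination of comparisons and infix
searches of words, under a fixed number of quantifiers over the active domain. The classes `Dec` and
`Counts` of polynomial-time tests and counts are closed under Boolean operations, such quantifiers
and such sums, each quantifier or sum costing one more nested loop. The sum is kept in unary, which
polynomial time permits. Reducing a fraction with the constant denominator `k!` needs only a residue
modulo `k!`, held in the finite register, and a binary counter (`finish_exec`). The programs are
written in a structured language `Cmd` with a cost semantics `Exec`, which the translation to stack
machines respects (`Exec.steps`, `machine_outputs`). -/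

namespace SignedShapley

/-! ### A structured language over stacks, and its translation into stack machines -/

/-- Structured programs over stacks `K` with alphabet `G` and a finite register `σ`. -/
inductive Cmd (K G σ : Type) : Type
  | push (k : K) (f : σ → G)
  | pop (k : K) (f : σ → Option G → σ)
  | peek (k : K) (f : σ → Option G → σ)
  | load (f : σ → σ)
  | seq (a b : Cmd K G σ)
  | ite (f : σ → Bool) (a b : Cmd K G σ)
  | loop (f : σ → Bool) (a : Cmd K G σ)

namespace Cmd

variable {K G σ : Type}

section
variable [DecidableEq K]

/-- `Exec c v S v' S' t`: from register `v` and stacks `S`, the program `c` terminates with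
register `v'` and stacks `S'` in at most `t` steps. -/
inductive Exec : Cmd K G σ → σ → (K → List G) → σ → (K → List G) → ℕ → Prop
  | push {k f v S} : Exec (push k f) v S v (Function.update S k (f v :: S k)) 1
  | pop {k f v S} : Exec (pop k f) v S (f v (S k).head?) (Function.update S k (S k).tail) 1
  | peek {k f v S} : Exec (peek k f) v S (f v (S k).head?) S 1
  | load {f v S} : Exec (load f) v S (f v) S 1
  | seq {a b v S v₁ S₁ v₂ S₂ t₁ t₂} : Exec a v S v₁ S₁ t₁ → Exec b v₁ S₁ v₂ S₂ t₂ →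
      Exec (seq a b) v S v₂ S₂ (t₁ + t₂)
  | ite_true {f a b v S v₁ S₁ t} : f v = true → Exec a v S v₁ S₁ t →
      Exec (ite f a b) v S v₁ S₁ (t + 1)
  | ite_false {f a b v S v₁ S₁ t} : f v = false → Exec b v S v₁ S₁ t →
      Exec (ite f a b) v S v₁ S₁ (t + 1)
  | loop_done {f a v S} : f v = false → Exec (loop f a) v S v S 1
  | loop_step {f a v S v₁ S₁ v₂ S₂ t₁ t₂} : f v = true → Exec a v S v₁ S₁ t₁ →
      Exec (loop f a) v₁ S₁ v₂ S₂ t₂ → Exec (loop f a) v S v₂ S₂ (t₁ + t₂ + 1)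
  | mono {c v S v' S' t t'} : Exec c v S v' S' t → t ≤ t' → Exec c v S v' S' t'

/-- A unit of time pushes at most one symbol. Time bounds thus double as size bounds, both for the
unary counter and for the output word. -/
theorem Exec.length_le {c : Cmd K G σ} {v S v' S' t} (h : Exec c v S v' S' t) (k : K) :
    (S' k).length ≤ (S k).length + t := by
  induction h with
  | @push k' f v S =>
    by_cases hk : k = k'
    · subst hk; simp
    · simp [Function.update_of_ne hk]
  | @pop k' f v S =>
    by_cases hk : k = k'
    · subst hk; simp; omega
    · simp [Function.update_of_ne hk]
  | peek => omega
  | load => omega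
  | seq _ _ h₁ h₂ => omega
  | ite_true _ _ h => omega
  | ite_false _ _ h => omega
  | loop_done => omega
  | loop_step _ _ _ h₁ h₂ => omega
  | mono _ _ h => omega

end

/-- The labels of the machine that runs a program. -/
def Lab : Cmd K G σ → Type
  | push _ _ => Unit
  | pop _ _ => Unit
  | peek _ _ => Unit
  | load _ => Unit
  | seq a b => a.Lab ⊕ b.Lab
  | ite _ a b => Option (a.Lab ⊕ b.Lab)
  | loop _ a => Option a.Lab

theorem finite_lab (c : Cmd K G σ) : Finite c.Lab := by
  induction c with
  | push | pop | peek | load => exact inferInstanceAs (Finite Unit)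
  | seq a b ha hb => exact inferInstanceAs (Finite (a.Lab ⊕ b.Lab))
  | ite _ a b ha hb => exact inferInstanceAs (Finite (Option (a.Lab ⊕ b.Lab)))
  | loop _ a ha => exact inferInstanceAs (Finite (Option a.Lab))

/-- The label at which a program starts. -/
def entry : (c : Cmd K G σ) → c.Lab
  | push _ _ => ()
  | pop _ _ => ()
  | peek _ _ => ()
  | load _ => ()
  | seq a _ => Sum.inl a.entry
  | ite _ _ _ => none
  | loop _ _ => none

open Turing

variable (O : Type)

/-- The stack alphabets of the machine: the stacks of the program, and an output stack. -/
abbrev Alph (K G O : Type) : Option K → Type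
  | some _ => G
  | none => O

/-- The code of a program, whose labels are embedded by `emb` and which leaves to `ex`. -/
def code {Λ : Type} : (c : Cmd K G σ) → (c.Lab → Λ) → Λ → c.Lab → TM2.Stmt (Alph K G O) Λ σ
  | push k f, _, ex, _ => TM2.Stmt.push (some k) f (TM2.Stmt.goto fun _ => ex)
  | pop k f, _, ex, _ => TM2.Stmt.pop (some k) f (TM2.Stmt.goto fun _ => ex)
  | peek k f, _, ex, _ => TM2.Stmt.peek (some k) f (TM2.Stmt.goto fun _ => ex)
  | load f, _, ex, _ => TM2.Stmt.load f (TM2.Stmt.goto fun _ => ex)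
  | seq a b, emb, ex, l =>
    Sum.elim (code a (fun l => emb (Sum.inl l)) (emb (Sum.inr b.entry)))
      (code b (fun l => emb (Sum.inr l)) ex) l
  | ite f a b, emb, ex, l =>
    Option.elim l
      (TM2.Stmt.branch f (TM2.Stmt.goto fun _ => emb (some (Sum.inl a.entry)))
        (TM2.Stmt.goto fun _ => emb (some (Sum.inr b.entry))))
      (Sum.elim (code a (fun l => emb (some (Sum.inl l))) ex)
        (code b (fun l => emb (some (Sum.inr l))) ex))
  | loop f a, emb, ex, l =>
    Option.elim l
      (TM2.Stmt.branch f (TM2.Stmt.goto fun _ => emb (some a.entry)) (TM2.Stmt.goto fun _ => ex))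
      -- The body of a loop leaves to the head of the loop, where the test is repeated.
      (code a (fun l => emb (some l)) (emb none))

/-- The stacks of the machine, from the stacks of a program and the output. -/
def allStk {O : Type} (S : K → List G) (o : List O) : (k : Option K) → List (Alph K G O k)
  | some k => S k
  | none => o

variable [DecidableEq K]

theorem allStk_update {O : Type} (S : K → List G) (o : List O) (k : K) (l : List G) :
    allStk (Function.update S k l) o =
      Function.update (allStk (O := O) S o) (some k) l := by
  funext k'
  rcases k' with _ | k'
  · rw [Function.update_of_ne (by simp)]; rfl
  · by_cases h : k' = k
    · subst h
      rw [Function.update_self]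
      exact Function.update_self ..
    · rw [Function.update_of_ne (by simpa using h)]
      exact Function.update_of_ne h ..

theorem allStk_update_none {O : Type} (S : K → List G) (o l : List O) :
    Function.update (allStk S o) none l = allStk S l := by
  funext k'
  rcases k' with _ | k'
  · exact Function.update_self ..
  · exact Function.update_of_ne (by simp) ..

/-- `n` steps of a partial transition function. -/
def Steps {C : Type} (f : C → Option C) (n : ℕ) (a b : C) : Prop :=
  (flip bind f)^[n] (some a) = some b

theorem Steps.trans {C : Type} {f : C → Option C} {n m : ℕ} {a b c : C}
    (h₁ : Steps f n a b) (h₂ : Steps f m b c) : Steps f (n + m) a c := by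
  unfold Steps at *
  rw [Nat.add_comm, Function.iterate_add_apply, h₁, h₂]

theorem Steps.single {C : Type} {f : C → Option C} {a b : C} (h : f a = some b) :
    Steps f 1 a b := h

theorem step_of_code {Λ : Type} {M : Λ → TM2.Stmt (Alph K G O) Λ σ} {l : Λ}
    {q : TM2.Stmt (Alph K G O) Λ σ} (h : M l = q) (v : σ) (S : ∀ k, List (Alph K G O k))
    {c : TM2.Cfg (Alph K G O) Λ σ} (hc : TM2.stepAux q v S = c) :
    Steps (TM2.step M) 1 ⟨some l, v, S⟩ c := by
  subst h hc
  exact Steps.single rfl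

/-- Induction on the execution. The exit label has to vary, since the first part of a sequence
leaves to the entry of the second and the body of a loop leaves to the head of the loop. The bound
holds because every constructor of `Exec` is charged at least the machine steps that it takes; the
output stack `o` is never touched. -/
theorem Exec.steps {Λ : Type} {c : Cmd K G σ} {v S v' S' t} (h : Exec c v S v' S' t)
    (M : Λ → TM2.Stmt (Alph K G O) Λ σ) (o : List O) (emb : c.Lab → Λ) (ex : Λ)
    (hM : ∀ l, M (emb l) = code O c emb ex l) :
    ∃ n ≤ t, Steps (TM2.step M) n ⟨some (emb c.entry), v, allStk S o⟩
      ⟨some ex, v', allStk S' o⟩ := by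
  induction h generalizing ex with
  | push =>
    refine ⟨1, le_rfl, step_of_code O (hM _) _ _ ?_⟩
    rw [allStk_update]; rfl
  | pop =>
    refine ⟨1, le_rfl, step_of_code O (hM _) _ _ ?_⟩
    rw [allStk_update]; rfl
  | peek => exact ⟨1, le_rfl, step_of_code O (hM _) _ _ rfl⟩
  | load => exact ⟨1, le_rfl, step_of_code O (hM _) _ _ rfl⟩
  | @seq a b v S v₁ S₁ v₂ S₂ t₁ t₂ _ _ iha ihb =>
    obtain ⟨n, hn, h₁⟩ := iha (fun l => emb (Sum.inl l)) (emb (Sum.inr b.entry))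
      (fun l => hM (Sum.inl l))
    obtain ⟨m, hm, h₂⟩ := ihb (fun l => emb (Sum.inr l)) ex (fun l => hM (Sum.inr l))
    exact ⟨n + m, by omega, h₁.trans h₂⟩
  | @ite_true f a b v S v₁ S₁ t hf _ ih =>
    obtain ⟨n, hn, h⟩ := ih (fun l => emb (some (Sum.inl l))) ex (fun l => hM (some (Sum.inl l)))
    refine ⟨1 + n, by omega, Steps.trans (step_of_code O (hM none) _ _ ?_) h⟩
    show cond (f v) _ _ = _
    rw [hf]; rfl
  | @ite_false f a b v S v₁ S₁ t hf _ ih =>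
    obtain ⟨n, hn, h⟩ := ih (fun l => emb (some (Sum.inr l))) ex (fun l => hM (some (Sum.inr l)))
    refine ⟨1 + n, by omega, Steps.trans (step_of_code O (hM none) _ _ ?_) h⟩
    show cond (f v) _ _ = _
    rw [hf]; rfl
  | @loop_done f a v S hf =>
    refine ⟨1, le_rfl, step_of_code O (hM none) _ _ ?_⟩
    show cond (f v) _ _ = _
    rw [hf]; rfl
  | @loop_step f a v S v₁ S₁ v₂ S₂ t₁ t₂ hf _ _ iha ihb =>
    obtain ⟨n, hn, h₁⟩ := iha (fun l => emb (some l)) (emb none) (fun l => hM (some l))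
    -- The remaining iterations run the same program, hence the same labels and the same exit.
    obtain ⟨m, hm, h₂⟩ := ihb emb ex hM
    refine ⟨1 + (n + m), by omega, Steps.trans (step_of_code O (hM none) _ _ ?_) (h₁.trans h₂)⟩
    show cond (f v) _ _ = _
    rw [hf]; rfl
  | mono _ hle ih =>
    obtain ⟨n, hn, h⟩ := ih emb ex hM
    exact ⟨n, hn.trans hle, h⟩

/-- The code that runs a program and then moves the stack `r` to the output stack. -/
def outCode [Inhabited O] (c : Cmd K G σ) (r : K) (v₀ : σ) (rd : σ → Option G → σ)
    (get : σ → Option O) : Option c.Lab → TM2.Stmt (Alph K G O) (Option c.Lab) σ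
  | none => TM2.Stmt.pop (some r) rd
      (TM2.Stmt.branch (fun v => (get v).isSome)
        (TM2.Stmt.push none (fun v => (get v).getD default) (TM2.Stmt.goto fun _ => none))
        -- `haltList` prescribes the initial register, so it is restored before halting.
        (TM2.Stmt.load (fun _ => v₀) TM2.Stmt.halt))
  | some l => code O c some none l

/-- The machine that runs a program on the stack `input` and then moves the stack `r` to the
output stack, translating symbols. The initial register is `v₀`; popped symbols are recorded by
`rd`, and `get` gives the translation of the recorded symbol. -/
noncomputable def machine [Fintype K] [Fintype G] [Fintype σ] [Inhabited O] (c : Cmd K G σ)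
    (input r : K) (v₀ : σ) (rd : σ → Option G → σ) (get : σ → Option O) : FinTM2 :=
  letI := c.finite_lab
  letI : Fintype c.Lab := Fintype.ofFinite _
  { K := Option K
    k₀ := some input
    k₁ := none
    Γ := Alph K G O
    Λ := Option c.Lab
    main := some c.entry
    σ := σ
    initialState := v₀
    Γk₀Fin := inferInstanceAs (Fintype G)
    m := outCode O c r v₀ rd get }

theorem stepAux_pop {Λ : Type} (k : K) (f : σ → Option G → σ) (q : TM2.Stmt (Alph K G O) Λ σ)
    (v : σ) (S : K → List G) (o : List O) :
    TM2.stepAux (TM2.Stmt.pop (some k) f q) v (allStk S o) =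
      TM2.stepAux q (f v (S k).head?) (allStk (Function.update S k (S k).tail) o) := by
  rw [allStk_update]; rfl

theorem stepAux_push_none {Λ : Type} (f : σ → O) (q : TM2.Stmt (Alph K G O) Λ σ)
    (v : σ) (S : K → List G) (o : List O) :
    TM2.stepAux (TM2.Stmt.push none f q) v (allStk S o) =
      TM2.stepAux q v (allStk S (f v :: o)) := by
  rw [← allStk_update_none S o (f v :: o)]; rfl

/-- One machine step for each symbol and one for the pop that finds the stack empty. Moving a stack
reverses it, whence `res.reverse`. -/
theorem outCode_steps [Inhabited O] {c : Cmd K G σ} {r : K} {v₀ : σ} {rd : σ → Option G → σ}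
    {get : σ → Option O} {tr : G → O} (hget : ∀ v x, get (rd v x) = x.map tr) (res : List G) :
    ∀ (v : σ) (S : K → List G) (o : List O), S r = res →
      Steps (TM2.step (outCode O c r v₀ rd get)) (res.length + 1) ⟨some none, v, allStk S o⟩
        ⟨none, v₀, allStk (Function.update S r []) (res.reverse.map tr ++ o)⟩ := by
  induction res with
  | nil =>
    intro v S o hS
    refine step_of_code O (M := outCode O c r v₀ rd get) (l := none) rfl v _ ?_
    rw [outCode, stepAux_pop, hS]
    simp only [TM2.stepAux, hget]
    rfl
  | cons x res ih =>
    intro v S o hS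
    have h := ih (rd v (some x)) (Function.update S r res) (tr x :: o) (Function.update_self ..)
    rw [Function.update_idem] at h
    rw [List.length_cons, Nat.add_comm _ 1]
    have e : (x :: res).reverse.map tr ++ o = res.reverse.map tr ++ tr x :: o := by simp
    rw [e]
    refine Steps.trans (step_of_code O (M := outCode O c r v₀ rd get) (l := none) rfl v _ ?_) h
    rw [outCode, stepAux_pop, hS, TM2.stepAux, hget, stepAux_push_none, hget]
    rfl

/-- In the final configuration only the output stack may be nonempty. This is why the program is
required to end with all stacks but `r` empty. -/
theorem machine_outputs [Fintype K] [Fintype G] [Fintype σ] [Inhabited O] {c : Cmd K G σ}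
    {input r : K} {v₀ : σ} {rd : σ → Option G → σ} {get : σ → Option O} {tr : G → O}
    (hget : ∀ v x, get (rd v x) = x.map tr) {w res : List G} {v : σ} {t : ℕ}
    (h : Exec c v₀ (Function.update (fun _ => []) input w) v
      (Function.update (fun _ => []) r res) t) :
    Nonempty (TM2OutputsInTime (machine O c input r v₀ rd get) w
      (some (res.reverse.map tr)) (t + res.length + 1)) := by
  obtain ⟨n, hn, h₁⟩ := h.steps O (outCode O c r v₀ rd get) [] some none (fun l => rfl)
  have h₃ := h₁.trans (outCode_steps O hget res v (Function.update (fun _ => []) r res) []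
    (Function.update_self ..))
  have e₁ : initList (machine O c input r v₀ rd get) w = (⟨some (some c.entry), v₀,
      allStk (Function.update (fun _ => []) input w) []⟩ :
        TM2.Cfg (Alph K G O) (Option c.Lab) σ) := by
    unfold initList
    congr 1
    funext k
    rcases k with _ | k
    · exact dif_neg (by simp [machine])
    · by_cases hk : k = input
      · subst hk
        exact (dif_pos rfl).trans (Function.update_self (f := fun _ => ([] : List G)) k w).symm
      · refine (dif_neg (by simpa [machine] using hk)).trans ?_
        exact (Function.update_of_ne hk w (fun _ => ([] : List G))).symm
  have e₂ : haltList (machine O c input r v₀ rd get) (res.reverse.map tr) = (⟨none, v₀,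
      allStk (Function.update (Function.update (fun _ => []) r res) r [])
        (res.reverse.map tr ++ [])⟩ : TM2.Cfg (Alph K G O) (Option c.Lab) σ) := by
    unfold haltList
    congr 1
    funext k
    rcases k with _ | k
    · exact (dif_pos rfl).trans (List.append_nil _).symm
    · refine (dif_neg (by simp [machine])).trans ?_
      rw [Function.update_idem]
      by_cases hk : k = r
      · subst hk
        exact (Function.update_self (f := fun _ => ([] : List G)) k []).symm
      · exact (Function.update_of_ne hk [] (fun _ => ([] : List G))).symm
  refine ⟨⟨⟨n + (res.length + 1), ?_⟩, ?_⟩⟩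
  · rw [Option.map_some, e₁, e₂]
    exact h₃
  · show n + (res.length + 1) ≤ _
    omega

end Cmd
end SignedShapley

namespace SignedShapley

open Function

/-! ### Registers, stacks, and elementary programs -/

/-- The register of the programs below: a Boolean, two symbols, and two numbers. -/
structure Reg (G : Type) (M : ℕ) where
  res : Bool
  a : Option G
  b : Option G
  r : Fin (M + 1)
  g : Fin (M + 1)

instance {G : Type} [Finite G] {M : ℕ} : Finite (Reg G M) :=
  Finite.of_injective
    (fun v : Reg G M => (v.res, v.a, v.b, v.r, v.g)) (by
      rintro ⟨⟩ ⟨⟩ h; simp_all)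

/-- The stacks whose content may be part of a word that is assembled: the variables, the
distinguished signed fact, and the current constant. -/
inductive Src (J : Type)
  | var (j : J)
  | alpha
  | cur

/-- The stacks: the facts, the sources, the active domain, the loops, the counter, and scratch. -/
inductive WK (J : Type)
  | facts
  | src (s : Src J)
  | dom
  | loop
  | cnt
  | t1
  | t2
  | t3
  | t4

instance {J : Type} [Finite J] : Finite (Src J) :=
  Finite.of_injective
    (fun s : Src J => match s with
      | .var j => some (some j)
      | .alpha => some none
      | .cur => none) (by
    rintro (_ | _ | _) (_ | _ | _) h <;> simp_all)

instance {J : Type} [Finite J] : Finite (WK J) :=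
  Finite.of_injective
    (fun s : WK J => match s with
      | .facts => (Sum.inr 0 : Src J ⊕ Fin 8)
      | .src s => Sum.inl s
      | .dom => Sum.inr 1
      | .loop => Sum.inr 2
      | .cnt => Sum.inr 3
      | .t1 => Sum.inr 4
      | .t2 => Sum.inr 5
      | .t3 => Sum.inr 6
      | .t4 => Sum.inr 7) (by
    rintro (_ | _ | _) (_ | _ | _) h <;> simp_all)

noncomputable instance {J : Type} : DecidableEq (WK J) := Classical.decEq _

namespace Cmd

variable {G : Type} {M : ℕ}

theorem Exec.cast {K σ : Type} [DecidableEq K] {c : Cmd K G σ} {v S v' S₁ t S' t'}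
    (h : Exec c v S v' S₁ t) (hS : S₁ = S') (ht : t ≤ t') : Exec c v S v' S' t' :=
  hS ▸ h.mono ht

section Xfer

variable {K : Type} [Inhabited G]

/-- Record a symbol in the first component of the register. -/
def setA (v : Reg G M) (x : Option G) : Reg G M := { v with a := x }

/-- Record a symbol in the second component of the register. -/
def setB (v : Reg G M) (x : Option G) : Reg G M := { v with b := x }

/-- Do nothing. -/
def skip : Cmd K G (Reg G M) := load id

/-- Push the recorded symbol onto all the stacks of a list. -/
def pushAll : List K → Cmd K G (Reg G M)
  | [] => skip
  | k :: ks => seq (push k fun v => v.a.getD default) (pushAll ks)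

/-- Transfer symbols from the stack `A` to the stacks `ts` as long as they satisfy `p`. -/
def xfer (p : G → Bool) (A : K) (ts : List K) : Cmd K G (Reg G M) :=
  seq (peek A setA) (loop (fun v => v.a.any p)
    (seq (pop A fun v _ => v) (seq (pushAll ts) (peek A setA))))

variable [DecidableEq K]

/-- Push the symbols of `w` one after the other onto the stacks `ts`. -/
def pushed (ts : List K) (w : List G) (S : K → List G) : K → List G :=
  fun k => if k ∈ ts then w.reverse ++ S k else S k

theorem pushAll_exec (x : G) (ts : List K) (hts : ts.Nodup) (v : Reg G M) (hv : v.a = some x)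
    (S : K → List G) : Exec (pushAll ts) v S v (pushed ts [x] S) (ts.length + 1) := by
  induction ts generalizing S with
  | nil => exact Exec.load.cast (by funext k; simp [pushed]) (by simp)
  | cons k ks ih =>
    rw [List.nodup_cons] at hts
    refine (Exec.seq Exec.push (ih hts.2 _)).cast ?_ (by simp; omega)
    funext k'
    by_cases h : k' = k
    · subst h; simp [pushed, hts.1, hv]
    · simp [pushed, h]

/-- The two hypotheses on `p` make `w` the longest prefix of the stack whose symbols satisfy `p`. A
round costs the test, a pop, `ts.length + 1` for the pushes, and a peek. -/
theorem xfer_exec {p : G → Bool} {A : K} {ts : List K} (hts : ts.Nodup) (hA : A ∉ ts)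
    (w rest : List G) (hw : ∀ x ∈ w, p x = true) (hrest : rest.head?.any p = false)
    (v : Reg G M) (S : K → List G) (hS : S A = w ++ rest) :
    Exec (xfer p A ts) v S (setA v rest.head?) (pushed ts w (update S A rest))
      ((ts.length + 4) * (w.length + 1)) := by
  -- Tests see only the register, so the invariant of the loop is that `v.a` holds the top of `A`.
  have key : ∀ (w : List G), (∀ x ∈ w, p x = true) → ∀ (v : Reg G M) (S : K → List G),
      S A = w ++ rest → v.a = (w ++ rest).head? →
      Exec (loop (fun v => v.a.any p)
        (seq (pop A fun v _ => v) (seq (pushAll ts) (peek A setA)))) v S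
        (setA v rest.head?) (pushed ts w (update S A rest)) ((ts.length + 4) * w.length + 1) := by
    intro w
    induction w with
    | nil =>
      intro _ v S hS hv
      have e₁ : setA v rest.head? = v := by cases v; simp_all [setA]
      have e₂ : pushed ts [] (update S A rest) = S := by
        funext k; simp only [pushed, List.reverse_nil, List.nil_append, ite_self]
        rw [update_eq_self_iff.2 (by simpa using hS.symm)]
      rw [e₁, e₂]
      refine (Exec.loop_done ?_).mono (by omega)
      rw [hv]; exact hrest
    | cons x w ih =>
      intro hw v S hS hv
      have hx : v.a = some x := by simpa using hv
      have e₁ : (pushed ts [x] (update S A (S A).tail)) A = w ++ rest := by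
        simp [pushed, hA, hS]
      have h := ih (fun y hy => hw y (List.mem_cons_of_mem _ hy)) (setA v (w ++ rest).head?)
        (pushed ts [x] (update S A (S A).tail)) e₁ rfl
      refine (Exec.loop_step (by simp [hx, hw]) (Exec.seq Exec.pop (Exec.seq
        (pushAll_exec x ts hts v hx _) Exec.peek)) (by rw [e₁]; exact h)).cast ?_ ?_
      · funext k
        by_cases hk : k = A
        · subst hk; simp [pushed, hA]
        · by_cases hk' : k ∈ ts <;> simp [pushed, hk, hk']
      · simp only [List.length_cons]; nlinarith
  have h := key w hw (setA v (S A).head?) S hS (by rw [hS]; rfl)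
  refine (Exec.seq Exec.peek h).cast rfl ?_
  nlinarith

/-- Empty the stack `A` as long as its symbols satisfy `p`. -/
theorem drop_exec {p : G → Bool} {A : K} (w rest : List G) (hw : ∀ x ∈ w, p x = true)
    (hrest : rest.head?.any p = false) (v : Reg G M) (S : K → List G) (hS : S A = w ++ rest) :
    Exec (xfer p A []) v S (setA v rest.head?) (update S A rest) (4 * (w.length + 1)) :=
  (xfer_exec (List.nodup_nil) (by simp) w rest hw hrest v S hS).cast
    (by funext k; simp [pushed]) (by simp)

theorem move_exec {p : G → Bool} {A B : K} (hAB : A ≠ B) (w rest : List G)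
    (hw : ∀ x ∈ w, p x = true)
    (hrest : rest.head?.any p = false) (v : Reg G M) (S : K → List G) (hS : S A = w ++ rest) :
    Exec (xfer p A [B]) v S (setA v rest.head?)
      (update (update S A rest) B (w.reverse ++ S B)) (5 * (w.length + 1)) :=
  (xfer_exec (by simp) (by simpa using hAB) w rest hw hrest v S hS).cast
    (by
      funext k
      by_cases hk : k = B
      · subst hk; simp [pushed, hAB.symm]
      · simp [pushed, hk])
    (by simp)

theorem clear_exec (A : K) (v : Reg G M) (S : K → List G) :
    Exec (xfer (fun _ => true) A []) v S (setA v none) (update S A [])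
      (4 * ((S A).length + 1)) :=
  drop_exec (S A) [] (by simp) rfl v S (by simp)

theorem moveAll_exec {A B : K} (hAB : A ≠ B) (v : Reg G M) (S : K → List G) :
    Exec (xfer (fun _ => true) A [B]) v S (setA v none)
      (update (update S A []) B ((S A).reverse ++ S B)) (5 * ((S A).length + 1)) :=
  move_exec hAB (S A) [] (by simp) rfl v S (by simp)

/-- Copy the stack `A` onto the stack `B`, using the empty stack `t`. -/
def copy (A B t : K) : Cmd K G (Reg G M) :=
  seq (xfer (fun _ => true) A [t]) (xfer (fun _ => true) t [A, B])

/-- The passage through `t` reverses the word twice, so `A` is restored and `B` receives it in the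
original order. -/
theorem copy_exec {A B t : K} (hAB : A ≠ B) (hAt : A ≠ t) (hBt : B ≠ t) (v : Reg G M)
    (S : K → List G) (ht : S t = []) :
    Exec (copy A B t) v S (setA v none) (update S B (S A ++ S B)) (11 * ((S A).length + 1)) := by
  refine (Exec.seq (moveAll_exec hAt v S)
    (xfer_exec (by simpa using hAB) (by simp [hAt.symm, hBt.symm]) (S A).reverse [] (by simp)
      rfl _ _ (by simp [ht]))).cast ?_ (by simp; omega)
  funext k
  by_cases h₁ : k = A
  · subst h₁; simp [pushed, hAB, hAt]
  · by_cases h₂ : k = B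
    · subst h₂; simp [pushed, hBt, h₁]
    · by_cases h₃ : k = t
      · subst h₃; simp [pushed, h₁, h₂, ht]
      · simp [pushed, h₁, h₂, h₃]

end Xfer

/-! ### Comparing two stacks through their first difference -/

section Compare

variable {K : Type}

open scoped Classical in
/-- The first symbols in which two words differ. -/
noncomputable def diff : List G → List G → Option G × Option G
  | [], l => (none, l.head?)
  | x :: _, [] => (some x, none)
  | x :: l, y :: l' => if x = y then diff l l' else (some x, some y)

/-- A first difference fits into the register, and it settles being a prefix as well as equality
(`diff_eq_none`) and the lexicographic order (`lexLt_diff`). One comparison program therefore serves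
all three tests. -/
theorem diff_fst_eq_none {l l' : List G} : (diff l l').1 = none ↔ l <+: l' := by
  induction l generalizing l' with
  | nil => simp [diff]
  | cons x l ih =>
    rcases l' with _ | ⟨y, l'⟩
    · simp [diff]
    · by_cases h : x = y
      · subst h; simp [diff, ih]
      · simp [diff, h]

theorem diff_eq_none {l l' : List G} : diff l l' = (none, none) ↔ l = l' := by
  induction l generalizing l' with
  | nil => rcases l' with _ | ⟨y, l'⟩ <;> simp [diff]
  | cons x l ih =>
    rcases l' with _ | ⟨y, l'⟩
    · simp [diff]
    · by_cases h : x = y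
      · subst h; simp [diff, ih]
      · simp [diff, h]

variable [Inhabited G]

/-- The test that decides a property of the first difference of two stacks, which are emptied. -/
noncomputable def cmp (A B : K) (f : Option G × Option G → Bool) : Cmd K G (Reg G M) :=
  open scoped Classical in
  seq (peek A setA) (seq (peek B setB) (seq
    (loop (fun v => decide (v.a = v.b) && v.a.isSome)
      (seq (pop A fun v _ => v) (seq (pop B fun v _ => v) (seq (peek A setA) (peek B setB)))))
    (seq (load fun v => { v with res := f (v.a, v.b) })
      (seq (xfer (fun _ => true) A []) (xfer (fun _ => true) B [])))))

variable [DecidableEq K]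

theorem cmp_exec {A B : K} (hAB : A ≠ B) (f : Option G × Option G → Bool) (v : Reg G M)
    (S : K → List G) : ∃ v' : Reg G M, v'.res = f (diff (S A) (S B)) ∧
      Exec (cmp A B f) v S v' (update (update S A []) B [])
        (13 * ((S A).length + (S B).length + 1)) := by
  classical
  -- The words `x` and `y` are what the loop leaves on the two stacks after cutting off the common
  -- prefix. Only a bound for their lengths matters, as both stacks are cleared afterwards.
  have key : ∀ (w : List G) (v : Reg G M) (S : K → List G), S A = w → v.a = (S A).head? →
      v.b = (S B).head? → ∃ (v' : Reg G M) (x y : List G),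
        (v'.a, v'.b) = diff (S A) (S B) ∧ x.length ≤ (S A).length ∧ y.length ≤ (S B).length ∧
        Exec (loop (fun v : Reg G M => decide (v.a = v.b) && v.a.isSome)
          (seq (pop A fun v _ => v) (seq (pop B fun v _ => v) (seq (peek A setA) (peek B setB)))))
          v S v' (update (update S A x) B y) (5 * w.length + 1) := by
    intro w
    induction w with
    | nil =>
      intro v S hw ha hb
      refine ⟨v, S A, S B, ?_, le_rfl, le_rfl, (Exec.loop_done ?_).cast (by simp) (by omega)⟩
      · simp [hw, diff, ha, hb]
      · simp [ha, hw]
    | cons z w ih =>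
      intro v S hw ha hb
      by_cases h : v.a = v.b
      · have hB : ∃ w', S B = z :: w' := by
          have h' : (S B).head? = some z := by rw [← hb, ← h, ha, hw]; rfl
          rcases e : S B with _ | ⟨y, w'⟩
          · simp [e] at h'
          · simp [e] at h'; exact ⟨w', by rw [h']⟩
        obtain ⟨w', hw'⟩ := hB
        have eA : (update (update S A (S A).tail) B (update S A (S A).tail B).tail) A = w := by
          simp [hAB, hw]
        have eB : (update (update S A (S A).tail) B (update S A (S A).tail B).tail) B = w' := by
          simp [hAB.symm, hw']
        obtain ⟨v', x, y, h₁, hx, hy, h₂⟩ := ih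
          (setB (setA v w.head?) w'.head?)
          (update (update S A (S A).tail) B (update S A (S A).tail B).tail) eA
          (by rw [eA]; rfl) (by rw [eB]; rfl)
        rw [eA] at hx
        rw [eB] at hy
        refine ⟨v', x, y, ?_, hx.trans (by simp [hw]), hy.trans (by simp [hw']), ?_⟩
        · rw [h₁, eA, eB, hw, hw']; simp [diff]
        · have e₁ : Exec (peek A setA) v
            (update (update S A (S A).tail) B (update S A (S A).tail B).tail)
            (setA v w.head?) (update (update S A (S A).tail) B (update S A (S A).tail B).tail) 1 := by
            have h := @Exec.peek K G (Reg G M) _ A setA v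
              (update (update S A (S A).tail) B (update S A (S A).tail B).tail)
            rwa [eA] at h
          have e₂ : Exec (peek B setB) (setA v w.head?)
            (update (update S A (S A).tail) B (update S A (S A).tail B).tail)
            (setB (setA v w.head?) w'.head?)
            (update (update S A (S A).tail) B (update S A (S A).tail B).tail) 1 := by
            have h := @Exec.peek K G (Reg G M) _ B setB (setA v w.head?)
              (update (update S A (S A).tail) B (update S A (S A).tail B).tail)
            rwa [eB] at h
          refine (Exec.loop_step ?_ (Exec.seq Exec.pop (Exec.seq Exec.pop (Exec.seq e₁ e₂)))
            h₂).cast ?_ ?_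
          · simp [h]; rw [← h, ha, hw]; rfl
          · funext k
            by_cases hkB : k = B
            · subst hkB; simp
            · by_cases hkA : k = A
              · subst hkA; simp [hAB]
              · simp [hkA, hkB]
          · simp only [List.length_cons]; omega
      · refine ⟨v, S A, S B, ?_, le_rfl, le_rfl, (Exec.loop_done ?_).cast (by simp) (by omega)⟩
        · rw [ha, hb, hw] at *
          rcases e : S B with _ | ⟨y, w'⟩
          · simp [diff]
          · rw [e] at h
            simp only [List.head?_cons, Option.some.injEq] at h
            simp [diff, h]
        · simp [h]
  obtain ⟨v', x, y, h₁, hx, hy, h₂⟩ := key (S A) (setB (setA v (S A).head?) (S B).head?) S rfl rfl rfl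
  refine ⟨_, ?_, (Exec.seq Exec.peek (Exec.seq Exec.peek (Exec.seq h₂ (Exec.seq Exec.load
    (Exec.seq (clear_exec A _ _) (clear_exec B _ _)))))).cast ?_ ?_⟩
  · simp [setA, h₁]
  · funext k
    by_cases hkB : k = B
    · subst hkB; simp
    · by_cases hkA : k = A
      · subst hkA; simp [hAB]
      · simp [hkA, hkB]
  · simp [hAB, hAB.symm]; omega

end Compare

end Cmd
end SignedShapley

/-! ### Assembling words, comparing them, and searching for an infix -/

namespace SignedShapley

open Function

noncomputable instance {Rel : Type} [Finite Rel] : Fintype (InSymbol Rel) :=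
  @Fintype.ofFinite _ (Finite.of_injective
    (fun s : InSymbol Rel => match s with
      | .sign b => (Sum.inl b : Bool ⊕ (Rel ⊕ (Bool ⊕ Unit)))
      | .rel R => Sum.inr (Sum.inl R)
      | .bit b => Sum.inr (Sum.inr (Sum.inl b))
      | .sep => Sum.inr (Sum.inr (Sum.inr ()))) (by
    rintro (_ | _ | _ | _) (_ | _ | _ | _) h <;> simp_all))

instance {Rel : Type} : Inhabited (InSymbol Rel) := ⟨InSymbol.sep⟩

namespace Cmd

variable {J : Type} {M : ℕ}

section Words

variable {G : Type}

/-- The word that is the concatenation of symbols and contents of source stacks. -/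
def wordOf (S : WK J → List G) (ps : List (G ⊕ Src J)) : List G :=
  ps.flatMap (Sum.elim (fun g => [g]) fun s => S (WK.src s))

theorem length_wordOf_le {S : WK J → List G} {n : ℕ} (hn : ∀ s, (S (WK.src s)).length ≤ n)
    (ps : List (G ⊕ Src J)) : (wordOf S ps).length ≤ ps.length * (n + 1) := by
  induction ps with
  | nil => simp [wordOf]
  | cons p ps ih =>
    have e : wordOf S (p :: ps) = Sum.elim (fun g => [g]) (fun s => S (WK.src s)) p ++ wordOf S ps :=
      by simp [wordOf]
    have h : (Sum.elim (fun g => [g]) (fun s => S (WK.src s)) p : List G).length ≤ n + 1 := by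
      rcases p with g | s
      · simp
      · exact (hn s).trans (by omega)
    rw [e, List.length_append, List.length_cons, add_mul]
    omega

theorem wordOf_congr {S S' : WK J → List G} (h : ∀ s, S' (WK.src s) = S (WK.src s))
    (ps : List (G ⊕ Src J)) : wordOf S' ps = wordOf S ps := by
  simp [wordOf, h]

variable [Inhabited G]

/-- Push a word onto the stack `k`. -/
def build (k : WK J) : List (G ⊕ Src J) → Cmd (WK J) G (Reg G M)
  | [] => skip
  -- The tail goes first: a word is read from the top of its stack.
  | p :: ps => seq (build k ps)
      (p.elim (fun g => push k fun _ => g) fun s => copy (WK.src s) k WK.t3)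

theorem build_exec {k : WK J} (hk : k ≠ WK.t3) (hk' : ∀ s, k ≠ WK.src s) {n : ℕ}
    (ps : List (G ⊕ Src J)) (S : WK J → List G) (hn : ∀ s, (S (WK.src s)).length ≤ n)
    (h₃ : S WK.t3 = []) (v : Reg G M) :
    ∃ v', Exec (build k ps) v S v' (update S k (wordOf S ps ++ S k))
      (ps.length * (11 * (n + 1)) + 1) := by
  induction ps with
  | nil => exact ⟨v, Exec.load.cast (by simp [wordOf]) (by simp)⟩
  | cons p ps ih =>
    obtain ⟨v', h⟩ := ih
    rcases p with g | s
    · exact ⟨_, (h.seq Exec.push).cast (by simp [wordOf]) (by simp only [List.length_cons]; ring_nf; omega)⟩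
    · refine ⟨_, (h.seq (copy_exec (hk' s).symm (by simp) hk _ _ ?_)).cast ?_ ?_⟩
      · simp [hk.symm, h₃]
      · simp [wordOf, (hk' s).symm]
      · rw [update_of_ne (hk' s).symm, List.length_cons]
        have := hn s
        ring_nf; omega

/-- The scratch stacks are empty. -/
structure Clean (S : WK J → List G) : Prop where
  t1 : S WK.t1 = []
  t2 : S WK.t2 = []
  t3 : S WK.t3 = []
  t4 : S WK.t4 = []

/-- Compare two words. -/
noncomputable def cmpWords (ps ps' : List (G ⊕ Src J)) (f : Option G × Option G → Bool) :
    Cmd (WK J) G (Reg G M) :=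
  seq (build WK.t1 ps) (seq (build WK.t2 ps') (cmp WK.t1 WK.t2 f))

theorem cmpWords_exec {n : ℕ} (ps ps' : List (G ⊕ Src J)) (f : Option G × Option G → Bool)
    (S : WK J → List G) (hn : ∀ s, (S (WK.src s)).length ≤ n) (hS : Clean S) (v : Reg G M) :
    ∃ v', v'.res = f (diff (wordOf S ps) (wordOf S ps')) ∧
      Exec (cmpWords ps ps' f) v S v' S ((ps.length + ps'.length + 1) * (24 * (n + 1))) := by
  obtain ⟨v₁, h₁⟩ := build_exec (k := WK.t1) (by simp) (by simp) ps S hn hS.t3 v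
  rw [hS.t1, List.append_nil] at h₁
  obtain ⟨v₂, h₂⟩ := build_exec (k := WK.t2) (by simp) (by simp) ps'
    (update S WK.t1 (wordOf S ps)) (n := n) (by simpa using hn) (by simp [hS.t3]) v₁
  rw [wordOf_congr (S := S) (S' := update S WK.t1 (wordOf S ps)) (by simp)] at h₂
  obtain ⟨v₃, h, h₃⟩ := cmp_exec (A := (WK.t1 : WK J)) (B := WK.t2) (by simp) f v₂
    (update (update S WK.t1 (wordOf S ps)) WK.t2
      (wordOf S ps' ++ update S WK.t1 (wordOf S ps) WK.t2))
  have e₁ := length_wordOf_le hn ps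
  have e₂ := length_wordOf_le hn ps'
  refine ⟨v₃, ?_, (h₁.seq (h₂.seq h₃)).cast ?_ ?_⟩
  · rw [h]; simp [hS.t2]
  · funext k
    by_cases hk : k = WK.t1
    · subst hk; simp [hS.t1]
    · by_cases hk' : k = WK.t2
      · subst hk'; simp [hS.t2]
      · simp [hk, hk']
  · simp [hS.t2]
    nlinarith

/-- The scanned symbol exists, and the test has not succeeded yet. -/
def unfound (v : Reg G M) : Bool := !v.res && v.a.isSome

/-- Test whether a nonempty word is an infix of the stack `A`. -/
noncomputable def infixTest (ps : List (G ⊕ Src J)) (A : WK J) : Cmd (WK J) G (Reg G M) :=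
  seq (load fun v => { v with res := false }) (seq (peek A setA) (seq
    (loop unfound
      (seq (copy A WK.t2 WK.t3) (seq (build WK.t1 ps) (seq (cmp WK.t1 WK.t2 fun d => d.1.isNone)
        (seq (pop A setA) (seq (push WK.t4 fun v => v.a.getD default) (peek A setA)))))))
    (xfer (fun _ => true) WK.t4 [A])))

/-- A word is an infix if and only if it is a prefix of some suffix, and the loop tries the suffixes
one after the other. The part already passed, `x`, is kept in reverse on `WK.t4`, from which `A` is
restored. The empty suffix is never tried, so the word must be nonempty; and `A` must not be a
source stack, since popping it would change the word. -/
theorem infixTest_loop {n : ℕ} {ps : List (G ⊕ Src J)} {A : WK J}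
    (hA : A ∉ [WK.t1, WK.t2, WK.t3, WK.t4]) (hA' : ∀ s, A ≠ WK.src s) (w : List G) :
    ∀ (S : WK J → List G) (v : Reg G M), S A = w → (∀ s, (S (WK.src s)).length ≤ n) →
      w.length ≤ n → wordOf S ps ≠ [] → S WK.t1 = [] → S WK.t2 = [] → S WK.t3 = [] →
      v.a = w.head? → v.res = false →
      ∃ v' x y, (v'.res = true ↔ wordOf S ps <:+: w) ∧ x ++ y = w ∧
        Exec (loop unfound
          (seq (copy A WK.t2 WK.t3) (seq (build WK.t1 ps)
            (seq (cmp WK.t1 WK.t2 fun d => d.1.isNone) (seq (pop A setA)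
              (seq (push WK.t4 fun v => v.a.getD default) (peek A setA)))))))
          v S v' (update (update S A y) WK.t4 (x.reverse ++ S WK.t4))
          (w.length * ((ps.length + 1) * (30 * (n + 1))) + 1) := by
  simp only [List.mem_cons, List.not_mem_nil, or_false, not_or] at hA
  obtain ⟨hA₁, hA₂, hA₃, hA₄⟩ : A ≠ WK.t1 ∧ A ≠ WK.t2 ∧ A ≠ WK.t3 ∧ A ≠ WK.t4 := hA
  induction w with
  | nil =>
    intro S v hw hn hl hne h₁ h₂ h₃ ha hr
    refine ⟨v, [], [], ?_, rfl, (Exec.loop_done (by simp [unfound, ha])).cast ?_ (by simp)⟩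
    · simp [hr, hne]
    · rw [List.reverse_nil, List.nil_append, ← hw, update_eq_self, update_eq_self]
  | cons g w ih =>
    intro S v hw hn hl hne h₁ h₂ h₃ ha hr
    have c₁ := copy_exec (A := A) (B := WK.t2) (t := WK.t3) hA₂ hA₃ (by simp) v S h₃
    rw [h₂, List.append_nil] at c₁
    obtain ⟨v₂, c₂⟩ := build_exec (k := WK.t1) (by simp) (by simp) ps
      (update S WK.t2 (S A)) (n := n) (by simpa using hn) (by simp [h₃]) (setA v none)
    rw [wordOf_congr (S := S) (by simp), update_of_ne (by simp), h₁, List.append_nil] at c₂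
    obtain ⟨v₃, hv₃, c₃⟩ := cmp_exec (A := (WK.t1 : WK J)) (B := WK.t2) (by simp)
      (fun d => d.1.isNone) v₂ (update (update S WK.t2 (S A)) WK.t1 (wordOf S ps))
    have e₀ : update (update (update (update S WK.t2 (S A)) WK.t1 (wordOf S ps)) WK.t1 [])
        WK.t2 [] = S := by
      funext k
      by_cases hk : k = WK.t1
      · subst hk; simp [h₁]
      · by_cases hk' : k = WK.t2
        · subst hk'; simp [h₂]
        · simp [hk, hk']
    rw [e₀] at c₃
    have c₄ := @Exec.pop (WK J) G (Reg G M) _ A setA v₃ S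
    rw [hw, List.head?_cons, List.tail_cons] at c₄
    have c₅ := @Exec.push (WK J) G (Reg G M) _ WK.t4 (fun v => v.a.getD default)
      (setA v₃ (some g)) (update S A w)
    have c₆ := @Exec.peek (WK J) G (Reg G M) _ A setA (setA v₃ (some g))
      (update (update S A w) WK.t4 (g :: update S A w WK.t4))
    have e₁ : (update (update S A w) WK.t4 (g :: update S A w WK.t4)) A = w := by
      rw [update_of_ne hA₄, update_self]
    rw [e₁] at c₆
    have hbody := c₁.seq (c₂.seq (c₃.seq (c₄.seq (c₅.seq c₆))))
    have hres : v₃.res = true ↔ wordOf S ps <+: g :: w := by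
      rw [hv₃]; simp [← diff_fst_eq_none, hw]
    have hcond : unfound v = true := by simp [unfound, hr, ha]
    have e₂ := length_wordOf_le hn ps
    have hb : 11 * ((S A).length + 1) + (ps.length * (11 * (n + 1)) + 1 +
        (13 * ((update (update S WK.t2 (S A)) WK.t1 (wordOf S ps) WK.t1).length +
          (update (update S WK.t2 (S A)) WK.t1 (wordOf S ps) WK.t2).length + 1) + (1 + (1 + 1)))) + 1
        ≤ (ps.length + 1) * (30 * (n + 1)) := by
      rw [update_self, update_of_ne (by simp), update_self, hw]
      nlinarith
    by_cases hp : wordOf S ps <+: g :: w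
    -- The symbol `g` is popped before the loop test notices the success.
    · refine ⟨_, [g], w, ?_, rfl, (Exec.loop_step hcond hbody (Exec.loop_done ?_)).cast ?_ ?_⟩
      · simp only [setA, hres, hp, true_iff]; exact hp.isInfix
      · simp [unfound, setA, hres.2 hp]
      · rw [update_of_ne hA₄.symm]; rfl
      · rw [List.length_cons, add_one_mul w.length]; omega
    · obtain ⟨v', x, y, hv', hxy, h⟩ := ih _ (setA (setA v₃ (some g)) w.head?) e₁
        (by intro s; simpa [(hA' s).symm] using hn s) (by simp at hl; omega)
        (by rwa [wordOf_congr (S := S)]; intro s; simp [(hA' s).symm])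
        (by simp [hA₁.symm, h₁]) (by simp [hA₂.symm, h₂]) (by simp [hA₃.symm, h₃]) rfl
        (by simp [setA, Bool.eq_false_iff, hres, hp])
      rw [wordOf_congr (S := S) (by intro s; simp [(hA' s).symm])] at hv'
      refine ⟨v', g :: x, y, ?_, by simp [hxy], (Exec.loop_step hcond hbody h).cast ?_ ?_⟩
      · rw [hv', List.infix_cons_iff]; simp [hp]
      · funext k
        by_cases hk : k = A
        · subst hk; simp [hA₄]
        · by_cases hk' : k = WK.t4
          · subst hk'; simp [hA₄.symm]
          · simp [hk, hk']
      · rw [List.length_cons, add_one_mul w.length]; omega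

theorem infixTest_exec {n : ℕ} {ps : List (G ⊕ Src J)} {A : WK J}
    (hA : A ∉ [WK.t1, WK.t2, WK.t3, WK.t4]) (hA' : ∀ s, A ≠ WK.src s) (S : WK J → List G)
    (v : Reg G M) (hn : ∀ s, (S (WK.src s)).length ≤ n) (hl : (S A).length ≤ n)
    (hne : wordOf S ps ≠ []) (hS : Clean S) :
    ∃ v', (v'.res = true ↔ wordOf S ps <:+: S A) ∧
      Exec (infixTest ps A) v S v' S ((n + 1) * ((ps.length + 1) * (30 * (n + 1)))) := by
  obtain ⟨v', x, y, hv', hxy, h⟩ := infixTest_loop (M := M) hA hA' (S A) S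
    (setA { v with res := false } (S A).head?) rfl hn hl hne hS.t1 hS.t2 hS.t3 rfl rfl
  simp only [List.mem_cons, List.not_mem_nil, or_false, not_or] at hA
  obtain ⟨hA₁, hA₂, hA₃, hA₄⟩ : A ≠ WK.t1 ∧ A ≠ WK.t2 ∧ A ≠ WK.t3 ∧ A ≠ WK.t4 := hA
  have hx : x.length ≤ n := by
    have := congrArg List.length hxy
    simp at this; omega
  refine ⟨_, ?_, (Exec.seq Exec.load (Exec.seq Exec.peek (Exec.seq h
    (moveAll_exec (Ne.symm hA₄) _ _)))).cast ?_ ?_⟩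
  · simpa [setA] using hv'
  · funext k
    by_cases hk : k = A
    · subst hk; simp [hA₄, hS.t4, hxy]
    · by_cases hk' : k = WK.t4
      · subst hk'; simp [hk, hS.t4]
      · simp [hk, hk']
  · simp [hS.t4]
    rw [add_one_mul n]
    have h₁ : (S A).length * ((ps.length + 1) * (30 * (n + 1))) ≤
      n * ((ps.length + 1) * (30 * (n + 1))) := Nat.mul_le_mul_right _ hl
    have h₂ : 30 * (n + 1) ≤ (ps.length + 1) * (30 * (n + 1)) :=
      Nat.le_mul_of_pos_left _ (by omega)
    omega

end Words

end Cmd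
end SignedShapley

/-! ### Loops over the active domain -/

namespace SignedShapley

open Function

namespace Cmd

variable {Rel J : Type} {M : ℕ}

/-- The symbols of a binary word. -/
def bits (w : List Bool) : List (InSymbol Rel) := w.map InSymbol.bit

/-- A binary word with delimiters. -/
def encWord (w : List Bool) : List (InSymbol Rel) :=
  -- The symbol `sign false` occurs only at the beginning of a delimited word, which makes infix
  -- search reliable; `sign true` remains free to mark loops.
  InSymbol.sign false :: (bits w ++ [InSymbol.sep])

/-- A list of binary words. -/
def encWords (L : List (List Bool)) : List (InSymbol Rel) := L.flatMap encWord

theorem bits_injective : Injective (bits (Rel := Rel)) :=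
  List.map_injective_iff.2 fun _ _ h => by simpa using h

@[simp]
theorem length_bits (w : List Bool) : (bits (Rel := Rel) w).length = w.length := by simp [bits]

theorem length_bits_le {w : List Bool} {L : List (List Bool)} (hw : w ∈ L) :
    w.length ≤ (encWords (Rel := Rel) L).length := by
  induction L with
  | nil => simp at hw
  | cons w' L ih =>
    rcases List.mem_cons.1 hw with rfl | hw
    · simp [encWords, encWord]; omega
    · have := ih hw
      simp only [encWords, List.flatMap_cons, List.length_append] at *
      omega

theorem length_le_encWords (L : List (List Bool)) : L.length ≤ (encWords (Rel := Rel) L).length := by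
  induction L with
  | nil => simp
  | cons w L ih =>
    simp only [encWords, encWord, List.flatMap_cons, List.length_append, List.length_cons] at *
    omega

/-- The symbol that starts a delimited binary word. -/
def isHead : InSymbol Rel → Bool
  | .sign false => true
  | _ => false

/-- Any symbol but the marker of a loop. -/
def notMark : InSymbol Rel → Bool
  | .sign true => false
  | _ => true

/-- Any symbol but the end marker of constants. -/
def notSep : InSymbol Rel → Bool
  | .sep => false
  | _ => true

/-- Start a loop over the active domain for the variable `j`. -/
def iterInit (j : J) : Cmd (WK J) (InSymbol Rel) (Reg (InSymbol Rel) M) :=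
  seq (push WK.loop fun _ => InSymbol.sign true) (seq
    (xfer (fun _ => true) (WK.src (Src.var j)) [WK.loop]) (seq
    (push WK.loop fun _ => InSymbol.sign true) (copy WK.dom WK.loop WK.t3)))

/-- Load the next constant of a loop. -/
def iterNext (s : Src J) : Cmd (WK J) (InSymbol Rel) (Reg (InSymbol Rel) M) :=
  seq (pop WK.loop fun v _ => v) (seq (xfer notSep WK.loop [WK.t3]) (seq
    (xfer (fun _ => true) WK.t3 [WK.src s]) (pop WK.loop fun v _ => v)))

/-- End a loop and restore the variable. -/
def iterFin (j : J) : Cmd (WK J) (InSymbol Rel) (Reg (InSymbol Rel) M) :=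
  seq (xfer notMark WK.loop []) (seq (pop WK.loop fun v _ => v) (seq
    (xfer notMark WK.loop [WK.src (Src.var j)]) (pop WK.loop fun v _ => v)))

/-- A loop owns a frame on `WK.loop`: from the top, the constants still to be visited, a mark, the
former value of the variable in reverse, and a second mark. Frames of nested loops lie on top of
each other, so a single stack serves any depth. -/
theorem iterInit_exec (j : J) (S : WK J → List (InSymbol Rel)) (h₃ : S WK.t3 = [])
    (v : Reg (InSymbol Rel) M) :
    ∃ v', Exec (iterInit j) v S v' (update (update S WK.loop (S WK.dom ++
      (InSymbol.sign true :: ((S (WK.src (Src.var j))).reverse ++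
        InSymbol.sign true :: S WK.loop)))) (WK.src (Src.var j)) [])
      (5 * ((S (WK.src (Src.var j))).length + 1) + 11 * ((S WK.dom).length + 1) + 2) := by
  refine ⟨_, (Exec.push.seq ((moveAll_exec (by simp) _ _).seq (Exec.push.seq
    (copy_exec (by simp) (by simp) (by simp) _ _ ?_)))).cast ?_ ?_⟩
  · simp [h₃]
  · funext k
    by_cases hk : k = WK.loop
    · subst hk; simp
    · by_cases hk' : k = WK.src (Src.var j)
      · subst hk'; simp
      · simp [hk, hk']
  · simp; omega

/-- The first symbol `x` is arbitrary, so that the same program can also read a constant from a list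
of facts, below a dummy symbol. The passage through `WK.t3` undoes the reversal. -/
theorem iterNext_exec (s : Src J) (S : WK J → List (InSymbol Rel)) (h₃ : S WK.t3 = [])
    (x : InSymbol Rel) (w : List Bool) (rest : List (InSymbol Rel))
    (hl : S WK.loop = x :: (bits w ++ InSymbol.sep :: rest))
    (hs : S (WK.src s) = []) (v : Reg (InSymbol Rel) M) :
    ∃ v', Exec (iterNext s) v S v' (update (update S WK.loop rest) (WK.src s) (bits w))
      (10 * (w.length + 1) + 2) := by
  refine ⟨_, (Exec.pop.seq ((move_exec (by simp) (bits w) (InSymbol.sep :: rest) ?_ ?_ _ _ ?_).seq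
    ((moveAll_exec (by simp) _ _).seq Exec.pop))).cast ?_ ?_⟩
  · intro x hx
    simp only [bits, List.mem_map] at hx
    obtain ⟨b, _, rfl⟩ := hx
    rfl
  · rfl
  · simp [hl]
  · funext k
    by_cases hk : k = WK.loop
    · subst hk; simp
    · by_cases hk' : k = WK.src s
      · subst hk'; simp [h₃, hs]
      · by_cases hk'' : k = WK.t3
        · subst hk''; simp [h₃]
        · simp [hk, hk', hk'']
  · simp [h₃]; omega

theorem notMark_bits (u : List Bool) : ∀ x ∈ (bits (Rel := Rel) u).reverse, notMark x = true := by
  intro x hx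
  simp only [bits, List.mem_reverse, List.mem_map] at hx
  obtain ⟨b, _, rfl⟩ := hx
  rfl

theorem notMark_encWords (L : List (List Bool)) :
    ∀ x ∈ encWords (Rel := Rel) L, notMark x = true := by
  intro x hx
  simp only [encWords, encWord, List.mem_flatMap, List.mem_cons, List.mem_append, bits,
    List.mem_map, List.not_mem_nil, or_false] at hx
  obtain ⟨w, _, rfl | ⟨b, _, rfl⟩ | rfl⟩ := hx <;> rfl

/-- The list `L` of unvisited constants may be nonempty, because a search stops at the first
success. The result `res` of the search survives the cleanup. -/
theorem iterFin_exec (j : J) (S : WK J → List (InSymbol Rel)) (L : List (List Bool))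
    (u : List Bool) (old : List (InSymbol Rel))
    (hl : S WK.loop = encWords L ++ (InSymbol.sign true :: ((bits u).reverse ++
        InSymbol.sign true :: old))) (hs : S (WK.src (Src.var j)) = [])
    (v : Reg (InSymbol Rel) M) :
    ∃ v', v'.res = v.res ∧
      Exec (iterFin j) v S v' (update (update S WK.loop old) (WK.src (Src.var j)) (bits u))
      (4 * ((encWords (Rel := Rel) L).length + 1) + 5 * (u.length + 1) + 2) := by
  refine ⟨_, ?_, ((drop_exec (encWords L) _ (notMark_encWords L) ?_ _ _ hl).seq (Exec.pop.seq
    ((move_exec (by simp) (bits u).reverse (InSymbol.sign true :: old) (notMark_bits u) rfl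
      _ _ ?_).seq Exec.pop))).cast ?_ ?_⟩
  · rfl
  · rfl
  · simp
  · funext k
    by_cases hk : k = WK.loop
    · subst hk; simp
    · by_cases hk' : k = WK.src (Src.var j)
      · subst hk'; simp [hs]
      · simp [hk, hk']
  · simp; omega

/-- A loop over the active domain is not finished. -/
def atHead (v : Reg (InSymbol Rel) M) : Bool := v.a.any isHead

/-- A loop over the active domain is not finished, and its test has not succeeded yet. -/
def more (v : Reg (InSymbol Rel) M) : Bool := !v.res && v.a.any isHead

/-- Test whether some constant of the active domain passes a test. -/
def iterEx (j : J) (body : Cmd (WK J) (InSymbol Rel) (Reg (InSymbol Rel) M)) :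
    Cmd (WK J) (InSymbol Rel) (Reg (InSymbol Rel) M) :=
  seq (iterInit j) (seq (load fun v => { v with res := false }) (seq (peek WK.loop setA) (seq
    (loop more (seq (iterNext (Src.var j)) (seq body (seq
      (xfer (fun _ => true) (WK.src (Src.var j)) []) (peek WK.loop setA)))))
    (iterFin j))))

/-- Run a program for all constants of the active domain. -/
def iterAll (j : J) (body : Cmd (WK J) (InSymbol Rel) (Reg (InSymbol Rel) M)) :
    Cmd (WK J) (InSymbol Rel) (Reg (InSymbol Rel) M) :=
  seq (iterInit j) (seq (peek WK.loop setA) (seq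
    (loop atHead (seq (iterNext (Src.var j)) (seq body (seq
      (xfer (fun _ => true) (WK.src (Src.var j)) []) (peek WK.loop setA)))))
    (iterFin j)))

theorem encWords_cons_append (w : List Bool) (L : List (List Bool)) (R : List (InSymbol Rel)) :
    encWords (w :: L) ++ R = InSymbol.sign false :: (bits w ++ InSymbol.sep :: (encWords L ++ R)) :=
  by simp [encWords, encWord]

/-- The body is assumed to work for every content `l` of `WK.loop`, as this stack shrinks from round
to round, and to restore all stacks. The list `L'` is what an early success leaves unvisited. -/
theorem iterEx_loop {j : J} {body : Cmd (WK J) (InSymbol Rel) (Reg (InSymbol Rel) M)}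
    {P : List Bool → Prop} {tb n : ℕ} (T : WK J → List (InSymbol Rel)) (h₃ : T WK.t3 = [])
    (R : List (InSymbol Rel)) (L : List (List Bool)) (hn : ∀ w ∈ L, w.length ≤ n)
    (hbody : ∀ w ∈ L, ∀ (l : List (InSymbol Rel)) (v : Reg (InSymbol Rel) M), ∃ v',
      (v'.res = true ↔ P w) ∧
        Exec body v (update (update T WK.loop l) (WK.src (Src.var j)) (bits w)) v'
          (update (update T WK.loop l) (WK.src (Src.var j)) (bits w)) tb) :
    ∀ v : Reg (InSymbol Rel) M, v.res = false →
      v.a = (encWords L ++ InSymbol.sign true :: R).head? →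
      ∃ v' L', (v'.res = true ↔ ∃ w ∈ L, P w) ∧
        (encWords (Rel := Rel) L').length ≤ (encWords (Rel := Rel) L).length ∧
        Exec (loop more
          (seq (iterNext (Src.var j)) (seq body (seq
            (xfer (fun _ => true) (WK.src (Src.var j)) []) (peek WK.loop setA)))))
          v (update (update T WK.loop (encWords L ++ InSymbol.sign true :: R))
            (WK.src (Src.var j)) []) v'
          (update (update T WK.loop (encWords L' ++ InSymbol.sign true :: R))
            (WK.src (Src.var j)) []) (L.length * (tb + 20 * (n + 1)) + 1) := by
  induction L with
  | nil =>
    intro v hr ha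
    refine ⟨v, [], by simp [hr], le_rfl, (Exec.loop_done ?_).mono (by omega)⟩
    simp [more, ha, encWords, isHead]
  | cons w L ih =>
    intro v hr ha
    rw [encWords_cons_append] at ha ⊢
    obtain ⟨v₁, c₁⟩ := iterNext_exec (Src.var j) (update (update T WK.loop (InSymbol.sign false ::
      (bits w ++ InSymbol.sep :: (encWords L ++ InSymbol.sign true :: R)))) (WK.src (Src.var j)) [])
      (by simp [h₃]) (InSymbol.sign false) w (encWords L ++ InSymbol.sign true :: R) (by simp)
      (by simp) v
    have e₁ : update (update (update (update T WK.loop (InSymbol.sign false ::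
        (bits w ++ InSymbol.sep :: (encWords L ++ InSymbol.sign true :: R))))
        (WK.src (Src.var j)) []) WK.loop (encWords L ++ InSymbol.sign true :: R))
        (WK.src (Src.var j)) (bits w) =
        update (update T WK.loop (encWords L ++ InSymbol.sign true :: R))
          (WK.src (Src.var j)) (bits w) := by
      funext k
      by_cases hk : k = WK.loop
      · subst hk; simp
      · by_cases hk' : k = WK.src (Src.var j)
        · subst hk'; simp
        · simp [hk, hk']
    rw [e₁] at c₁
    obtain ⟨v₂, hv₂, c₂⟩ := hbody w (by simp) (encWords L ++ InSymbol.sign true :: R) v₁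
    have c₃ := clear_exec (WK.src (Src.var j)) v₂
      (update (update T WK.loop (encWords L ++ InSymbol.sign true :: R))
          (WK.src (Src.var j)) (bits w))
    rw [update_idem, update_self, length_bits] at c₃
    have c₄ := @Exec.peek (WK J) (InSymbol Rel) (Reg (InSymbol Rel) M) _ WK.loop setA
      (setA v₂ none) (update (update T WK.loop (encWords L ++ InSymbol.sign true :: R))
          (WK.src (Src.var j)) [])
    rw [update_of_ne (by simp), update_self] at c₄
    have hcond : more v = true := by
      simp [more, hr, ha, isHead]
    have hlen := hn w (by simp)
    by_cases hp : P w
    · refine ⟨_, L, ?_, by simp [encWords],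
        (Exec.loop_step hcond (c₁.seq (c₂.seq (c₃.seq c₄))) (Exec.loop_done ?_)).mono ?_⟩
      · simp [setA, hv₂, hp]
      · simp [more, setA, hv₂.2 hp]
      · rw [List.length_cons, add_one_mul L.length]; omega
    · obtain ⟨v', L', hv', hL', h⟩ := ih (fun w hw => hn w (by simp [hw]))
        (fun w hw => hbody w (by simp [hw]))
        (setA (setA v₂ none) (encWords L ++ InSymbol.sign true :: R).head?)
        (by simp [setA, Bool.eq_false_iff, hv₂, hp]) rfl
      refine ⟨v', L', by simp [hv', hp], hL'.trans (by simp [encWords]),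
        (Exec.loop_step hcond (c₁.seq (c₂.seq (c₃.seq c₄))) h).mono ?_⟩
      rw [List.length_cons, add_one_mul L.length]; omega

theorem iterEx_exec {j : J} {body : Cmd (WK J) (InSymbol Rel) (Reg (InSymbol Rel) M)}
    {P : List Bool → Prop} {tb n : ℕ} (S : WK J → List (InSymbol Rel)) (h₃ : S WK.t3 = [])
    (L : List (List Bool)) (hL : S WK.dom = encWords L)
    (hn : (encWords (Rel := Rel) L).length ≤ n)
    (u : List Bool) (hu : S (WK.src (Src.var j)) = bits u) (hu' : u.length ≤ n)
    (hbody : ∀ w ∈ L, ∀ (l : List (InSymbol Rel)) (v : Reg (InSymbol Rel) M), ∃ v',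
      (v'.res = true ↔ P w) ∧
        Exec body v (update (update S WK.loop l) (WK.src (Src.var j)) (bits w)) v'
          (update (update S WK.loop l) (WK.src (Src.var j)) (bits w)) tb)
    (v : Reg (InSymbol Rel) M) :
    ∃ v', (v'.res = true ↔ ∃ w ∈ L, P w) ∧
      Exec (iterEx j body) v S v' S ((n + 1) * (tb + 40 * (n + 1))) := by
  obtain ⟨v₁, c₁⟩ := iterInit_exec j S h₃ v
  rw [hL, hu] at c₁
  obtain ⟨v₂, L', hv₂, hL', c₂⟩ := iterEx_loop S h₃
    ((bits u).reverse ++ InSymbol.sign true :: S WK.loop) L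
    (fun w hw => (length_bits_le hw).trans hn) hbody
    (setA { v₁ with res := false } (encWords L ++ InSymbol.sign true :: ((bits u).reverse ++
      InSymbol.sign true :: S WK.loop)).head?) rfl rfl
  obtain ⟨v₃, hv₃, c₃⟩ := iterFin_exec j (update (update S WK.loop (encWords L' ++
    InSymbol.sign true :: ((bits u).reverse ++ InSymbol.sign true :: S WK.loop)))
    (WK.src (Src.var j)) []) L' u (S WK.loop) (by simp) (by simp) v₂
  have c₀ := @Exec.peek (WK J) (InSymbol Rel) (Reg (InSymbol Rel) M) _ WK.loop setA
      { v₁ with res := false } (update (update S WK.loop (encWords L ++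
    InSymbol.sign true :: ((bits u).reverse ++ InSymbol.sign true :: S WK.loop)))
    (WK.src (Src.var j)) [])
  rw [update_of_ne (by simp), update_self] at c₀
  refine ⟨v₃, by rw [hv₃, hv₂], (c₁.seq (Exec.load.seq (c₀.seq (c₂.seq c₃)))).cast ?_ ?_⟩
  · funext k
    by_cases hk : k = WK.loop
    · subst hk; simp
    · by_cases hk' : k = WK.src (Src.var j)
      · subst hk'; simp [hu]
      · simp [hk, hk']
  · have h₁ : L.length * (tb + 20 * (n + 1)) ≤ n * (tb + 20 * (n + 1)) :=
      Nat.mul_le_mul_right _ ((length_le_encWords L).trans hn)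
    have h₂ : (n + 1) * (tb + 40 * (n + 1)) =
      n * (tb + 20 * (n + 1)) + tb + 20 * (n * (n + 1)) + 40 * (n + 1) := by ring
    rw [length_bits, h₂]
    omega

/-- Here the body may change the counter, by adding `N w` symbols; hence the hypothesis is for all
contents `c` of it, and the increments add up over `L`. -/
theorem iterAll_loop {j : J} {body : Cmd (WK J) (InSymbol Rel) (Reg (InSymbol Rel) M)}
    {N : List Bool → ℕ} {tb n : ℕ} (T : WK J → List (InSymbol Rel)) (h₃ : T WK.t3 = [])
    (R : List (InSymbol Rel)) (L : List (List Bool)) (hn : ∀ w ∈ L, w.length ≤ n)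
    (hbody : ∀ w ∈ L, ∀ (l c : List (InSymbol Rel)) (v : Reg (InSymbol Rel) M), ∃ v',
        Exec body v (update (update (update T WK.loop l) (WK.src (Src.var j)) (bits w)) WK.cnt c) v'
          (update (update (update T WK.loop l) (WK.src (Src.var j)) (bits w)) WK.cnt
            (List.replicate (N w) InSymbol.sep ++ c)) tb) :
    ∀ (v : Reg (InSymbol Rel) M) (c : List (InSymbol Rel)),
      v.a = (encWords L ++ InSymbol.sign true :: R).head? →
      ∃ v',
        Exec (loop atHead
          (seq (iterNext (Src.var j)) (seq body (seq
            (xfer (fun _ => true) (WK.src (Src.var j)) []) (peek WK.loop setA)))))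
          v (update (update (update T WK.loop (encWords L ++ InSymbol.sign true :: R))
            (WK.src (Src.var j)) []) WK.cnt c) v'
          (update (update (update T WK.loop (InSymbol.sign true :: R))
            (WK.src (Src.var j)) []) WK.cnt
              (List.replicate (L.map N).sum InSymbol.sep ++ c))
          (L.length * (tb + 20 * (n + 1)) + 1) := by
  induction L with
  | nil =>
    intro v c ha
    refine ⟨v, (Exec.loop_done ?_).cast (by simp [encWords]) (by omega)⟩
    simp [atHead, ha, encWords, isHead]
  | cons w L ih =>
    intro v c ha
    rw [encWords_cons_append] at ha ⊢
    obtain ⟨v₁, c₁⟩ := iterNext_exec (Src.var j) (update (update (update T WK.loop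
      (InSymbol.sign false :: (bits w ++ InSymbol.sep :: (encWords L ++ InSymbol.sign true :: R))))
      (WK.src (Src.var j)) []) WK.cnt c)
      (by simp [h₃]) (InSymbol.sign false) w (encWords L ++ InSymbol.sign true :: R) (by simp)
      (by simp) v
    have e₁ : update (update (update (update (update T WK.loop (InSymbol.sign false ::
        (bits w ++ InSymbol.sep :: (encWords L ++ InSymbol.sign true :: R))))
        (WK.src (Src.var j)) []) WK.cnt c) WK.loop (encWords L ++ InSymbol.sign true :: R))
        (WK.src (Src.var j)) (bits w) =
        update (update (update T WK.loop (encWords L ++ InSymbol.sign true :: R))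
          (WK.src (Src.var j)) (bits w)) WK.cnt c := by
      funext k
      by_cases hk : k = WK.loop
      · subst hk; simp
      · by_cases hk' : k = WK.src (Src.var j)
        · subst hk'; simp
        · simp [hk, hk', update_apply]
    rw [e₁] at c₁
    obtain ⟨v₂, c₂⟩ := hbody w (by simp) (encWords L ++ InSymbol.sign true :: R) c v₁
    have c₃ := clear_exec (WK.src (Src.var j)) v₂
      (update (update (update T WK.loop (encWords L ++ InSymbol.sign true :: R))
          (WK.src (Src.var j)) (bits w)) WK.cnt (List.replicate (N w) InSymbol.sep ++ c))
    have e₂ : update (update (update (update T WK.loop (encWords L ++ InSymbol.sign true :: R))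
        (WK.src (Src.var j)) (bits w)) WK.cnt (List.replicate (N w) InSymbol.sep ++ c))
        (WK.src (Src.var j)) [] = update (update (update T WK.loop (encWords L ++
        InSymbol.sign true :: R)) (WK.src (Src.var j)) []) WK.cnt
          (List.replicate (N w) InSymbol.sep ++ c) := by
      rw [update_comm (show (WK.cnt : WK J) ≠ WK.src (Src.var j) by simp), update_idem]
    rw [e₂, update_of_ne (by simp), update_self, length_bits] at c₃
    have c₄ := @Exec.peek (WK J) (InSymbol Rel) (Reg (InSymbol Rel) M) _ WK.loop setA
      (setA v₂ none) (update (update (update T WK.loop (encWords L ++ InSymbol.sign true :: R))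
          (WK.src (Src.var j)) []) WK.cnt (List.replicate (N w) InSymbol.sep ++ c))
    rw [update_of_ne (by simp), update_of_ne (by simp), update_self] at c₄
    have hcond : atHead v = true := by
      simp [atHead, ha, isHead]
    have hlen := hn w (by simp)
    obtain ⟨v', h⟩ := ih (fun w hw => hn w (by simp [hw]))
      (fun w hw => hbody w (by simp [hw]))
      (setA (setA v₂ none) (encWords L ++ InSymbol.sign true :: R).head?)
      (List.replicate (N w) InSymbol.sep ++ c) rfl
    refine ⟨v', (Exec.loop_step hcond (c₁.seq (c₂.seq (c₃.seq c₄))) h).cast ?_ ?_⟩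
    · rw [← List.append_assoc, List.replicate_append_replicate, List.map_cons, List.sum_cons,
        Nat.add_comm (N w)]
    · rw [List.length_cons, add_one_mul L.length]; omega

theorem iterAll_exec {j : J} {body : Cmd (WK J) (InSymbol Rel) (Reg (InSymbol Rel) M)}
    {N : List Bool → ℕ} {tb n : ℕ} (S : WK J → List (InSymbol Rel)) (h₃ : S WK.t3 = [])
    (L : List (List Bool)) (hL : S WK.dom = encWords L)
    (hn : (encWords (Rel := Rel) L).length ≤ n)
    (u : List Bool) (hu : S (WK.src (Src.var j)) = bits u) (hu' : u.length ≤ n)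
    (hbody : ∀ w ∈ L, ∀ (l c : List (InSymbol Rel)) (v : Reg (InSymbol Rel) M), ∃ v',
        Exec body v (update (update (update S WK.loop l) (WK.src (Src.var j)) (bits w)) WK.cnt c) v'
          (update (update (update S WK.loop l) (WK.src (Src.var j)) (bits w)) WK.cnt
            (List.replicate (N w) InSymbol.sep ++ c)) tb)
    (v : Reg (InSymbol Rel) M) :
    ∃ v', Exec (iterAll j body) v S v'
      (update S WK.cnt (List.replicate (L.map N).sum InSymbol.sep ++ S WK.cnt))
      ((n + 1) * (tb + 40 * (n + 1))) := by
  obtain ⟨v₁, c₁⟩ := iterInit_exec j S h₃ v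
  rw [hL, hu] at c₁
  obtain ⟨v₂, c₂⟩ := iterAll_loop S h₃
    ((bits u).reverse ++ InSymbol.sign true :: S WK.loop) L
    (fun w hw => (length_bits_le hw).trans hn) hbody
    (setA v₁ (encWords L ++ InSymbol.sign true :: ((bits u).reverse ++
      InSymbol.sign true :: S WK.loop)).head?) (S WK.cnt) rfl
  obtain ⟨v₃, -, c₃⟩ := iterFin_exec j (update (update (update S WK.loop (
    InSymbol.sign true :: ((bits u).reverse ++ InSymbol.sign true :: S WK.loop)))
    (WK.src (Src.var j)) []) WK.cnt (List.replicate (L.map N).sum InSymbol.sep ++ S WK.cnt))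
    [] u (S WK.loop) (by simp [encWords]) (by simp) v₂
  have c₀ := @Exec.peek (WK J) (InSymbol Rel) (Reg (InSymbol Rel) M) _ WK.loop setA
      v₁ (update (update S WK.loop (encWords L ++
    InSymbol.sign true :: ((bits u).reverse ++ InSymbol.sign true :: S WK.loop)))
    (WK.src (Src.var j)) [])
  rw [update_of_ne (by simp), update_self] at c₀
  have e : update (update (update S WK.loop (encWords L ++
      InSymbol.sign true :: ((bits u).reverse ++ InSymbol.sign true :: S WK.loop)))
      (WK.src (Src.var j)) []) WK.cnt (S WK.cnt) = update (update S WK.loop (encWords L ++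
      InSymbol.sign true :: ((bits u).reverse ++ InSymbol.sign true :: S WK.loop)))
      (WK.src (Src.var j)) [] := update_eq_self_iff.2 (by simp)
  rw [e] at c₂
  refine ⟨v₃, (c₁.seq (c₀.seq (c₂.seq c₃))).cast ?_ ?_⟩
  · funext k
    by_cases hk : k = WK.loop
    · subst hk; simp
    · by_cases hk' : k = WK.src (Src.var j)
      · subst hk'; simp [hu]
      · simp [hk, hk', update_apply]
  · have h₁ : L.length * (tb + 20 * (n + 1)) ≤ n * (tb + 20 * (n + 1)) :=
      Nat.mul_le_mul_right _ ((length_le_encWords L).trans hn)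
    have h₂ : (n + 1) * (tb + 40 * (n + 1)) =
      n * (tb + 20 * (n + 1)) + tb + 20 * (n * (n + 1)) + 40 * (n + 1) := by ring
    have h₃ : (encWords (Rel := Rel) []).length = 0 := rfl
    rw [length_bits, h₂, h₃]
    omega

end Cmd
end SignedShapley

namespace SignedShapley

open Function

/-! ### Properties and counts that programs can compute from the stacks -/

/-- The data that a program can refer to: a list of facts, a signed fact, a list of distinct constants. -/
structure Ctx (S : Schema) (Const : Type) where
  facts : List (Fact S Const)
  α : Fact S.signed Const
  L : List Const
  nodup : L.Nodup

namespace Cmd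

variable {S : Schema} {Const J : Type} {M : ℕ} (enc : Computability.Encoding Const Bool)

/-- The content of a source stack. -/
def srcWord (ctx : Ctx S Const) (ν : J → Const) : Src J → List (InSymbol S.Rel)
  | .var j => bits (enc.encode (ν j))
  | .alpha => encodeSignedFact enc ctx.α
  | .cur => []

/-- The word that is the concatenation of symbols and contents of source stacks. -/
def ctxWord (ctx : Ctx S Const) (ν : J → Const) (ps : List (InSymbol S.Rel ⊕ Src J)) :
    List (InSymbol S.Rel) :=
  ps.flatMap (Sum.elim (fun g => [g]) (srcWord enc ctx ν))

/-- The stacks represent the context and the valuation, and are not longer than `n`. -/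
structure Good (ctx : Ctx S Const) (ν : J → Const) (n : ℕ) (T : WK J → List (InSymbol S.Rel)) :
    Prop where
  clean : Clean T
  facts : T WK.facts = ctx.facts.flatMap (encodeFact enc)
  src : ∀ s, T (WK.src s) = srcWord enc ctx ν s
  dom : T WK.dom = encWords (ctx.L.map enc.encode)
  facts_le : (T WK.facts).length ≤ n
  src_le : ∀ s, (T (WK.src s)).length ≤ n
  dom_le : (T WK.dom).length ≤ n

variable {enc}

theorem Good.wordOf {ctx : Ctx S Const} {ν : J → Const} {n : ℕ} {T : WK J → List (InSymbol S.Rel)}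
    (h : Good enc ctx ν n T) (ps : List (InSymbol S.Rel ⊕ Src J)) :
    Cmd.wordOf T ps = ctxWord enc ctx ν ps := by
  simp only [Cmd.wordOf, ctxWord, h.src]

/-- The code of a constant of the active domain is no longer than the stack `WK.dom`, so the size
bound `n` does not grow as loops are nested. This keeps the running time of nested loops polynomial.
-/
theorem Good.update_loop [DecidableEq J] {ctx : Ctx S Const} {ν : J → Const} {n : ℕ}
    {T : WK J → List (InSymbol S.Rel)} (h : Good enc ctx ν n T) {c : Const} (hc : c ∈ ctx.L) (j : J)
    (l : List (InSymbol S.Rel)) :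
    Good enc ctx (update ν j c) n
      (update (update T WK.loop l) (WK.src (Src.var j)) (bits (enc.encode c))) where
  clean := ⟨by simp [h.clean.t1], by simp [h.clean.t2], by simp [h.clean.t3], by simp [h.clean.t4]⟩
  facts := by simp [h.facts]
  dom := by simp [h.dom]
  facts_le := by simp [h.facts_le]
  dom_le := by simp [h.dom_le]
  src := by
    intro s
    by_cases hs : s = Src.var j
    · subst hs; simp [srcWord]
    · rw [update_of_ne (by simpa using hs), update_of_ne (by simp), h.src]
      rcases s with i | _ | _
      · have : i ≠ j := fun h => hs (by rw [h])
        simp [srcWord, this]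
      · rfl
      · rfl
  src_le := by
    intro s
    by_cases hs : s = Src.var j
    · subst hs
      have h₁ := length_bits_le (Rel := S.Rel) (List.mem_map_of_mem (f := enc.encode) hc)
      rw [← h.dom] at h₁
      simpa using h₁.trans h.dom_le
    · rw [update_of_ne (by simpa using hs), update_of_ne (by simp)]
      exact h.src_le s

theorem Good.update_cnt {ctx : Ctx S Const} {ν : J → Const} {n : ℕ}
    {T : WK J → List (InSymbol S.Rel)} (h : Good enc ctx ν n T) (l : List (InSymbol S.Rel)) :
    Good enc ctx ν n (update T WK.cnt l) where
  clean := ⟨by simp [h.clean.t1], by simp [h.clean.t2], by simp [h.clean.t3], by simp [h.clean.t4]⟩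
  facts := by simp [h.facts]
  dom := by simp [h.dom]
  facts_le := by simp [h.facts_le]
  dom_le := by simp [h.dom_le]
  src := by simp [h.src]
  src_le := by simpa using h.src_le

variable (enc M)

/-- Some program decides `P` in polynomial time. -/
def Dec (P : Ctx S Const → (J → Const) → Prop) : Prop :=
  ∃ (c : Cmd (WK J) (InSymbol S.Rel) (Reg (InSymbol S.Rel) M)) (p : Polynomial ℕ),
    ∀ ctx ν n T v, Good enc ctx ν n T →
      ∃ v', (v'.res = true ↔ P ctx ν) ∧ Exec c v T v' T (p.eval n)

/-- Some program counts up by `N` in polynomial time. -/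
def Counts (N : Ctx S Const → (J → Const) → ℕ) : Prop :=
  ∃ (c : Cmd (WK J) (InSymbol S.Rel) (Reg (InSymbol S.Rel) M)) (p : Polynomial ℕ),
    ∀ ctx ν n T v, Good enc ctx ν n T →
      ∃ v', Exec c v T v'
        (update T WK.cnt (List.replicate (N ctx ν) InSymbol.sep ++ T WK.cnt)) (p.eval n)

variable {enc M} {P Q : Ctx S Const → (J → Const) → Prop} {N N' : Ctx S Const → (J → Const) → ℕ}

theorem Dec.congr (hP : Dec M enc P) (h : ∀ ctx ν, P ctx ν ↔ Q ctx ν) : Dec M enc Q := by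
  have : P = Q := by funext ctx ν; exact propext (h ctx ν)
  exact this ▸ hP

/-- The proposition does not depend on the input, so its truth value is built into the program and
need not be computed. -/
theorem Dec.const (p : Prop) : Dec (S := S) (J := J) M enc fun _ _ => p := by
  classical
  refine ⟨load fun v => { v with res := decide p }, 1, fun ctx ν n T v _ => ⟨_, ?_,
    Exec.load.mono (by simp)⟩⟩
  simp

theorem Dec.not (hP : Dec M enc P) : Dec M enc fun ctx ν => ¬P ctx ν := by
  obtain ⟨c, p, h⟩ := hP
  refine ⟨seq c (load fun v => { v with res := !v.res }), p + 1, fun ctx ν n T v hT => ?_⟩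
  obtain ⟨v', hv', hc⟩ := h ctx ν n T v hT
  refine ⟨_, ?_, (hc.seq Exec.load).mono (by simp)⟩
  simp [← hv']

theorem Dec.and (hP : Dec M enc P) (hQ : Dec M enc Q) :
    Dec M enc fun ctx ν => P ctx ν ∧ Q ctx ν := by
  obtain ⟨c, p, h⟩ := hP
  obtain ⟨d, q, h'⟩ := hQ
  refine ⟨seq c (ite (fun v => v.res) d skip), p + (q + 2), fun ctx ν n T v hT => ?_⟩
  obtain ⟨v₁, hv₁, h₁⟩ := h ctx ν n T v hT
  obtain ⟨v₂, hv₂, h₂⟩ := h' ctx ν n T v₁ hT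
  by_cases hp : P ctx ν
  · refine ⟨v₂, by simp [hv₂, hp], (h₁.seq (h₂.ite_true (hv₁.2 hp))).mono (by simp)⟩
  · refine ⟨v₁, by simp [hv₁, hp], (h₁.seq (Exec.ite_false ?_ (Exec.load))).mono (by simp)⟩
    simpa [← hv₁] using hp

theorem Dec.or (hP : Dec M enc P) (hQ : Dec M enc Q) :
    Dec M enc fun ctx ν => P ctx ν ∨ Q ctx ν :=
  (hP.not.and hQ.not).not.congr fun _ _ => by tauto

/-- The list belongs to the query and not to the input: the conjunction is unrolled into the
program. -/
theorem Dec.forall_mem {ι : Type*} {P : ι → Ctx S Const → (J → Const) → Prop} (l : List ι)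
    (h : ∀ i ∈ l, Dec M enc (P i)) : Dec M enc fun ctx ν => ∀ i ∈ l, P i ctx ν := by
  induction l with
  | nil => exact (Dec.const True).congr (by simp)
  | cons i l ih =>
    exact ((h i (by simp)).and (ih fun j hj => h j (by simp [hj]))).congr (by simp)

theorem Dec.exists_mem {ι : Type*} {P : ι → Ctx S Const → (J → Const) → Prop} (l : List ι)
    (h : ∀ i ∈ l, Dec M enc (P i)) : Dec M enc fun ctx ν => ∃ i ∈ l, P i ctx ν := by
  induction l with
  | nil => exact (Dec.const False).congr (by simp)
  | cons i l ih =>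
    exact ((h i (by simp)).or (ih fun j hj => h j (by simp [hj]))).congr (by simp)

/-- A quantifier over the active domain costs one loop, which multiplies the time by a linear factor
up to a quadratic overhead. A fixed number of quantifiers stays polynomial. -/
theorem Dec.ex [DecidableEq J] (hP : Dec M enc P) (j : J) :
    Dec M enc fun ctx ν => ∃ c ∈ ctx.L, P ctx (update ν j c) := by
  obtain ⟨c, p, h⟩ := hP
  refine ⟨iterEx j c, (Polynomial.X + 1) * (p + 40 * (Polynomial.X + 1)), fun ctx ν n T v hT => ?_⟩
  have hvar := hT.src (Src.var j)
  have key := fun hb => iterEx_exec (j := j) (body := c)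
    -- The loop handles words, not constants; injectivity of the code recovers the constant.
    (P := fun w => ∃ c, enc.encode c = w ∧ P ctx (update ν j c)) (tb := p.eval n) (n := n) T
    hT.clean.t3 (ctx.L.map enc.encode) hT.dom (hT.dom ▸ hT.dom_le) (enc.encode (ν j)) hvar
    (by have := hT.src_le (Src.var j); rw [hvar] at this; simpa [srcWord] using this) hb v
  obtain ⟨v', hv', h'⟩ := key (by
    intro w hw l v
    obtain ⟨c', hc', rfl⟩ := List.mem_map.1 hw
    obtain ⟨v'', hv'', e⟩ := h ctx _ n _ v (hT.update_loop hc' j l)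
    refine ⟨v'', ?_, e⟩
    rw [hv'']
    constructor
    · intro hp; exact ⟨c', rfl, hp⟩
    · rintro ⟨c'', e, hp⟩
      obtain rfl := enc.encode_injective e
      exact hp)
  refine ⟨v', ?_, h'.mono (by simp)⟩
  rw [hv']
  constructor
  · rintro ⟨w, hw, c, rfl, hc⟩
    obtain ⟨c', hc', e⟩ := List.mem_map.1 hw
    obtain rfl := enc.encode_injective e
    exact ⟨c', hc', hc⟩
  · rintro ⟨c, hc, hp⟩
    exact ⟨_, List.mem_map_of_mem hc, c, rfl, hp⟩

theorem Dec.words (ps ps' : List (InSymbol S.Rel ⊕ Src J))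
    (f : Option (InSymbol S.Rel) × Option (InSymbol S.Rel) → Bool) :
    Dec M enc fun ctx ν => f (diff (ctxWord enc ctx ν ps) (ctxWord enc ctx ν ps')) = true := by
  refine ⟨cmpWords ps ps' f, ((ps.length + ps'.length + 1 : ℕ) : Polynomial ℕ) *
    (24 * (Polynomial.X + 1)), fun ctx ν n T v hT => ?_⟩
  obtain ⟨v', hv', h⟩ := cmpWords_exec ps ps' f T hT.src_le hT.clean v
  refine ⟨v', ?_, h.mono (by simp)⟩
  rw [hv', hT.wordOf, hT.wordOf]

theorem Dec.words_eq (ps ps' : List (InSymbol S.Rel ⊕ Src J)) :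
    Dec M enc fun ctx ν => ctxWord enc ctx ν ps = ctxWord enc ctx ν ps' := by
  classical
  exact (Dec.words ps ps' fun d => decide (d = (none, none))).congr fun ctx ν => by
    simp [diff_eq_none]

theorem Dec.infix_facts (ps : List (InSymbol S.Rel ⊕ Src J))
    (hne : ∀ ctx ν, ctxWord enc ctx ν ps ≠ []) :
    Dec M enc fun ctx ν => ctxWord enc ctx ν ps <:+: ctx.facts.flatMap (encodeFact enc) := by
  refine ⟨infixTest ps WK.facts, (Polynomial.X + 1) * (((ps.length + 1 : ℕ) : Polynomial ℕ) *
    (30 * (Polynomial.X + 1))), fun ctx ν n T v hT => ?_⟩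
  obtain ⟨v', hv', h⟩ := infixTest_exec (A := WK.facts) (by simp) (by simp) T v hT.src_le
    hT.facts_le (by rw [hT.wordOf]; exact hne ctx ν) hT.clean
  refine ⟨v', ?_, h.mono (by simp)⟩
  rw [hv', hT.wordOf, hT.facts]

theorem Dec.infix_dom (ps : List (InSymbol S.Rel ⊕ Src J))
    (hne : ∀ ctx ν, ctxWord enc ctx ν ps ≠ []) :
    Dec M enc fun ctx ν => ctxWord enc ctx ν ps <:+: encWords (ctx.L.map enc.encode) := by
  refine ⟨infixTest ps WK.dom, (Polynomial.X + 1) * (((ps.length + 1 : ℕ) : Polynomial ℕ) *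
    (30 * (Polynomial.X + 1))), fun ctx ν n T v hT => ?_⟩
  obtain ⟨v', hv', h⟩ := infixTest_exec (A := WK.dom) (by simp) (by simp) T v hT.src_le
    hT.dom_le (by rw [hT.wordOf]; exact hne ctx ν) hT.clean
  refine ⟨v', ?_, h.mono (by simp)⟩
  rw [hv', hT.wordOf, hT.dom]

theorem Counts.congr (hN : Counts M enc N) (h : ∀ ctx ν, N ctx ν = N' ctx ν) : Counts M enc N' := by
  have : N = N' := by funext ctx ν; exact h ctx ν
  exact this ▸ hN

theorem Counts.const (w : ℕ) : Counts (S := S) (J := J) M enc fun _ _ => w := by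
  induction w with
  | zero =>
    exact ⟨skip, 1, fun ctx ν n T v hT => ⟨v, Exec.load.cast (by simp) (by simp)⟩⟩
  | succ w ih =>
    obtain ⟨c, p, h⟩ := ih
    refine ⟨seq c (push WK.cnt fun _ => InSymbol.sep), p + 1, fun ctx ν n T v hT => ?_⟩
    obtain ⟨v', hv'⟩ := h ctx ν n T v hT
    exact ⟨v', (hv'.seq Exec.push).cast (by simp [List.replicate_succ]) (by simp)⟩

theorem Counts.add (hN : Counts M enc N) (hN' : Counts M enc N') :
    Counts M enc fun ctx ν => N ctx ν + N' ctx ν := by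
  obtain ⟨c, p, h⟩ := hN
  obtain ⟨d, q, h'⟩ := hN'
  refine ⟨seq c d, p + q, fun ctx ν n T v hT => ?_⟩
  obtain ⟨v₁, h₁⟩ := h ctx ν n T v hT
  obtain ⟨v₂, h₂⟩ := h' ctx ν n _ v₁ (hT.update_cnt _)
  refine ⟨v₂, (h₁.seq h₂).cast ?_ (by simp)⟩
  rw [update_idem, update_self, ← List.append_assoc, List.replicate_append_replicate,
    Nat.add_comm (N' ctx ν)]

open scoped Classical in
theorem Counts.guard (hP : Dec M enc P) (hN : Counts M enc N) :
    Counts M enc fun ctx ν => if P ctx ν then N ctx ν else 0 := by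
  obtain ⟨c, p, h⟩ := hP
  obtain ⟨d, q, h'⟩ := hN
  refine ⟨seq c (ite (fun v => v.res) d skip), p + (q + 2), fun ctx ν n T v hT => ?_⟩
  obtain ⟨v₁, hv₁, h₁⟩ := h ctx ν n T v hT
  by_cases hp : P ctx ν
  · obtain ⟨v₂, h₂⟩ := h' ctx ν n T v₁ hT
    exact ⟨v₂, (h₁.seq (h₂.ite_true (hv₁.2 hp))).cast (by simp [hp]) (by simp)⟩
  · refine ⟨v₁, (h₁.seq (Exec.ite_false ?_ (Exec.load))).cast (by simp [hp]) (by simp)⟩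
    simpa [← hv₁] using hp

theorem Counts.list_sum {ι : Type*} {N : ι → Ctx S Const → (J → Const) → ℕ} (l : List ι)
    (h : ∀ i ∈ l, Counts M enc (N i)) : Counts M enc fun ctx ν => (l.map fun i => N i ctx ν).sum := by
  induction l with
  | nil => exact (Counts.const 0).congr (by simp)
  | cons i l ih =>
    exact ((h i (by simp)).add (ih fun j hj => h j (by simp [hj]))).congr (by simp)

theorem Counts.sum [DecidableEq J] (hN : Counts M enc N) (j : J) :
    Counts M enc fun ctx ν => (ctx.L.map fun c => N ctx (update ν j c)).sum := by
  obtain ⟨c, p, h⟩ := hN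
  refine ⟨iterAll j c, (Polynomial.X + 1) * (p + 40 * (Polynomial.X + 1)), fun ctx ν n T v hT => ?_⟩
  have hvar := hT.src (Src.var j)
  have key := fun hb => iterAll_exec (j := j) (body := c)
    -- The default `0` is for words that encode nothing; the loop never meets one.
    (N := fun w => ((enc.decode w).map fun c => N ctx (update ν j c)).getD 0)
    (tb := p.eval n) (n := n) T
    hT.clean.t3 (ctx.L.map enc.encode) hT.dom (hT.dom ▸ hT.dom_le) (enc.encode (ν j)) hvar
    (by have := hT.src_le (Src.var j); rw [hvar] at this; simpa [srcWord] using this) hb v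
  obtain ⟨v', h'⟩ := key (by
    intro w hw l r v
    obtain ⟨c', hc', rfl⟩ := List.mem_map.1 hw
    obtain ⟨v'', e⟩ := h ctx _ n _ v ((hT.update_loop hc' j l).update_cnt r)
    refine ⟨v'', e.cast ?_ le_rfl⟩
    simp)
  refine ⟨v', h'.cast ?_ (by simp)⟩
  rw [List.map_map]
  congr 4
  refine List.map_congr_left fun c _ => ?_
  simp

end Cmd
end SignedShapley

namespace SignedShapley

open Function

/-! ### Unique readability of encodings -/

/-- By `h₁`, head symbols occur only at the beginning of blocks, so an occurrence of `e a` must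
start at the beginning of a block. By `h₂`, this block is then `e a` itself. -/
theorem infix_flatMap_iff {A G : Type*} {e : A → List G} (hd : G → Prop)
    (h₁ : ∀ a, ∃ g r, e a = g :: r ∧ hd g ∧ ∀ x ∈ r, ¬hd x)
    (h₂ : ∀ a a' x y, e a ++ x = e a' ++ y → a = a') (a : A) (L : List A) :
    e a <:+: L.flatMap e ↔ a ∈ L := by
  constructor
  · rintro ⟨s, t, h⟩
    obtain ⟨g, r, ha, hg, -⟩ := h₁ a
    induction L generalizing s with
    | nil => simp [ha] at h
    | cons b L ih =>
      obtain ⟨g', r', hb, hg', hr'⟩ := h₁ b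
      rw [List.flatMap_cons] at h
      rcases s with _ | ⟨z, s⟩
      · rw [List.nil_append] at h
        simp [h₂ _ _ _ _ h]
      · rw [hb, List.cons_append, List.cons_append, List.cons_append, List.cons.injEq,
          List.append_assoc] at h
        obtain ⟨-, h⟩ := h
        -- The occurrence starts within the rest `r'` of the first block, exactly at its end, or
        -- later. The first is impossible, as `r'` contains no head symbol.
        rcases List.append_eq_append_iff.1 h with ⟨u, hu, hu'⟩ | ⟨u, hu, hu'⟩
        · rcases u with _ | ⟨z', u⟩
          · rw [List.nil_append] at hu'
            refine List.mem_cons_of_mem _ (ih [] ?_)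
            simpa using hu'
          · rw [ha, List.cons_append, List.cons_append, List.cons.injEq] at hu'
            exact absurd hg (hr' _ (by rw [hu, hu'.1]; simp))
        · refine List.mem_cons_of_mem _ (ih u ?_)
          rw [List.append_assoc]
          exact hu'.symm
  · intro h
    obtain ⟨s, t, rfl⟩ := List.append_of_mem h
    exact ⟨s.flatMap e, t.flatMap e, by simp⟩

namespace Cmd

variable {Rel : Type}

theorem bits_sep_inj {w w' : List Bool} {x y : List (InSymbol Rel)}
    (h : bits w ++ InSymbol.sep :: x = bits w' ++ InSymbol.sep :: y) : w = w' ∧ x = y := by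
  induction w generalizing w' with
  | nil =>
    rcases w' with _ | ⟨b, w'⟩
    · simpa [bits] using h
    · simp [bits] at h
  | cons b w ih =>
    rcases w' with _ | ⟨b', w'⟩
    · simp [bits] at h
    · simp only [bits, List.map_cons, List.cons_append, List.cons.injEq, InSymbol.bit.injEq] at h
      obtain ⟨rfl, h⟩ := h
      obtain ⟨rfl, h'⟩ := ih h
      exact ⟨rfl, h'⟩

theorem infix_encWords_iff (w : List Bool) (L : List (List Bool)) :
    encWord (Rel := Rel) w <:+: encWords L ↔ w ∈ L := by
  refine infix_flatMap_iff (fun g => g = InSymbol.sign false) ?_ ?_ w L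
  · intro w
    refine ⟨_, _, rfl, rfl, ?_⟩
    intro x hx
    simp only [bits, List.mem_append, List.mem_map, List.mem_singleton] at hx
    obtain ⟨b, _, rfl⟩ | rfl := hx <;> simp
  · intro w w' x y h
    simp only [encWord, List.cons_append, List.append_assoc, List.cons.injEq, true_and,
      List.nil_append] at h
    exact (bits_sep_inj h).1

variable {S : Schema} {Const : Type} (enc : Computability.Encoding Const Bool)

/-- The code of a list of constants. -/
def encArgs (cs : List Const) : List (InSymbol Rel) :=
  cs.flatMap fun c => bits (enc.encode c) ++ [InSymbol.sep]

theorem encArgs_inj {cs cs' : List Const} (hl : cs.length = cs'.length)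
    {x y : List (InSymbol Rel)} (h : encArgs enc cs ++ x = encArgs enc cs' ++ y) :
    cs = cs' ∧ x = y := by
  induction cs generalizing cs' with
  | nil =>
    rcases cs' with _ | ⟨b, w'⟩
    · simpa [encArgs] using h
    · simp at hl
  | cons b w ih =>
    rcases cs' with _ | ⟨b', w'⟩
    · simp at hl
    · simp only [encArgs, List.flatMap_cons, List.append_assoc, List.cons_append,
        List.nil_append] at h
      obtain ⟨h₁, h₂⟩ := bits_sep_inj h
      obtain ⟨rfl, h'⟩ := ih (by simpa using hl) h₂
      exact ⟨by rw [enc.encode_injective h₁], h'⟩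

theorem encodeFact_eq (f : Fact S Const) :
    encodeFact enc f = InSymbol.rel f.1 :: encArgs enc (List.ofFn f.2) := rfl

/-- The relation symbol determines the arity, hence the number of end markers that belong to the
fact. This supplies the equality of lengths that `encArgs_inj` needs. -/
theorem encodeFact_inj {f f' : Fact S Const} {x y : List (InSymbol S.Rel)}
    (h : encodeFact enc f ++ x = encodeFact enc f' ++ y) : f = f' ∧ x = y := by
  obtain ⟨R, c⟩ := f
  obtain ⟨R', c'⟩ := f'
  rw [encodeFact_eq, encodeFact_eq, List.cons_append, List.cons_append, List.cons.injEq,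
    InSymbol.rel.injEq] at h
  obtain ⟨rfl, h⟩ := h
  obtain ⟨h₁, h₂⟩ := encArgs_inj enc (by simp) h
  exact ⟨by rw [show c = c' from List.ofFn_injective h₁], h₂⟩

theorem encodeSignedFact_inj {f f' : Fact S.signed Const}
    (h : encodeSignedFact enc f = encodeSignedFact enc f') : f = f' := by
  obtain ⟨R | R, c⟩ := f <;> obtain ⟨R' | R', c'⟩ := f'
  · have := (encodeFact_inj enc (f := ⟨R, c⟩) (f' := ⟨R', c'⟩) (x := []) (y := [])
      (by simpa [encodeSignedFact] using h)).1
    cases this; rfl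
  · simp [encodeSignedFact] at h
  · simp [encodeSignedFact] at h
  · have := (encodeFact_inj enc (f := ⟨R, c⟩) (f' := ⟨R', c'⟩) (x := []) (y := [])
      (by simpa [encodeSignedFact] using h)).1
    cases this; rfl

theorem notRel_encArgs (cs : List Const) (x : InSymbol Rel) (hx : x ∈ encArgs enc cs) :
    ∀ R, x ≠ InSymbol.rel R := by
  simp only [encArgs, bits, List.mem_flatMap, List.mem_append, List.mem_map, List.mem_cons,
    List.not_mem_nil, or_false] at hx
  obtain ⟨c, _, ⟨b, _, rfl⟩ | rfl⟩ := hx <;> simp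

theorem infix_encodeFact_iff (f : Fact S Const) (F : List (Fact S Const)) :
    encodeFact enc f <:+: F.flatMap (encodeFact enc) ↔ f ∈ F := by
  refine infix_flatMap_iff (fun g => ∃ R, g = InSymbol.rel R) ?_ ?_ f F
  · intro f
    refine ⟨_, _, encodeFact_eq enc f, ⟨_, rfl⟩, ?_⟩
    rintro x hx ⟨R, rfl⟩
    exact notRel_encArgs enc _ _ hx R rfl
  · intro f f' x y h
    exact (encodeFact_inj enc h).1

/-! ### Order of words -/

/-- Any linear order will do; it only serves to select one of several valuations with the same
support. -/
noncomputable instance [Finite Rel] : LinearOrder (InSymbol Rel) :=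
  LinearOrder.lift' (Fintype.equivFin (InSymbol Rel)) (Equiv.injective _)

/-- Lexicographic comparison, in terms of the first difference of two words. -/
def lexLt {G : Type} [LinearOrder G] : Option G × Option G → Bool
  | (none, some _) => true
  | (some a, some b) => decide (a < b)
  | _ => false

theorem lexLt_diff {G : Type} [LinearOrder G] (l l' : List G) :
    lexLt (diff l l') = true ↔ l < l' := by
  induction l generalizing l' with
  | nil => rcases l' with _ | ⟨y, l'⟩ <;> simp [diff, lexLt]
  | cons x l ih =>
    rcases l' with _ | ⟨y, l'⟩
    · simp [diff, lexLt]
    · by_cases h : x = y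
      · subst h; simp [diff, ih]
      · simp [diff, lexLt, h, List.cons_lt_cons_iff]

/-! ### Properties of queries that programs can decide -/

variable {Var : Type} {W : Finset Var} (c₀ : Const) {M : ℕ}

open scoped Classical in
/-- The valuation of all variables that extends a valuation of the variables in `W`. -/
noncomputable def val (ν : W → Const) : Var → Const :=
  -- The set `W` will contain all variables of positive atoms, so by safety `c₀` never influences a
  -- disjunct.
  fun x => if h : x ∈ W then ν ⟨x, h⟩ else c₀

/-- One of the two valuations that are represented by the variables of the programs. -/
def side (b : Bool) (v : Bool × W → Const) : W → Const := fun x => v (b, x)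

/-- A literal word. -/
def lits (w : List (InSymbol Rel)) : List (InSymbol Rel ⊕ Src (Bool × W)) := w.map Sum.inl

open scoped Classical in
/-- The word of a term. -/
noncomputable def termPieces (b : Bool) : Term Const Var → List (InSymbol Rel ⊕ Src (Bool × W))
  | .const c => lits (bits (enc.encode c))
  | .var x => if h : x ∈ W then [Sum.inr (Src.var (b, ⟨x, h⟩))] else lits (bits (enc.encode c₀))

/-- The word of an atom. -/
noncomputable def atomPieces (b : Bool) (A : Atom S (Term Const Var)) :
    List (InSymbol S.Rel ⊕ Src (Bool × W)) :=
  Sum.inl (InSymbol.rel A.1) ::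
    (List.ofFn A.2).flatMap fun t => termPieces enc c₀ b t ++ [Sum.inl InSymbol.sep]

/-- The word of a signed atom. -/
noncomputable def signedPieces (b : Bool) : Atom S.signed (Term Const Var) →
    List (InSymbol S.Rel ⊕ Src (Bool × W))
  | ⟨Sum.inl R, c⟩ => Sum.inl (InSymbol.sign true) :: atomPieces (S := S) enc c₀ b ⟨R, c⟩
  | ⟨Sum.inr R, c⟩ => Sum.inl (InSymbol.sign false) :: atomPieces (S := S) enc c₀ b ⟨R, c⟩

variable {J : Type}

theorem ctxWord_append (ctx : Ctx S Const) (ν : J → Const) (ps ps') :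
    ctxWord enc ctx ν (ps ++ ps') = ctxWord enc ctx ν ps ++ ctxWord enc ctx ν ps' := by
  simp [ctxWord]

theorem ctxWord_inl (ctx : Ctx S Const) (ν : J → Const) (g) (ps) :
    ctxWord enc ctx ν (Sum.inl g :: ps) = g :: ctxWord enc ctx ν ps := by
  simp [ctxWord]

variable {c₀}

theorem ctxWord_lits (ctx : Ctx S Const) (ν : Bool × W → Const) (w) :
    ctxWord enc ctx ν (lits w) = w := by
  simp [ctxWord, lits, List.flatMap_map]

theorem ctxWord_term (ctx : Ctx S Const) (v : Bool × W → Const) (b : Bool) (t : Term Const Var) :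
    ctxWord enc ctx v (termPieces enc c₀ b t) = bits (enc.encode (t.eval (val c₀ (side b v)))) := by
  rcases t with c | x
  · rw [termPieces, ctxWord_lits]; rfl
  · by_cases h : x ∈ W
    · simp [termPieces, h, ctxWord, Term.eval, val, side, srcWord]
    · rw [termPieces, dif_neg h, ctxWord_lits]; simp [Term.eval, val, h]

theorem ctxWord_atom (ctx : Ctx S Const) (v : Bool × W → Const) (b : Bool)
    (A : Atom S (Term Const Var)) :
    ctxWord enc ctx v (atomPieces enc c₀ b A) =
      encodeFact enc (Atom.eval (val c₀ (side b v)) A) := by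
  have h : ∀ l : List (Term Const Var), ctxWord enc ctx v (l.flatMap fun t =>
      termPieces enc c₀ b t ++ [Sum.inl InSymbol.sep]) =
      encArgs enc (l.map fun t => t.eval (val c₀ (side b v))) := by
    intro l
    induction l with
    | nil => rfl
    | cons t l ih =>
      rw [List.flatMap_cons, ctxWord_append, ctxWord_append, ih, ctxWord_term, ctxWord_inl]
      simp [encArgs, ctxWord]
  rw [atomPieces, ctxWord_inl, h, encodeFact_eq, List.map_ofFn]
  rfl

theorem ctxWord_signed (ctx : Ctx S Const) (v : Bool × W → Const) (b : Bool)
    (A : Atom S.signed (Term Const Var)) :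
    ctxWord enc ctx v (signedPieces enc c₀ b A) =
      encodeSignedFact enc (Atom.eval (val c₀ (side b v)) A) := by
  obtain ⟨R | R, c⟩ := A
  · rw [signedPieces, ctxWord_inl, ctxWord_atom]; rfl
  · rw [signedPieces, ctxWord_inl, ctxWord_atom]; rfl

variable (c₀)

theorem Dec.mem_facts (b : Bool) (A : Atom S (Term Const Var)) :
    Dec M enc fun ctx v => Atom.eval (val c₀ (side (W := W) b v)) A ∈ ctx.facts :=
  (Dec.infix_facts (atomPieces enc c₀ b A) (fun ctx ν => by
    rw [ctxWord_atom, encodeFact_eq]; simp)).congr fun ctx v => by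
      rw [ctxWord_atom, infix_encodeFact_iff]

theorem Dec.mem_dom (b : Bool) (t : Term Const Var) :
    Dec (S := S) M enc fun ctx v => t.eval (val c₀ (side (W := W) b v)) ∈ ctx.L :=
  (Dec.infix_dom (Sum.inl (InSymbol.sign false) ::
    (termPieces enc c₀ b t ++ [Sum.inl InSymbol.sep])) (fun ctx ν => by
      rw [ctxWord_inl]; simp)).congr fun ctx v => by
      rw [ctxWord_inl, ctxWord_append, ctxWord_term, ctxWord_inl]
      refine (infix_encWords_iff _ _).trans ?_
      rw [List.mem_map_of_injective enc.encode_injective]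

theorem Dec.term_eq (b b' : Bool) (t t' : Term Const Var) :
    Dec (S := S) M enc fun _ v =>
      t.eval (val c₀ (side (W := W) b v)) = t'.eval (val c₀ (side b' v)) :=
  (Dec.words_eq (termPieces enc c₀ b t) (termPieces enc c₀ b' t')).congr fun ctx v => by
    rw [ctxWord_term, ctxWord_term, bits_injective.eq_iff, enc.encode_injective.eq_iff]

theorem Dec.atom_eq (b b' : Bool) (A A' : Atom S.signed (Term Const Var)) :
    Dec (S := S) M enc fun _ v =>
      Atom.eval (val c₀ (side (W := W) b v)) A = Atom.eval (val c₀ (side b' v)) A' :=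
  (Dec.words_eq (signedPieces enc c₀ b A) (signedPieces enc c₀ b' A')).congr fun ctx v => by
    rw [ctxWord_signed, ctxWord_signed]
    exact ⟨encodeSignedFact_inj enc, fun h => by rw [h]⟩

theorem Dec.atom_eq_alpha (b : Bool) (A : Atom S.signed (Term Const Var)) :
    Dec M enc fun ctx v => Atom.eval (val c₀ (side (W := W) b v)) A = ctx.α :=
  (Dec.words_eq (signedPieces enc c₀ b A) [Sum.inr Src.alpha]).congr fun ctx v => by
    rw [ctxWord_signed]
    have : ctxWord enc ctx v [Sum.inr Src.alpha] = encodeSignedFact enc ctx.α := by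
      simp [ctxWord, srcWord]
    rw [this]
    exact ⟨encodeSignedFact_inj enc, fun h => by rw [h]⟩

/-- A word that determines a valuation. -/
noncomputable def rankWord (ν : W → Const) : List (InSymbol Rel) :=
  encArgs enc ((Finset.univ : Finset W).toList.map ν)

theorem rankWord_injective : Injective (rankWord (Rel := Rel) (W := W) enc) := by
  intro ν ν' h
  have h := (encArgs_inj enc (x := []) (y := []) (by simp) (congrArg (· ++ []) h)).1
  funext x
  exact List.map_inj_left.1 h x (by simp)

theorem Dec.rank_lt (b b' : Bool) :
    Dec (S := S) M enc fun _ v =>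
      rankWord (Rel := S.Rel) enc (side (W := W) b v) < rankWord enc (side b' v) := by
  have h : ∀ (b : Bool) (ctx : Ctx S Const) (v : Bool × W → Const), ctxWord enc ctx v
      ((Finset.univ : Finset W).toList.flatMap fun x =>
        [Sum.inr (Src.var (b, x)), Sum.inl InSymbol.sep]) = rankWord enc (side b v) := by
    intro b ctx v
    rw [rankWord]
    generalize (Finset.univ : Finset W).toList = l
    induction l with
    | nil => rfl
    | cons x l ih =>
      rw [List.flatMap_cons, ctxWord_append, ih]
      simp [encArgs, ctxWord, srcWord, side]
  refine (Dec.words ((Finset.univ : Finset W).toList.flatMap fun x =>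
        [Sum.inr (Src.var (b, x)), Sum.inl InSymbol.sep])
        ((Finset.univ : Finset W).toList.flatMap fun x =>
        [Sum.inr (Src.var (b', x)), Sum.inl InSymbol.sep]) lexLt).congr fun ctx v => ?_
  rw [h, h, lexLt_diff]

end Cmd
end SignedShapley

/-! ### Deciding which valuations represent minimal supports, and counting them -/

namespace SignedShapley

open Function

open scoped Classical in
/-- The set of facts that the atoms of a conjunctive query become under a valuation. -/
noncomputable def cover {S : Schema} {Const Var : Type} (p : CQneg S Const Var) (μ : Var → Const) :
    Finset (Fact S Const) :=
  (p.pos.map (Atom.eval μ)).toFinset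

/-- The facts of the signed query are facts of the signed database, and the inequalities hold. -/
def Valid {S : Schema} {Const Var : Type} (facts : List (Fact S Const)) (L : List Const)
    (p : CQneg S Const Var) (μ : Var → Const) : Prop :=
  (∀ A ∈ p.pos, Atom.eval μ A ∈ facts) ∧
    (∀ A ∈ p.neg, Atom.eval μ A ∉ facts ∧ ∀ t ∈ List.ofFn A.2, t.eval μ ∈ L) ∧
    ∀ t ∈ p.ineq, t.1.eval μ ≠ t.2.eval μ

namespace Cmd

variable {S : Schema} {Const Var : Type} {W : Finset Var} {M : ℕ}
  {enc : Computability.Encoding Const Bool}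

section Block

variable {J : Type} [Fintype J]

open scoped Classical in
/-- The valuations that differ from `v` only on `l`, where they take values in `L`. -/
noncomputable def box (L : List Const) (l : List J) (v : J → Const) : Finset (J → Const) :=
  Fintype.piFinset fun j => if j ∈ l then L.toFinset else {v j}

theorem mem_box {L : List Const} {l : List J} {v u : J → Const} :
    u ∈ box L l v ↔ ∀ j, (j ∈ l → u j ∈ L) ∧ (j ∉ l → u j = v j) := by
  simp only [box, Fintype.mem_piFinset]
  refine forall_congr' fun j => ?_
  by_cases h : j ∈ l <;> simp [h]

open scoped Classical in
theorem mem_box_cons {L : List Const} {j : J} {l : List J} (hj : j ∉ l) {v u : J → Const} {c : Const}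
    (hc : c ∈ L) : u ∈ box L l (update v j c) ↔ u ∈ box L (j :: l) v ∧ u j = c := by
  rw [mem_box, mem_box]
  constructor
  · intro h
    have hjc : u j = c := by simpa using (h j).2 hj
    refine ⟨fun i => ?_, hjc⟩
    by_cases hi : i = j
    · subst hi; simp [hjc, hc]
    · simpa [hi] using h i
  · rintro ⟨h, hjc⟩ i
    by_cases hi : i = j
    · subst hi; simp [hj, hjc]
    · simpa [hi] using h i

/-- One loop for each variable in `l`. The number of variables is fixed by the query, so it only
affects the degree of the polynomial. -/
theorem Dec.ex_box {P : Ctx S Const → (J → Const) → Prop} (hP : Dec M enc P) (l : List J)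
    (hl : l.Nodup) : Dec M enc fun ctx v => ∃ u ∈ box ctx.L l v, P ctx u := by
  classical
  induction l with
  | nil =>
    refine hP.congr fun ctx v => ?_
    have : ∀ u, u ∈ box ctx.L [] v ↔ u = v := fun u => by rw [mem_box]; simp [funext_iff]
    simp [this]
  | cons j l ih =>
    rw [List.nodup_cons] at hl
    refine ((ih hl.2).ex j).congr fun ctx v => ⟨?_, ?_⟩
    · rintro ⟨c, hc, u, hu, h⟩
      exact ⟨u, ((mem_box_cons hl.1 hc).1 hu).1, h⟩
    · rintro ⟨u, hu, h⟩
      have hc := (mem_box.1 hu j).1 (by simp)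
      exact ⟨u j, hc, u, (mem_box_cons hl.1 hc).2 ⟨hu, rfl⟩, h⟩

theorem Counts.sum_box {N : Ctx S Const → (J → Const) → ℕ} (hN : Counts M enc N) (l : List J)
    (hl : l.Nodup) : Counts M enc fun ctx v => ∑ u ∈ box ctx.L l v, N ctx u := by
  classical
  induction l with
  | nil =>
    refine hN.congr fun ctx v => ?_
    have : box ctx.L [] v = {v} := by ext u; rw [mem_box]; simp [funext_iff]
    simp [this]
  | cons j l ih =>
    rw [List.nodup_cons] at hl
    refine ((ih hl.2).sum j).congr fun ctx v => ?_
    -- The outer loop runs through the values at `j`, and each box of the inner loops is the fibre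
    -- over such a value. Since `ctx.L` has no repetitions, no fibre is counted twice.
    rw [← List.sum_toFinset _ ctx.nodup, ← Finset.sum_fiberwise_of_maps_to (s := box ctx.L (j :: l) v)
      (t := ctx.L.toFinset) (g := fun u => u j)]
    · refine Finset.sum_congr rfl fun c hc => Finset.sum_congr ?_ fun _ _ => rfl
      ext u
      rw [mem_box_cons hl.1 (by simpa using hc), Finset.mem_filter]
    · intro u hu
      simpa using (mem_box.1 hu j).1 (by simp)

end Block

/-- The variables that represent one of the two valuations. -/
noncomputable def sideVars (W : Finset Var) (b : Bool) : List (Bool × W) :=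
  (Finset.univ : Finset W).toList.map fun x => (b, x)

theorem nodup_sideVars (b : Bool) : (sideVars W b).Nodup :=
  (Finset.nodup_toList _).map fun _ _ h => by simpa using h

theorem mem_sideVars {b : Bool} {j : Bool × W} : j ∈ sideVars W b ↔ j.1 = b := by
  obtain ⟨b', x⟩ := j
  simp [sideVars, eq_comm]

theorem mem_box_sideVars {L : List Const} {b : Bool} {v u : Bool × W → Const} :
    u ∈ box L (sideVars W b) v ↔ (∀ x, side b u x ∈ L) ∧ side (!b) u = side (!b) v := by
  simp only [mem_box, mem_sideVars, Prod.forall, side, funext_iff]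
  cases b <;> simp [forall_and]

/-- The variables tagged `true` hold the competitor `ν'`. Looping over them leaves the valuation
tagged `false`, which is being tested, unchanged. -/
theorem Dec.ex_side {P : Ctx S Const → (W → Const) → (W → Const) → Prop}
    (hP : Dec M enc fun ctx v => P ctx (side false v) (side true v)) :
    Dec M enc fun ctx v => ∃ ν' : W → Const, (∀ x, ν' x ∈ ctx.L) ∧ P ctx (side false v) ν' := by
  refine (hP.ex_box (sideVars W true) (nodup_sideVars true)).congr fun ctx v => ⟨?_, ?_⟩
  · rintro ⟨u, hu, h⟩
    obtain ⟨h₁, h₂⟩ := mem_box_sideVars.1 hu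
    exact ⟨side true u, h₁, h₂ ▸ h⟩
  · rintro ⟨ν', h₁, h⟩
    exact ⟨fun j => if j.1 then ν' j.2 else v j, mem_box_sideVars.2 ⟨by simpa [side] using h₁,
      by funext x; simp [side]⟩, h⟩

open scoped Classical in
theorem Counts.sum_side {P : Ctx S Const → (W → Const) → Prop}
    (hP : Dec M enc fun ctx v => P ctx (side false v)) (w : ℕ) :
    Counts M enc fun ctx (_ : Bool × W → Const) =>
      w * ((Fintype.piFinset fun _ : W => ctx.L.toFinset).filter (P ctx)).card := by
  refine ((Counts.guard hP (Counts.const w)).sum_box (sideVars W false)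
    (nodup_sideVars false)).congr fun ctx v => ?_
  rw [← Finset.sum_filter, Finset.sum_const, smul_eq_mul, mul_comm]
  congr 1
  -- In the box the half tagged `true` is frozen at its value in `v`, so a point is determined by
  -- its half tagged `false`.
  refine Finset.card_bij (fun u _ => side false u) ?_ ?_ ?_
  · intro u hu
    rw [Finset.mem_filter, mem_box_sideVars] at hu
    exact Finset.mem_filter.2 ⟨Fintype.mem_piFinset.2 fun x => List.mem_toFinset.2 (hu.1.1 x), hu.2⟩
  · intro u hu u' hu' h
    rw [Finset.mem_filter, mem_box_sideVars] at hu hu'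
    funext ⟨b, x⟩
    cases b
    · exact congrFun h x
    · exact (congrFun hu.1.2 x).trans (congrFun hu'.1.2 x).symm
  · intro ν hν
    rw [Finset.mem_filter, Fintype.mem_piFinset] at hν
    refine ⟨fun j => if j.1 then v j else ν j.2, ?_, by funext x; simp [side]⟩
    rw [Finset.mem_filter, mem_box_sideVars]
    exact ⟨⟨by simpa [side] using hν.1, by funext x; simp [side]⟩, hν.2⟩

variable (c₀ : Const)

theorem Dec.valid (b : Bool) (p : CQneg S Const Var) :
    Dec M enc fun ctx v => Valid ctx.facts ctx.L p (val c₀ (side (W := W) b v)) :=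
  (Dec.forall_mem _ fun A _ => Dec.mem_facts enc c₀ b A).and
    ((Dec.forall_mem _ fun A _ => (Dec.mem_facts enc c₀ b A).not.and
      (Dec.forall_mem _ fun t _ => Dec.mem_dom enc c₀ b t)).and
    (Dec.forall_mem _ fun t _ => (Dec.term_eq enc c₀ b b t.1 t.2).not))

theorem Dec.cover_subset (b b' : Bool) (p p' : CQneg S.signed Const Var) :
    Dec (S := S) M enc fun _ v => cover p (val c₀ (side (W := W) b v)) ⊆
      cover p' (val c₀ (side b' v)) :=
  (Dec.forall_mem p.pos fun A _ => Dec.exists_mem p'.pos fun A' _ =>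
    Dec.atom_eq enc c₀ b' b A' A).congr fun ctx v => by
      simp only [cover, Finset.subset_iff, List.mem_toFinset, List.mem_map]
      constructor
      · rintro h _ ⟨A, hA, rfl⟩
        exact h A hA
      · intro h A hA
        exact h ⟨A, hA, rfl⟩

theorem Dec.alpha_mem_cover (b : Bool) (p : CQneg S.signed Const Var) :
    Dec M enc fun ctx v => ctx.α ∈ cover p (val c₀ (side (W := W) b v)) :=
  (Dec.exists_mem p.pos fun A _ => Dec.atom_eq_alpha enc c₀ b A).congr fun ctx v => by
    simp only [cover, List.mem_toFinset, List.mem_map]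

/-- Distinct facts are counted along the list of atoms: an atom counts unless a later one becomes
the same fact. For a fixed list and a fixed `s` this is a Boolean combination of equality tests. -/
theorem Dec.card_cover (b : Bool) (p : CQneg S.signed Const Var) (s : ℕ) :
    Dec (S := S) M enc fun _ v => (cover p (val c₀ (side (W := W) b v))).card = s := by
  classical
  have key : ∀ (l : List (Atom S.signed (Term Const Var))) (s : ℕ), Dec (S := S) M enc fun _ v =>
      (l.map (Atom.eval (val c₀ (side (W := W) b v)))).toFinset.card = s := by
    intro l
    induction l with
    | nil => exact fun s => (Dec.const (0 = s)).congr fun _ _ => by simp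
    | cons A l ih =>
      intro s
      have hmem : Dec (S := S) M enc fun _ v =>
          Atom.eval (val c₀ (side (W := W) b v)) A ∈
            (l.map (Atom.eval (val c₀ (side (W := W) b v)))).toFinset :=
        (Dec.exists_mem l fun A' _ => Dec.atom_eq enc c₀ b b A' A).congr fun ctx v => by
          simp only [List.mem_toFinset, List.mem_map]
      rcases s with _ | s
      · exact (Dec.const False).congr fun ctx v => by simp
      · refine ((hmem.and (ih (s + 1))).or (hmem.not.and (ih s))).congr fun ctx v => ?_
        rw [List.map_cons, List.toFinset_cons]
        by_cases h : Atom.eval (val c₀ (side (W := W) b v)) A ∈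
            (l.map (Atom.eval (val c₀ (side (W := W) b v)))).toFinset
        · rw [Finset.insert_eq_of_mem h]; simp [h]
        · rw [Finset.card_insert_of_notMem h]; simp [h]
  exact (key p.pos s).congr fun _ _ => by simp only [cover]; convert Iff.rfl

/-- The valuation `ν` for the `i`-th disjunct of `q` yields a minimal support of size `s` that
contains the distinguished fact, and no pair `(i', ν')` that precedes `(i, ν)` yields the same
support. -/
def Canonical (enc : Computability.Encoding Const Bool) (q : UCQneg S Const Var)
    (ctx : Ctx S Const) (i : Fin q.length) (s : ℕ) (ν : W → Const) : Prop :=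
  (Valid ctx.facts ctx.L (q.get i) (val c₀ ν) ∧
    ∀ i' ∈ List.finRange q.length, ¬∃ ν' : W → Const, (∀ x, ν' x ∈ ctx.L) ∧
      Valid ctx.facts ctx.L (q.get i') (val c₀ ν') ∧
      cover (q.get i').signed (val c₀ ν') ⊆ cover (q.get i).signed (val c₀ ν) ∧
      ¬cover (q.get i).signed (val c₀ ν) ⊆ cover (q.get i').signed (val c₀ ν')) ∧
  (ctx.α ∈ cover (q.get i).signed (val c₀ ν) ∧ (cover (q.get i).signed (val c₀ ν)).card = s) ∧
  ∀ i' ∈ List.finRange q.length, ¬∃ ν' : W → Const, (∀ x, ν' x ∈ ctx.L) ∧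
      Valid ctx.facts ctx.L (q.get i') (val c₀ ν') ∧
      (cover (q.get i').signed (val c₀ ν') ⊆ cover (q.get i).signed (val c₀ ν) ∧
      cover (q.get i).signed (val c₀ ν) ⊆ cover (q.get i').signed (val c₀ ν')) ∧
      (i' < i ∨ i' = i ∧ rankWord (Rel := S.Rel) enc ν' < rankWord enc ν)

/-- `Canonical` is phrased with conjunctions over fixed lists and negated existential quantifiers
precisely so that the closure properties of `Dec` apply. -/
theorem Dec.canonical (q : UCQneg S Const Var) (i : Fin q.length) (s : ℕ) :
    Dec M enc fun ctx v => Canonical (W := W) c₀ enc q ctx i s (side false v) := by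
  refine ((Dec.valid c₀ false _).and (Dec.forall_mem _ fun i' _ => Dec.not (Dec.ex_side
    (P := fun ctx ν ν' => Valid ctx.facts ctx.L (q.get i') (val c₀ ν') ∧
      cover (q.get i').signed (val c₀ ν') ⊆ cover (q.get i).signed (val c₀ ν) ∧
      ¬cover (q.get i).signed (val c₀ ν) ⊆ cover (q.get i').signed (val c₀ ν')) ?_))).and
    (((Dec.alpha_mem_cover c₀ false _).and (Dec.card_cover c₀ false _ s)).and
    (Dec.forall_mem _ fun i' _ => Dec.not (Dec.ex_side
    (P := fun ctx ν ν' => Valid ctx.facts ctx.L (q.get i') (val c₀ ν') ∧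
      (cover (q.get i').signed (val c₀ ν') ⊆ cover (q.get i).signed (val c₀ ν) ∧
      cover (q.get i).signed (val c₀ ν) ⊆ cover (q.get i').signed (val c₀ ν')) ∧
      (i' < i ∨ i' = i ∧ rankWord (Rel := S.Rel) enc ν' < rankWord enc ν)) ?_)))
  · exact (Dec.valid c₀ true _).and ((Dec.cover_subset c₀ true false _ _).and
      -- Minimality asks that no competitor have a properly smaller cover; the next case asks that
      -- none of smaller rank have the same cover. There the comparison of `i'` and `i` is a
      -- constant of the program.
      (Dec.cover_subset c₀ false true _ _).not)
  · exact (Dec.valid c₀ true _).and (((Dec.cover_subset c₀ true false _ _).and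
      (Dec.cover_subset c₀ false true _ _)).and ((Dec.const _).or ((Dec.const _).and
      (Dec.rank_lt enc true false))))

open scoped Classical in
/-- The weighted number of minimal supports that contain the distinguished fact, if the weight of a
support of size `s` is `weight s`. -/
noncomputable def total (W : Finset Var) (enc : Computability.Encoding Const Bool)
    (q : UCQneg S Const Var) (weight : ℕ → ℕ) (sizes : List ℕ) (ctx : Ctx S Const) : ℕ :=
  ((List.finRange q.length).map fun i => (sizes.map fun s => weight s *
    ((Fintype.piFinset fun _ : W => ctx.L.toFinset).filter
      (Canonical c₀ enc q ctx i s)).card).sum).sum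

/-- Disjuncts and sizes range over fixed lists and are unrolled. Treating each size `s` separately
makes the weight a constant, so the machine never has to divide by `|T|`. -/
theorem Counts.total (q : UCQneg S Const Var) (weight : ℕ → ℕ) (sizes : List ℕ) :
    Counts M enc fun ctx (_ : Bool × W → Const) => Cmd.total c₀ W enc q weight sizes ctx :=
  Counts.list_sum _ fun i _ => Counts.list_sum _ fun s _ =>
    Counts.sum_side (Dec.canonical c₀ q i s) (weight s)

end Cmd
end SignedShapley

namespace SignedShapley

open Function

/-! ### Preparation: parsing the input and collecting the active domain -/

namespace Cmd

variable {S : Schema} {Const J : Type} {M : ℕ} (enc : Computability.Encoding Const Bool)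

/-- Any symbol but a relation symbol. -/
def notRel {Rel : Type} : InSymbol Rel → Bool
  | .rel _ => false
  | _ => true

/-- Move the signed fact at the beginning of the input to its own stack. -/
def splitInput {Rel : Type} : Cmd (WK J) (InSymbol Rel) (Reg (InSymbol Rel) M) :=
  seq (pop WK.facts setA) (seq (push WK.t1 fun v => v.a.getD default) (seq (pop WK.facts setA)
    (seq (push WK.t1 fun v => v.a.getD default) (seq (xfer notRel WK.facts [WK.t1])
      (xfer (fun _ => true) WK.t1 [WK.src Src.alpha])))))

theorem encodeSignedFact_eq (α : Fact S.signed Const) :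
    ∃ x R cs, encodeSignedFact enc α = x :: InSymbol.rel R :: encArgs enc cs := by
  obtain ⟨R | R, c⟩ := α
  · exact ⟨_, _, _, rfl⟩
  · exact ⟨_, _, _, rfl⟩

/-- The first fact of the database begins with the next relation symbol, so a relation symbol ends
the transfer. The sign and the relation symbol of `α` itself are therefore moved by hand. -/
theorem splitInput_exec (α : Fact S.signed Const) (F : List (Fact S Const))
    (v : Reg (InSymbol S.Rel) M) :
    ∃ v', Exec (splitInput (J := J)) v (update (fun _ => []) WK.facts
        (encodeSignedFact enc α ++ F.flatMap (encodeFact enc))) v'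
      (update (update (fun _ => []) WK.facts (F.flatMap (encodeFact enc)))
        (WK.src Src.alpha) (encodeSignedFact enc α))
      (10 * ((encodeSignedFact enc α).length + 1) + 4) := by
  obtain ⟨x, R, cs, h⟩ := encodeSignedFact_eq enc α
  rw [h]
  refine ⟨_, (Exec.pop.seq (Exec.push.seq (Exec.pop.seq (Exec.push.seq ((move_exec
    (by simp) (encArgs enc cs) (F.flatMap (encodeFact enc)) ?_ ?_ _ _ ?_).seq
    (moveAll_exec (by simp) _ _)))))).cast ?_ ?_⟩
  · intro y hy
    have := notRel_encArgs enc cs y hy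
    rcases y with _ | R | _ | _ <;> first | rfl | exact absurd rfl (this R)
  · rcases F with _ | ⟨f, F⟩
    · rfl
    · rfl
  · simp
  · funext k
    by_cases hk : k = WK.facts
    · subst hk; simp
    · by_cases hk' : k = WK.t1
      · subst hk'; simp
      · by_cases hk'' : k = WK.src Src.alpha
        · subst hk''; simp [setA]
        · simp [hk, hk', hk'']
  · simp; omega

/-- The tokens of a fact: its relation symbol and its arguments. -/
def tokens (f : Fact S Const) : List (S.Rel ⊕ Const) := Sum.inl f.1 :: (List.ofFn f.2).map Sum.inr

/-- The code of a token. -/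
def encToken : S.Rel ⊕ Const → List (InSymbol S.Rel)
  | .inl R => [InSymbol.rel R]
  | .inr c => bits (enc.encode c) ++ [InSymbol.sep]

theorem flatMap_encToken (F : List (Fact S Const)) :
    (F.flatMap tokens).flatMap (encToken enc) = F.flatMap (encodeFact enc) := by
  rw [List.flatMap_assoc]
  refine List.flatMap_congr fun f _ => ?_
  rw [tokens, List.flatMap_cons, encodeFact_eq, encArgs, List.flatMap_map]
  rfl

open scoped Classical in
/-- Add the constant of a token to a list of distinct constants. -/
noncomputable def collect : List Const → S.Rel ⊕ Const → List Const
  | L, .inl _ => L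
  | L, .inr c => if c ∈ L then L else c :: L

theorem foldl_collect_nodup (ts : List (S.Rel ⊕ Const)) :
    ∀ L : List Const, L.Nodup → (ts.foldl collect L).Nodup := by
  induction ts with
  | nil => exact fun L h => h
  | cons t ts ih =>
    intro L h
    refine ih _ ?_
    rcases t with R | c
    · exact h
    · by_cases hc : c ∈ L
      · simpa [collect, hc] using h
      · simp [collect, hc, h]

theorem mem_foldl_collect (ts : List (S.Rel ⊕ Const)) (c : Const) :
    ∀ L : List Const, c ∈ ts.foldl collect L ↔ c ∈ L ∨ Sum.inr c ∈ ts := by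
  induction ts with
  | nil => simp
  | cons t ts ih =>
    intro L
    rw [List.foldl_cons, ih]
    rcases t with R | c'
    · simp [collect]
    · by_cases hc : c' ∈ L
      · simp only [collect, hc, if_true, List.mem_cons, Sum.inr.injEq]
        constructor
        · tauto
        · rintro (h | rfl | h) <;> tauto
      · simp only [collect, hc, if_false, List.mem_cons, Sum.inr.injEq]
        tauto

/-- The delimited word of the current constant. -/
def curPieces {Rel : Type} : List (InSymbol Rel ⊕ Src J) :=
  [Sum.inl (InSymbol.sign false), Sum.inr Src.cur, Sum.inl InSymbol.sep]

theorem wordOf_curPieces {Rel : Type} {T : WK J → List (InSymbol Rel)} {w : List Bool}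
    (h : T (WK.src Src.cur) = bits w) : wordOf T curPieces = encWord w := by
  simp [wordOf, curPieces, h, encWord]

/-- The symbol read starts a constant. -/
def atConst {Rel : Type} (v : Reg (InSymbol Rel) M) : Bool := v.a.any notRel

/-- Process one token. -/
noncomputable def collectStep {Rel : Type} : Cmd (WK J) (InSymbol Rel) (Reg (InSymbol Rel) M) :=
  ite atConst
    -- `iterNext` discards one symbol before it reads a constant; constants in facts carry no
    -- opening delimiter, so a dummy is pushed.
    (seq (push WK.loop fun _ => InSymbol.sep) (seq (iterNext Src.cur) (seq
      (infixTest curPieces WK.dom) (seq (ite (fun v => v.res) skip (build WK.dom curPieces))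
        (xfer (fun _ => true) (WK.src Src.cur) [])))))
    (pop WK.loop fun v _ => v)

/-- Collect the constants that occur in the facts. -/
noncomputable def collectAll {Rel : Type} : Cmd (WK J) (InSymbol Rel) (Reg (InSymbol Rel) M) :=
  seq (copy WK.facts WK.loop WK.t3) (seq (peek WK.loop setA)
    (loop (fun v => v.a.isSome) (seq collectStep (peek WK.loop setA))))

/-- The time bound for processing a token. -/
def stepTime (n : ℕ) : ℕ := (n + 1) * (4 * (30 * (n + 1))) + 60 * (n + 1)

theorem collectStep_exec {n : ℕ} (T : WK J → List (InSymbol S.Rel)) (hT : Clean T)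
    (hcur : T (WK.src Src.cur) = []) (hn : ∀ s, (T (WK.src s)).length ≤ n) (L : List Const)
    (hdom : T WK.dom = encWords (L.map enc.encode)) (hd : (T WK.dom).length ≤ n)
    (t : S.Rel ⊕ Const) (rest : List (InSymbol S.Rel)) (hl : T WK.loop = encToken enc t ++ rest)
    (hln : (encToken enc t).length ≤ n) (v : Reg (InSymbol S.Rel) M)
    (hv : v.a = (T WK.loop).head?) :
    ∃ v', Exec collectStep v T v' (update (update T WK.loop rest) WK.dom
      (encWords ((collect L t).map enc.encode))) (stepTime n) := by
  rcases t with R | c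
  · refine ⟨_, (Exec.ite_false ?_ Exec.pop).cast ?_ ?_⟩
    · rw [atConst, hv, hl]; rfl
    · rw [hl]
      simp only [encToken, List.cons_append, List.nil_append, List.tail_cons, collect]
      exact (update_eq_self_iff.2 (by simp [hdom])).symm
    · unfold stepTime; omega
  · have hlen : (enc.encode c).length + 1 ≤ n := by simpa [encToken] using hln
    have c₁ := @Exec.push (WK J) (InSymbol S.Rel) (Reg (InSymbol S.Rel) M) _ WK.loop
      (fun _ => InSymbol.sep) v T
    obtain ⟨v₂, c₂⟩ := iterNext_exec (M := M) Src.cur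
      (update T WK.loop (InSymbol.sep :: T WK.loop)) (by simp [hT.t3]) InSymbol.sep
      (enc.encode c) rest (by simp [hl, encToken]) (by simp [hcur]) v
    rw [update_idem] at c₂
    set T₂ := update (update T WK.loop rest) (WK.src Src.cur) (bits (enc.encode c)) with hT₂
    have hcl : Clean T₂ := ⟨by simp [T₂, hT.t1], by simp [T₂, hT.t2], by simp [T₂, hT.t3],
      by simp [T₂, hT.t4]⟩
    have hn₂ : ∀ s, (T₂ (WK.src s)).length ≤ n := by
      intro s
      by_cases hs : s = Src.cur
      · subst hs; simp [T₂]; omega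
      · simp [T₂, hs, hn]
    have hw : wordOf T₂ curPieces = encWord (enc.encode c) := wordOf_curPieces (by simp [T₂])
    have hdom₂ : T₂ WK.dom = encWords (L.map enc.encode) := by simp [T₂, hdom]
    obtain ⟨v₃, hv₃, c₃⟩ := infixTest_exec (M := M) (n := n) (ps := curPieces) (A := WK.dom)
      (by simp) (by simp) T₂ v₂ hn₂ (by simpa [T₂] using hd) (by rw [hw]; simp [encWord]) hcl
    rw [hw, hdom₂] at hv₃
    have hv₃' := hv₃.trans ((infix_encWords_iff _ _).trans
      (List.mem_map_of_injective enc.encode_injective))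
    -- A constant whose code is empty shows up as a bare end marker, which is not a relation symbol
    -- either.
    have hcond : atConst v = true := by
      rw [atConst, hv, hl, encToken]
      rcases enc.encode c with _ | ⟨b, w⟩ <;> rfl
    have hps : (curPieces (Rel := S.Rel) (J := J)).length = 3 := rfl
    rw [hps] at c₃
    by_cases hc : c ∈ L
    · refine ⟨_, (Exec.ite_true hcond (c₁.seq (c₂.seq (c₃.seq ((Exec.ite_true (hv₃'.2 hc)
        Exec.load).seq (clear_exec (WK.src Src.cur) _ _)))))).cast ?_ ?_⟩
      · rw [collect, if_pos hc, ← hdom]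
        funext k
        by_cases hk : k = WK.src Src.cur
        · subst hk; simp [hcur]
        · by_cases hk' : k = WK.dom
          · subst hk'; simp [T₂]
          · simp [T₂, hk, hk']
      · simp [T₂, stepTime]; omega
    · obtain ⟨v₄, c₄⟩ := build_exec (M := M) (k := WK.dom) (by simp) (by simp)
        (curPieces (Rel := S.Rel)) T₂ hn₂ hcl.t3 v₃
      rw [hw, hdom₂, hps] at c₄
      refine ⟨_, (Exec.ite_true hcond (c₁.seq (c₂.seq (c₃.seq ((Exec.ite_false
        (by simpa [hc] using hv₃') c₄).seq (clear_exec (WK.src Src.cur) _ _)))))).cast ?_ ?_⟩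
      · rw [collect, if_neg hc]
        funext k
        by_cases hk : k = WK.src Src.cur
        · subst hk; simp [hcur]
        · by_cases hk' : k = WK.dom
          · subst hk'; simp [encWords]
          · simp [T₂, hk, hk']
      · simp [T₂, stepTime]; omega

/-- A code of length `m` occupies `m + 1` symbols in a fact and `m + 2 ≤ 2 * (m + 1)` on `WK.dom`.
-/
theorem length_collect_le (t : S.Rel ⊕ Const) (L : List Const) :
    (encWords (Rel := S.Rel) ((collect L t).map enc.encode)).length ≤
      (encWords (Rel := S.Rel) (L.map enc.encode)).length + 2 * (encToken enc t).length := by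
  rcases t with R | c
  · simp [collect]
  · by_cases hc : c ∈ L
    · simp [collect, hc]
    · simp [collect, hc, encWords, encWord, encToken]; omega

/-- The length of the collected domain plus twice the length of the unread facts never increases. So
one bound `n` controls all rounds. -/
theorem collectAll_loop {n : ℕ} (T : WK J → List (InSymbol S.Rel)) (hT : Clean T)
    (hcur : T (WK.src Src.cur) = []) (hn : ∀ s, (T (WK.src s)).length ≤ n)
    (ts : List (S.Rel ⊕ Const)) :
    ∀ (L : List Const) (v : Reg (InSymbol S.Rel) M),
      (encWords (Rel := S.Rel) (L.map enc.encode)).length +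
        2 * (ts.flatMap (encToken enc)).length ≤ n →
      v.a = (ts.flatMap (encToken enc)).head? →
      ∃ v', Exec (loop (fun v => v.a.isSome) (seq collectStep (peek WK.loop setA))) v
        (update (update T WK.loop (ts.flatMap (encToken enc))) WK.dom
          (encWords (L.map enc.encode))) v'
        (update (update T WK.loop []) WK.dom (encWords ((ts.foldl collect L).map enc.encode)))
        (ts.length * (stepTime n + 2) + 1) := by
  induction ts with
  | nil =>
    intro L v _ hv
    exact ⟨v, (Exec.loop_done (by simp [hv])).mono (by simp)⟩
  | cons t ts ih =>
    intro L v hL hv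
    rw [List.flatMap_cons, List.length_append] at hL
    set T₁ := update (update T WK.loop ((t :: ts).flatMap (encToken enc))) WK.dom
          (encWords (L.map enc.encode)) with hT₁
    obtain ⟨v₁, c₁⟩ := collectStep_exec (M := M) (n := n) enc T₁
      ⟨by simp [T₁, hT.t1], by simp [T₁, hT.t2], by simp [T₁, hT.t3], by simp [T₁, hT.t4]⟩
      (by simp [T₁, hcur]) (by simpa [T₁] using hn) L (by simp [T₁]) (by simp [T₁]; omega) t
      (ts.flatMap (encToken enc)) (by simp [T₁]) (by omega) v (by simp [T₁, hv])
    have e : update (update T₁ WK.loop (ts.flatMap (encToken enc))) WK.dom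
        (encWords ((collect L t).map enc.encode)) =
        update (update T WK.loop (ts.flatMap (encToken enc))) WK.dom
          (encWords ((collect L t).map enc.encode)) := by
      funext k
      by_cases hk : k = WK.dom
      · subst hk; simp
      · by_cases hk' : k = WK.loop
        · subst hk'; simp
        · simp [T₁, hk, hk']
    rw [e] at c₁
    have hlen := length_collect_le enc t L
    obtain ⟨v₂, c₂⟩ := ih (collect L t) (setA v₁ (ts.flatMap (encToken enc)).head?) (by omega) rfl
    have c₃ := @Exec.peek (WK J) (InSymbol S.Rel) (Reg (InSymbol S.Rel) M) _ WK.loop setA v₁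
      (update (update T WK.loop (ts.flatMap (encToken enc))) WK.dom
          (encWords ((collect L t).map enc.encode)))
    rw [update_of_ne (by simp), update_self] at c₃
    refine ⟨v₂, (Exec.loop_step (f := fun v => v.a.isSome) ?_ (c₁.seq c₃) c₂).mono ?_⟩
    · rw [hv]
      rcases t with R | c
      · rfl
      · simp only [List.flatMap_cons, encToken]
        rcases enc.encode c with _ | ⟨b, w⟩ <;> rfl
    · rw [List.length_cons, add_one_mul ts.length]; omega

theorem length_le_flatMap_encToken (ts : List (S.Rel ⊕ Const)) :
    ts.length ≤ (ts.flatMap (encToken enc)).length := by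
  induction ts with
  | nil => simp
  | cons t ts ih =>
    rw [List.flatMap_cons, List.length_append, List.length_cons]
    have : 1 ≤ (encToken enc t).length := by rcases t <;> simp [encToken]
    omega

theorem collectAll_exec {n : ℕ} (T : WK J → List (InSymbol S.Rel)) (hT : Clean T)
    (hcur : T (WK.src Src.cur) = []) (hn : ∀ s, (T (WK.src s)).length ≤ n)
    (hloop : T WK.loop = []) (hdom : T WK.dom = []) (F : List (Fact S Const))
    (hF : T WK.facts = F.flatMap (encodeFact enc)) (hFn : 2 * (T WK.facts).length ≤ n)
    (v : Reg (InSymbol S.Rel) M) :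
    ∃ v', Exec collectAll v T v'
      (update T WK.dom (encWords (((F.flatMap tokens).foldl collect []).map enc.encode)))
      ((n + 1) * (stepTime n + 30)) := by
  have c₁ := copy_exec (M := M) (A := WK.facts) (B := WK.loop) (t := WK.t3) (by simp) (by simp)
    (by simp) v T hT.t3
  rw [hloop, List.append_nil] at c₁
  have c₂ := @Exec.peek (WK J) (InSymbol S.Rel) (Reg (InSymbol S.Rel) M) _ WK.loop setA
    (setA v none) (update T WK.loop (T WK.facts))
  rw [update_self, hF, ← flatMap_encToken] at c₂
  obtain ⟨v₃, c₃⟩ := collectAll_loop (M := M) (n := n) enc T hT hcur hn (F.flatMap tokens) []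
    (setA (setA v none) ((F.flatMap tokens).flatMap (encToken enc)).head?)
    (by rw [flatMap_encToken, ← hF]; simpa [encWords] using hFn) rfl
  have e : update (update T WK.loop ((F.flatMap tokens).flatMap (encToken enc))) WK.dom
      (encWords (List.map enc.encode [])) =
      update T WK.loop ((F.flatMap tokens).flatMap (encToken enc)) :=
    update_eq_self_iff.2 (by simp [hdom, encWords])
  rw [e] at c₃
  rw [hF, ← flatMap_encToken] at c₁
  refine ⟨v₃, (c₁.seq (c₂.seq c₃)).cast ?_ ?_⟩
  · congr 1
    exact update_eq_self_iff.2 hloop.symm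
  · have h₁ := length_le_flatMap_encToken enc (F.flatMap tokens)
    rw [flatMap_encToken, ← hF] at h₁
    rw [flatMap_encToken, ← hF]
    have h₂ : (F.flatMap tokens).length * (stepTime n + 2) ≤ n * (stepTime n + 2) :=
      Nat.mul_le_mul_right _ (by omega)
    have h₃ : (n + 1) * (stepTime n + 30) = n * (stepTime n + 2) + 28 * n + stepTime n + 30 := by
      ring
    omega

theorem length_foldl_collect_le (ts : List (S.Rel ⊕ Const)) :
    ∀ L : List Const, (encWords (Rel := S.Rel) ((ts.foldl collect L).map enc.encode)).length ≤
      (encWords (Rel := S.Rel) (L.map enc.encode)).length +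
        2 * (ts.flatMap (encToken enc)).length := by
  induction ts with
  | nil => simp
  | cons t ts ih =>
    intro L
    have h₁ := ih (collect L t)
    have h₂ := length_collect_le enc t L
    rw [List.foldl_cons, List.flatMap_cons, List.length_append]
    omega

/-- Load the first constant of the active domain into a variable. -/
noncomputable def loadVar {Rel : Type} (j : J) :
    Cmd (WK J) (InSymbol Rel) (Reg (InSymbol Rel) M) :=
  seq (copy WK.dom WK.loop WK.t3) (seq (iterNext (Src.var j)) (xfer (fun _ => true) WK.loop []))

/-- `Good` asks every variable stack to hold the code of some constant, even before the loops assign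
one. Any constant of the active domain will do. -/
theorem loadVar_exec {n : ℕ} (j : J) (T : WK J → List (InSymbol S.Rel)) (hT : T WK.t3 = [])
    (hloop : T WK.loop = []) (hj : T (WK.src (Src.var j)) = []) (w : List Bool)
    (ws : List (List Bool)) (hdom : T WK.dom = encWords (w :: ws)) (hn : (T WK.dom).length ≤ n)
    (v : Reg (InSymbol S.Rel) M) :
    ∃ v', Exec (loadVar j) v T v' (update T (WK.src (Src.var j)) (bits w)) (30 * (n + 1)) := by
  have e : T WK.dom = InSymbol.sign false :: (bits w ++ InSymbol.sep :: encWords ws) := by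
    rw [hdom]; simp [encWords, encWord]
  have c₁ := copy_exec (M := M) (A := WK.dom) (B := WK.loop) (t := WK.t3) (by simp) (by simp)
    (by simp) v T hT
  rw [hloop, List.append_nil] at c₁
  obtain ⟨v₂, c₂⟩ := iterNext_exec (M := M) (Src.var j) (update T WK.loop (T WK.dom))
    (by simp [hT]) (InSymbol.sign false) w (encWords ws) (by simp [e]) (by simp [hj]) (setA v none)
  refine ⟨_, (c₁.seq (c₂.seq (clear_exec WK.loop _ _))).cast ?_ ?_⟩
  · funext k
    by_cases hk : k = WK.loop
    · subst hk; simp [hloop]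
    · by_cases hk' : k = WK.src (Src.var j)
      · subst hk'; simp
      · simp [hk, hk']
  · have := congrArg List.length e
    simp at this
    simp; omega

/-- Load the first constant of the active domain into several variables. -/
noncomputable def loadAll {Rel : Type} : List J → Cmd (WK J) (InSymbol Rel) (Reg (InSymbol Rel) M)
  | [] => skip
  | j :: js => seq (loadVar j) (loadAll js)

theorem loadAll_exec {n : ℕ} (w : List Bool) (ws : List (List Bool)) (js : List J) :
    ∀ (T : WK J → List (InSymbol S.Rel)) (v : Reg (InSymbol S.Rel) M), js.Nodup → T WK.t3 = [] →
      T WK.loop = [] → (∀ j ∈ js, T (WK.src (Src.var j)) = []) → T WK.dom = encWords (w :: ws) →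
      (T WK.dom).length ≤ n →
      ∃ v' T', Exec (loadAll js) v T v' T' (js.length * (30 * (n + 1)) + 1) ∧
        (∀ j ∈ js, T' (WK.src (Src.var j)) = bits w) ∧
        ∀ k, (∀ j ∈ js, k ≠ WK.src (Src.var j)) → T' k = T k := by
  induction js with
  | nil => exact fun T v _ _ _ _ _ _ => ⟨_, T, Exec.load.mono (by simp), by simp, fun _ _ => rfl⟩
  | cons j js ih =>
    intro T v hjs hT hloop hj hdom hn
    rw [List.nodup_cons] at hjs
    obtain ⟨v₁, c₁⟩ := loadVar_exec (M := M) j T hT hloop (hj j (by simp)) w ws hdom hn v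
    obtain ⟨v₂, T₂, c₂, h₁, h₂⟩ := ih (update T (WK.src (Src.var j)) (bits w)) v₁ hjs.2
      (by simp [hT]) (by simp [hloop]) (by
        intro i hi
        have : i ≠ j := fun h => hjs.1 (h ▸ hi)
        simp [this, hj i (by simp [hi])]) (by simp [hdom]) (by simpa using hn)
    refine ⟨v₂, T₂, (c₁.seq c₂).mono ?_, ?_, ?_⟩
    · rw [List.length_cons, add_one_mul js.length]; omega
    · intro i hi
      rcases List.mem_cons.1 hi with rfl | hi
      · rw [h₂ _ (by rintro i' hi' h; cases h; exact hjs.1 hi')]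
        simp
      · exact h₁ i hi
    · intro k hk
      rw [h₂ k fun i hi => hk i (by simp [hi]), update_of_ne (hk j (by simp))]

/-- Set up the stacks from the input. -/
noncomputable def prepare {Rel : Type} (js : List J) :
    Cmd (WK J) (InSymbol Rel) (Reg (InSymbol Rel) M) :=
  seq splitInput (seq collectAll (loadAll js))

/-- The distinct constants of a list of facts. -/
noncomputable def domList (F : List (Fact S Const)) : List Const :=
  (F.flatMap tokens).foldl collect []

theorem domList_nodup (F : List (Fact S Const)) : (domList F).Nodup :=
  foldl_collect_nodup _ _ List.nodup_nil

theorem mem_domList {F : List (Fact S Const)} {c : Const} :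
    c ∈ domList F ↔ ∃ f ∈ F, ∃ i, f.2 i = c := by
  rw [domList, mem_foldl_collect]
  simp [tokens]

/-- The factor `2` in the size bound pays for the delimiters on `WK.dom`, by `length_collect_le`. -/
theorem prepare_exec {n : ℕ} (js : List J) (hjs : js.Nodup) (hJ : ∀ j, j ∈ js)
    (α : Fact S.signed Const) (F : List (Fact S Const)) (c : Const) (L : List Const)
    (hL : domList F = c :: L)
    (hn : 2 * (encodeSignedFact enc α ++ F.flatMap (encodeFact enc)).length ≤ n)
    (v : Reg (InSymbol S.Rel) M) :
    ∃ v' T, Exec (prepare js) v (update (fun _ => []) WK.facts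
        (encodeSignedFact enc α ++ F.flatMap (encodeFact enc))) v' T
      (10 * (n + 1) + 4 + ((n + 1) * (stepTime n + 30) + (js.length * (30 * (n + 1)) + 1))) ∧
      Good enc ⟨F, α, domList F, domList_nodup F⟩ (fun _ => c) n T ∧
      T WK.loop = [] ∧ T WK.cnt = [] := by
  rw [List.length_append] at hn
  obtain ⟨v₁, c₁⟩ := splitInput_exec (J := J) enc α F v
  set T₁ : WK J → List (InSymbol S.Rel) :=
    update (update (fun _ => []) WK.facts (F.flatMap (encodeFact enc)))
        (WK.src Src.alpha) (encodeSignedFact enc α) with hT₁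
  obtain ⟨v₂, c₂⟩ := collectAll_exec (n := n) enc T₁ ⟨by simp [T₁], by simp [T₁], by simp [T₁],
    by simp [T₁]⟩ (by simp [T₁]) (by
      intro s
      by_cases hs : s = Src.alpha
      · subst hs; simp [T₁]; omega
      · simp [T₁, hs]) (by simp [T₁]) (by simp [T₁]) F (by simp [T₁]) (by
      simp [T₁, -List.length_flatMap]; omega) v₁
  have hd := length_foldl_collect_le enc (F.flatMap tokens) []
  rw [flatMap_encToken] at hd
  rw [← domList] at c₂ hd
  have hd' : (encWords (Rel := S.Rel) ((domList F).map enc.encode)).length ≤ n := by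
    simp [encWords] at hd hn ⊢; omega
  obtain ⟨v₃, T, c₃, h₁, h₂⟩ := loadAll_exec (n := n) (enc.encode c) (L.map enc.encode) js
    (update T₁ WK.dom (encWords ((domList F).map enc.encode))) v₂ hjs (by simp [T₁]) (by simp [T₁])
    (by simp [T₁]) (by simp [hL]) (by simpa using hd')
  refine ⟨v₃, T, (c₁.seq (c₂.seq c₃)).mono (by omega), ⟨?_, ?_, ?_, ?_, ?_, ?_, ?_⟩, ?_, ?_⟩
  · exact ⟨by rw [h₂ _ (by simp)]; simp [T₁], by rw [h₂ _ (by simp)]; simp [T₁],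
      by rw [h₂ _ (by simp)]; simp [T₁], by rw [h₂ _ (by simp)]; simp [T₁]⟩
  · rw [h₂ _ (by simp)]; simp [T₁]
  · rintro (j | _ | _)
    · exact h₁ j (hJ j)
    · rw [h₂ _ (by simp)]; simp [T₁, srcWord]
    · rw [h₂ _ (by simp)]; simp [T₁, srcWord]
  · rw [h₂ _ (by simp)]; simp
  · rw [h₂ _ (by simp)]; simp [T₁, -List.length_flatMap]; omega
  · rintro (j | _ | _)
    · rw [h₁ j (hJ j)]
      refine le_trans ?_ hd'
      rw [hL, length_bits]
      exact length_bits_le (by simp)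
    · rw [h₂ _ (by simp)]; simp [T₁]; omega
    · rw [h₂ _ (by simp)]; simp [T₁]
  · rw [h₂ _ (by simp)]; simpa using hd'
  · rw [h₂ _ (by simp)]; simp [T₁]
  · rw [h₂ _ (by simp)]; simp [T₁]

/-- Clear several stacks. -/
def clearAll {G : Type} [Inhabited G] : List (WK J) → Cmd (WK J) G (Reg G M)
  | [] => skip
  | A :: As => seq (xfer (fun _ => true) A []) (clearAll As)

theorem clearAll_exec {G : Type} [Inhabited G] {n : ℕ} (As : List (WK J)) :
    ∀ (v : Reg G M) (T : WK J → List G), (∀ A ∈ As, (T A).length ≤ n) →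
      ∃ v' T', Exec (clearAll As) v T v' T' (As.length * (4 * (n + 1)) + 1) ∧
        (∀ A ∈ As, T' A = []) ∧ ∀ A ∉ As, T' A = T A := by
  induction As with
  | nil => exact fun v T _ => ⟨_, T, Exec.load.mono (by simp), by simp, fun _ _ => rfl⟩
  | cons A As ih =>
    intro v T hn
    have c₁ := clear_exec (M := M) A v T
    obtain ⟨v₂, T₂, c₂, h₁, h₂⟩ := ih (setA v none) (update T A []) (by
      intro B hB
      by_cases h : B = A
      · subst h; simp
      · simpa [h] using hn B (by simp [hB]))
    refine ⟨v₂, T₂, (c₁.seq c₂).mono ?_, ?_, ?_⟩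
    · have := hn A (by simp)
      rw [List.length_cons, add_one_mul As.length]; omega
    · intro B hB
      by_cases hB' : B ∈ As
      · exact h₁ B hB'
      · rcases List.mem_cons.1 hB with rfl | h
        · rw [h₂ _ hB']; simp
        · exact absurd h hB'
    · intro B hB
      rw [List.mem_cons, not_or] at hB
      rw [h₂ B hB.2, update_of_ne hB.1]

end Cmd
end SignedShapley

namespace SignedShapley

open Function

/-! ### Reducing a fraction with constant denominator and writing it in binary -/

/-- The carry turns the `m` leading ones into zeros and the digit after them into a one. If there is
no such digit, `rest` is empty, `rest.tail` is empty as well, and the word grows by one digit. -/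
theorem encodePosNum_succ (p : PosNum) : ∃ m rest, rest.head? ≠ some true ∧
    Computability.encodePosNum p = List.replicate m true ++ rest ∧
    Computability.encodePosNum p.succ = List.replicate m false ++ true :: rest.tail := by
  induction p with
  | one => exact ⟨1, [], by simp, rfl, rfl⟩
  | bit1 p ih =>
    obtain ⟨m, rest, h, h₁, h₂⟩ := ih
    exact ⟨m + 1, rest, h, by rw [Computability.encodePosNum, h₁]; rfl, by
      rw [PosNum.succ, Computability.encodePosNum, h₂]; rfl⟩
  | bit0 p ih => exact ⟨0, false :: Computability.encodePosNum p, by simp, rfl, rfl⟩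

/-- The binary successor, on words with the least significant digit first. -/
theorem encodeNat_succ (n : ℕ) : ∃ m rest, rest.head? ≠ some true ∧
    Computability.encodeNat n = List.replicate m true ++ rest ∧
    Computability.encodeNat (n + 1) = List.replicate m false ++ true :: rest.tail := by
  have e : ((n + 1 : ℕ) : Num) = Num.succ (n : Num) := by
    rw [Nat.cast_succ, Num.add_one]
  rw [Computability.encodeNat, Computability.encodeNat, e]
  rcases (n : Num) with _ | p
  · exact ⟨0, [], by simp, rfl, rfl⟩
  · exact encodePosNum_succ p

/-- A crude bound is enough, since the numbers in question are already present in unary. -/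
theorem length_encodeNat_le (n : ℕ) : (Computability.encodeNat n).length ≤ n := by
  induction n with
  | zero => exact le_rfl
  | succ n ih =>
    obtain ⟨m, rest, _, h₁, h₂⟩ := encodeNat_succ n
    rw [h₁] at ih
    rw [h₂]
    simp at ih ⊢
    omega

namespace Cmd

section Drain

variable {K G : Type} {M : ℕ}

/-- A symbol has been read. -/
def someA (v : Reg G M) : Bool := v.a.isSome

/-- Run a program once for every symbol that is taken from a stack. -/
def drain (A : K) (body : Cmd K G (Reg G M)) : Cmd K G (Reg G M) :=
  seq (peek A setA) (loop someA (seq (pop A fun v _ => v) (seq body (peek A setA))))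

/-- An invariant rule: `Inv i` holds after `i` rounds. By `hA` the invariant ignores the register
entry `a` and the stack `A`, which the loop itself uses. -/
theorem drain_exec [DecidableEq K] {A : K} {body : Cmd K G (Reg G M)} {t N : ℕ}
    (Inv : ℕ → Reg G M → (K → List G) → Prop)
    (hbody : ∀ i < N, ∀ v S, Inv i v S → ∃ v' S', Exec body v S v' S' t ∧ Inv (i + 1) v' S' ∧
      S' A = S A)
    (hA : ∀ i v S x l, Inv i v S → Inv i (setA v x) (update S A l))
    (v : Reg G M) (S : K → List G) (hS : (S A).length = N) (h₀ : Inv 0 v S) :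
    ∃ v' S', Exec (drain A body) v S v' S' (N * (t + 3) + 2) ∧ Inv N v' S' ∧ S' A = [] := by
  have key : ∀ (n i : ℕ) (v : Reg G M) (S : K → List G), i + n = N → (S A).length = n →
      Inv i v S → v.a = (S A).head? →
      ∃ v' S', Exec (loop someA (seq (pop A fun v _ => v) (seq body (peek A setA)))) v S v' S'
        (n * (t + 3) + 1) ∧ Inv N v' S' ∧ S' A = [] := by
    intro n
    induction n with
    | zero =>
      intro i v S hi hn h hv
      have hA : S A = [] := List.length_eq_zero_iff.1 hn
      obtain rfl : i = N := by omega
      exact ⟨v, S, (Exec.loop_done (by simp [someA, hv, hA])).mono (by simp), h, hA⟩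
    | succ n ih =>
      intro i v S hi hn h hv
      have h' : Inv i v (update S A (S A).tail) := by
        have := hA i v S v.a (S A).tail h
        rwa [show setA v v.a = v from rfl] at this
      obtain ⟨v₁, S₁, c₁, h₁, e₁⟩ := hbody i (by omega) v _ h'
      rw [update_self] at e₁
      obtain ⟨v₂, S₂, c₂, h₂, e₂⟩ := ih (i + 1) (setA v₁ (S₁ A).head?) S₁ (by omega)
        (by rw [e₁]; simp [hn]) (by
          have := hA _ v₁ S₁ (S₁ A).head? (S₁ A) h₁
          rwa [update_eq_self] at this) rfl
      refine ⟨v₂, S₂, (Exec.loop_step (f := someA) ?_ (Exec.pop.seq (c₁.seq Exec.peek)) c₂).mono ?_,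
        h₂, e₂⟩
      · obtain ⟨x, l, e⟩ : ∃ x l, S A = x :: l := List.exists_cons_of_length_eq_add_one hn
        simp [someA, hv, e]
      · rw [add_one_mul n]; omega
  obtain ⟨v', S', c, h, e⟩ := key N 0 (setA v (S A).head?) S (by omega) hS (by
    have := hA _ v S (S A).head? (S A) h₀
    rwa [update_eq_self] at this) rfl
  exact ⟨v', S', (Exec.peek.seq c).mono (by omega), h, e⟩

end Drain

variable {Rel J : Type} {M : ℕ}

/-- A digit one. -/
def isTrue : InSymbol Rel → Bool
  | .bit b => b
  | _ => false

/-- Increment the binary number on the first scratch stack. -/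
noncomputable def increment : Cmd (WK J) (InSymbol Rel) (Reg (InSymbol Rel) M) :=
  -- The pop removes the digit zero that follows the ones, or does nothing at the end of the word.
  seq (xfer isTrue WK.t1 [WK.t3]) (seq (seq (pop WK.t1 fun v _ => v)
    (push WK.t1 fun _ => InSymbol.bit true))
      (drain WK.t3 (push WK.t1 fun _ => InSymbol.bit false)))

theorem increment_exec (n : ℕ) (T : WK J → List (InSymbol Rel))
    (h₁ : T WK.t1 = bits (Computability.encodeNat n)) (h₃ : T WK.t3 = [])
    (v : Reg (InSymbol Rel) M) :
    ∃ v', v'.r = v.r ∧ v'.g = v.g ∧ Exec increment v T v'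
      (update T WK.t1 (bits (Computability.encodeNat (n + 1)))) (9 * n + 10) := by
  obtain ⟨m, rest, hr, e₁, e₂⟩ := encodeNat_succ n
  have hm : m ≤ n := by
    have := length_encodeNat_le n
    rw [e₁] at this
    simp at this
    omega
  have c₁ := move_exec (A := WK.t1) (B := WK.t3) (p := isTrue) (by simp)
    (bits (Rel := Rel) (List.replicate m true)) (bits rest) (by simp [bits, isTrue]) (by
      rcases rest with _ | ⟨_ | _, rest⟩
      · rfl
      · rfl
      · simp at hr) v T (by rw [h₁, e₁]; simp [bits])
  rw [h₃, List.append_nil] at c₁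
  set U := update (update T WK.t1 (bits rest)) WK.t3
    (bits (Rel := Rel) (List.replicate m true)).reverse with hU
  set T₁ := update U WK.t1 (InSymbol.bit true :: bits rest.tail) with hT₁
  have cp : Exec (seq (pop WK.t1 fun v _ => v) (push WK.t1 fun _ => InSymbol.bit true))
      (setA v (bits (Rel := Rel) rest).head?) U (setA v (bits rest).head?) T₁ 2 :=
    (Exec.pop.seq Exec.push).cast (by simp [T₁, U, bits]) le_rfl
  obtain ⟨v₂, T₂, c₂, ⟨hr₂, hg₂, hI⟩, e⟩ := drain_exec (A := WK.t3)
    (body := push WK.t1 fun _ => InSymbol.bit false) (t := 1) (N := m)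
    (fun i (w : Reg (InSymbol Rel) M) S => w.r = v.r ∧ w.g = v.g ∧ ∀ k, k ≠ WK.t3 → S k =
      update T WK.t1 (List.replicate i (InSymbol.bit false) ++
        InSymbol.bit true :: bits rest.tail) k)
    (by
      rintro i - w S ⟨hr, hg, hS⟩
      refine ⟨_, _, Exec.push, ⟨hr, hg, ?_⟩, by simp⟩
      intro k hk
      by_cases hk' : k = WK.t1
      · subst hk'; simp [hS, List.replicate_succ]
      · simp [hk', hS k hk])
    (by
      rintro i w S x l ⟨hr, hg, hS⟩
      exact ⟨hr, hg, fun k hk => by simp [hk, hS k hk]⟩)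
    (setA v (bits (Rel := Rel) rest).head?) T₁ (by simp [T₁, U, bits])
    ⟨rfl, rfl, by
      intro k hk
      by_cases hk' : k = WK.t1
      · subst hk'; simp [T₁]
      · simp [T₁, U, hk', hk]⟩
  refine ⟨v₂, hr₂, hg₂, (c₁.seq (cp.seq c₂)).cast ?_ ?_⟩
  · funext k
    by_cases hk : k = WK.t3
    · subst hk; simp [e, h₃]
    · rw [hI k hk, e₂]
      simp [bits]
  · simp [bits]; omega

/-- Count a stack modulo `M` while moving it to another one. -/
def countMod : Cmd (WK J) (InSymbol Rel) (Reg (InSymbol Rel) M) :=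
  drain WK.cnt (seq (push WK.t2 fun _ => InSymbol.sep)
    (load fun v => { v with r := Fin.ofNat (M + 1) ((v.r.val + 1) % M) }))

/-- The residue modulo `M` fits into the register and suffices for the gcd, because `gcd N M = gcd
(N % M) M`. The unary number is moved, not consumed, as the division still needs it. -/
theorem countMod_exec (hM : 0 < M) (N : ℕ) (v : Reg (InSymbol Rel) M) (hv : v.r = 0) :
    ∃ v', v'.r.val = N % M ∧ Exec (countMod (J := J)) v
      (update (fun _ => []) WK.cnt (List.replicate N InSymbol.sep)) v'
      (update (fun _ => []) WK.t2 (List.replicate N InSymbol.sep)) (N * 5 + 2) := by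
  obtain ⟨v', T, c, ⟨hr, hT⟩, e⟩ := drain_exec (A := WK.cnt) (t := 2) (N := N)
    (body := seq (push (WK.t2 : WK J) fun _ => (InSymbol.sep : InSymbol Rel))
      (load fun v => { v with r := Fin.ofNat (M + 1) ((v.r.val + 1) % M) }))
    (fun i (w : Reg (InSymbol Rel) M) S => w.r.val = i % M ∧ ∀ k, k ≠ WK.cnt → S k =
      update (fun _ => []) WK.t2 (List.replicate i InSymbol.sep) k)
    (by
      rintro i - w S ⟨hr, hS⟩
      refine ⟨_, _, Exec.push.seq Exec.load, ⟨?_, ?_⟩, by simp⟩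
      · have := Nat.mod_lt (w.r.val + 1) hM
        simp only [Fin.ofNat]
        rw [Nat.mod_eq_of_lt (by omega), hr, Nat.mod_add_mod]
      · intro k hk
        by_cases hk' : k = WK.t2
        · subst hk'; simp [hS, List.replicate_succ]
        · simp [hk', hS k hk])
    (by
      rintro i w S x l ⟨hr, hS⟩
      exact ⟨hr, fun k hk => by simp [hk, hS k hk]⟩)
    v (update (fun _ => []) WK.cnt (List.replicate N InSymbol.sep)) (by simp) ⟨by simp [hv], by
      intro k hk
      by_cases hk' : k = WK.t2
      · subst hk'; simp
      · simp [hk', hk]⟩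
  refine ⟨v', hr, c.cast ?_ (by omega)⟩
  funext k
  by_cases hk : k = WK.cnt
  · subst hk; simp [e]
  · exact hT k hk

/-- The counted remainder completes the divisor. -/
def full {G : Type} (v : Reg G M) : Bool := v.r.val + 1 == v.g.val

/-- Divide the length of a stack by the recorded divisor, in binary. -/
noncomputable def divide : Cmd (WK J) (InSymbol Rel) (Reg (InSymbol Rel) M) :=
  drain WK.t2 (ite full (seq (load fun v => { v with r := 0 }) increment)
    (load fun v => { v with r := Fin.ofNat (M + 1) (v.r.val + 1) }))

/-- After `i` symbols the register holds `i % g` and `WK.t1` holds `i / g` in binary, where `g` is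
the divisor; the binary number is incremented whenever the remainder completes a cycle. -/
theorem divide_exec (N : ℕ) (v : Reg (InSymbol Rel) M) (hv : v.r = 0) (hg : 0 < v.g.val) :
    ∃ v', v'.g = v.g ∧ Exec (divide (J := J)) v
      (update (fun _ => []) WK.t2 (List.replicate N InSymbol.sep)) v'
      (update (fun _ => []) WK.t1 (bits (Computability.encodeNat (N / v.g.val))))
      (N * (9 * N + 15) + 2) := by
  obtain ⟨v', T, c, ⟨hr, hg, hT⟩, e⟩ := drain_exec (A := WK.t2) (t := 9 * N + 12) (N := N)
    (body := ite (full (M := M)) (seq (load fun v => { v with r := 0 })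
      (increment (J := J) (Rel := Rel)))
      (load fun v => { v with r := Fin.ofNat (M + 1) (v.r.val + 1) }))
    (fun i (w : Reg (InSymbol Rel) M) S => w.r.val = i % v.g.val ∧ w.g = v.g ∧
      ∀ k, k ≠ WK.t2 → S k =
        update (fun _ => []) WK.t1 (bits (Computability.encodeNat (i / v.g.val))) k)
    (by
      rintro i hi w S ⟨hr, hg', hS⟩
      by_cases hf : w.r.val + 1 = v.g.val
      · obtain ⟨w', hr', hg'', c⟩ := increment_exec (J := J) (M := M) (i / v.g.val) S
          (by simp [hS]) (by simp [hS]) { w with r := 0 }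
        have e : (i + 1) / v.g.val = i / v.g.val + 1 := by
          rw [Nat.succ_div, if_pos]
          rw [Nat.dvd_iff_mod_eq_zero, Nat.add_mod, ← hr]
          -- The divisor `1` is separate because `1 % 1 = 0`.
          rcases Nat.lt_or_ge 1 v.g.val with h | h
          · rw [Nat.mod_eq_of_lt h, hf, Nat.mod_self]
          · rw [show v.g.val = 1 by omega]; simp [Nat.mod_one]
        refine ⟨w', _, (Exec.ite_true (by simp [full, hg', hf]) (Exec.load.seq c)).mono ?_,
          ⟨?_, ?_, ?_⟩, by simp⟩
        · have := Nat.div_le_self i v.g.val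
          omega
        · rw [hr']
          have h := Nat.div_add_mod i v.g.val
          have h' := Nat.div_add_mod (i + 1) v.g.val
          rw [e, mul_add] at h'
          simp
          omega
        · rw [hg'']; exact hg'
        · intro k hk
          by_cases hk' : k = WK.t1
          · subst hk'; simp [e]
          · simp [hk', hS k hk]
      · have hlt := Nat.mod_lt i hg
        have hgM := v.g.isLt
        have h := Nat.div_add_mod i v.g.val
        have e : (i + 1) / v.g.val = i / v.g.val := by
          rw [← h, add_assoc, Nat.mul_add_div hg, Nat.div_eq_of_lt (a := i % v.g.val + 1) (by omega)]
          simp [Nat.mul_add_div hg, Nat.div_eq_of_lt hlt]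
        have h' := Nat.div_add_mod (i + 1) v.g.val
        rw [e] at h'
        refine ⟨_, _, (Exec.ite_false (by simpa [full, hg'] using hf) Exec.load).mono (by omega),
          ⟨?_, hg', by rw [e]; exact hS⟩, rfl⟩
        simp only [Fin.ofNat]
        rw [Nat.mod_eq_of_lt (by omega)]
        omega)
    (by
      rintro i w S x l ⟨hr, hg, hS⟩
      exact ⟨hr, hg, fun k hk => by simp [hk, hS k hk]⟩)
    v (update (fun _ => []) WK.t2 (List.replicate N InSymbol.sep)) (by simp) ⟨by simp [hv], rfl, by
      intro k hk
      by_cases hk' : k = WK.t1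
      · subst hk'; simp [Computability.encodeNat, Computability.encodeNum, bits]
      · simp [hk', hk]⟩
  refine ⟨v', hg, c.cast ?_ (by ring_nf; omega)⟩
  funext k
  by_cases hk : k = WK.t2
  · subst hk; simp [e]
  · exact hT k hk

/-- The recorded divisor is `d`. -/
def divisorIs {G : Type} (d : ℕ) (v : Reg G M) : Bool := v.g.val == d

/-- Write the reduced denominator, for one of several possible divisors. -/
noncomputable def writeDen : List ℕ → Cmd (WK J) (InSymbol Rel) (Reg (InSymbol Rel) M)
  | [] => skip
  | d :: ds => ite (divisorIs d)
      (build WK.t2 ((bits (Computability.encodeNat (M / d))).reverse.map Sum.inl)) (writeDen ds)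

/-- The denominator is `M` divided by one of finitely many numbers, so all possible binary words are
built into the program. -/
theorem writeDen_exec (ds : List ℕ) (v : Reg (InSymbol Rel) M) (hv : v.g.val ∈ ds)
    (T : WK J → List (InSymbol Rel)) (hT : ∀ k, k ≠ WK.t2 → T k = []) :
    ∃ v', Exec (writeDen ds) v T v' (update T WK.t2
      ((bits (Computability.encodeNat (M / v.g.val))).reverse ++ T WK.t2))
      (ds.length + M * 11 + 1) := by
  induction ds with
  | nil => simp at hv
  | cons d ds ih =>
    by_cases h : v.g.val = d
    · obtain ⟨v', c⟩ := build_exec (M := M) (k := WK.t2) (n := 0) (by simp) (by simp)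
        ((bits (Computability.encodeNat (M / d))).reverse.map Sum.inl) T (by simp [hT])
        (hT _ (by simp)) v
      refine ⟨v', (Exec.ite_true (by simpa [divisorIs] using h) c).cast ?_ ?_⟩
      · rw [h]
        rw [wordOf, List.flatMap_map]; simp
      · have h₁ := length_encodeNat_le (M / d)
        have h₂ := Nat.div_le_self M d
        simp
        omega
    · obtain ⟨v', c⟩ := ih (by simpa [h] using hv)
      exact ⟨v', (Exec.ite_false (by simpa [divisorIs] using h) c).mono (by simp only [List.length_cons]; omega)⟩

/-- Write the number of symbols of the counter, divided by `M`, as a reduced fraction. -/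
noncomputable def finish : Cmd (WK J) (InSymbol Rel) (Reg (InSymbol Rel) M) :=
  seq (load fun v => { v with r := 0 }) (seq countMod
    (seq (load fun v => { v with r := 0, g := Fin.ofNat (M + 1) (Nat.gcd v.r.val M) })
      (seq divide (seq (xfer (fun _ => true) WK.t1 [WK.t2]) (seq (push WK.t2 fun _ => InSymbol.sep)
        (writeDen (List.range (M + 1))))))))

/-- The output symbol of a stack symbol. -/
def outSymbol : InSymbol Rel → OutSymbol
  | .bit b => OutSymbol.bit b
  | _ => OutSymbol.slash

/-- Dividing both numbers by their gcd leaves coprime numbers, which are then the numerator and the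
denominator of the rational number. It is nonnegative, so no sign is written. -/
theorem encodeRat_div (N : ℕ) (hM : 0 < M) :
    encodeRat ((N : ℚ) / M) = (Computability.encodeNat (N / N.gcd M)).map OutSymbol.bit ++
      OutSymbol.slash :: (Computability.encodeNat (M / N.gcd M)).map OutSymbol.bit := by
  have hg : 0 < N.gcd M := Nat.gcd_pos_of_pos_right _ hM
  obtain ⟨a, ha⟩ := Nat.gcd_dvd_left N M
  obtain ⟨b, hb⟩ := Nat.gcd_dvd_right N M
  have hb0 : 0 < b := by
    rcases Nat.eq_zero_or_pos b with rfl | h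
    · omega
    · exact h
  have ha' : N / N.gcd M = a := Nat.div_eq_of_eq_mul_right hg ha
  have hb' : M / N.gcd M = b := Nat.div_eq_of_eq_mul_right hg hb
  have hab : Nat.Coprime a b := by
    rw [← ha', ← hb']; exact Nat.coprime_div_gcd_div_gcd hg
  have e : (N : ℚ) / M = ((a : ℤ) : ℚ) / ((b : ℤ) : ℚ) := by
    have h₁ : (N : ℚ) = (N.gcd M : ℚ) * a := by exact_mod_cast ha
    have h₂ : (M : ℚ) = (N.gcd M : ℚ) * b := by exact_mod_cast hb
    have h₃ : (N.gcd M : ℚ) ≠ 0 := by positivity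
    rw [h₁, h₂, mul_div_mul_left _ _ h₃]
    simp
  have hnum : ((N : ℚ) / M).num = a := by
    rw [e]; exact Rat.num_div_eq_of_coprime (by exact_mod_cast hb0) (by simpa using hab)
  have hden : ((N : ℚ) / M).den = b := by
    have := Rat.den_div_eq_of_coprime (a := a) (b := b) (by exact_mod_cast hb0) (by simpa using hab)
    rw [e]; exact_mod_cast this
  have hneg : ¬ (N : ℚ) / M < 0 := not_lt.2 (by positivity)
  rw [encodeRat, if_neg hneg, hnum, hden, ha', hb']
  simp

/-- The fraction is piled up on `WK.t2` with its first symbol at the bottom. The machine reverses it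
on the way to the output stack, hence `res.reverse`; the symbol `sep` becomes the slash. -/
theorem finish_exec (hM : 0 < M) (N : ℕ) (v : Reg (InSymbol Rel) M) :
    ∃ v' res, Exec (finish (J := J)) v
      (update (fun _ => []) WK.cnt (List.replicate N InSymbol.sep)) v'
      (update (fun _ => []) WK.t2 res) (9 * N * N + 25 * N + 12 * M + 30) ∧
      res.reverse.map outSymbol = encodeRat ((N : ℚ) / M) := by
  obtain ⟨v₁, hr, c₁⟩ := countMod_exec (J := J) hM N { v with r := 0 } rfl
  have hgM : Nat.gcd v₁.r.val M = N.gcd M := by rw [hr, ← Nat.gcd_rec, Nat.gcd_comm]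
  have hg : 0 < N.gcd M := Nat.gcd_pos_of_pos_right _ hM
  set v₂ : Reg (InSymbol Rel) M :=
    { v₁ with r := 0, g := Fin.ofNat (M + 1) (Nat.gcd v₁.r.val M) } with hv₂
  have hg₂ : v₂.g.val = N.gcd M := by
    simp only [hv₂, Fin.ofNat, hgM]
    exact Nat.mod_eq_of_lt (Nat.lt_succ_of_le (Nat.gcd_le_right _ hM))
  obtain ⟨v₃, hg₃, c₃⟩ := divide_exec (J := J) N v₂ rfl (by rw [hg₂]; exact hg)
  set w := bits (Rel := Rel) (Computability.encodeNat (N / v₂.g.val)) with hw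
  have c₄ := moveAll_exec (M := M) (A := WK.t1) (B := (WK.t2 : WK J)) (by simp) v₃
    (update (fun _ => []) WK.t1 w)
  rw [update_self, update_idem, update_of_ne (by simp), List.append_nil] at c₄
  have e₄ : update (update (fun _ => []) (WK.t1 : WK J) []) WK.t2 w.reverse =
      update (fun _ => []) WK.t2 w.reverse := by
    rw [update_eq_self_iff.2 rfl]
  rw [e₄] at c₄
  obtain ⟨v₅, c₅⟩ := writeDen_exec (J := J) (List.range (M + 1)) (setA v₃ none)
    (by simp only [setA, List.mem_range]; exact v₃.g.isLt)
    (update (fun _ => []) WK.t2 (InSymbol.sep :: w.reverse)) (by intro k hk; simp [hk])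
  have c₆ := @Exec.push (WK J) (InSymbol Rel) (Reg (InSymbol Rel) M) _ WK.t2
    (fun _ => InSymbol.sep) (setA v₃ none) (update (fun _ => []) WK.t2 w.reverse)
  rw [update_self, update_idem] at c₆
  rw [update_self, update_idem] at c₅
  refine ⟨v₅, _, (Exec.load.seq (c₁.seq (Exec.load.seq (c₃.seq (c₄.seq (c₆.seq c₅)))))).cast rfl ?_,
    ?_⟩
  · have h₁ := length_encodeNat_le (N / v₂.g.val)
    have h₂ := Nat.div_le_self N v₂.g.val
    simp only [hw, length_bits, List.length_range]
    ring_nf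
    omega
  · rw [encodeRat_div N hM]
    simp only [setA, hg₃, hg₂, hw, bits]
    simp [Function.comp_def, outSymbol]

end Cmd
end SignedShapley

namespace SignedShapley

open Function

/-! ### The Shapley value of a count of minimal supports -/

section Orderings

variable {F : Type*} {D : Finset F}

open scoped Classical in
/-- The number of orderings in which a given element of `U` is the last one of `U`. -/
theorem card_orderings_last {n : ℕ} {X : Type*} [Fintype X] [DecidableEq X] (U : Finset X) (a : X)
    (ha : a ∈ U) :
    (Finset.univ.filter fun e : X ≃ Fin n => ∀ b ∈ U, e b ≤ e a).card * U.card =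
      Fintype.card (X ≃ Fin n) := by
  -- Composition with the transposition of `a` and `b` exchanges the orderings that end with `a` on
  -- `U` and those that end with `b`.
  have hsymm : ∀ b ∈ U, (Finset.univ.filter fun e : X ≃ Fin n => ∀ d ∈ U, e d ≤ e b).card =
      (Finset.univ.filter fun e : X ≃ Fin n => ∀ d ∈ U, e d ≤ e a).card := by
    intro b hb
    have hU : ∀ d ∈ U, Equiv.swap a b d ∈ U := by
      intro d hd
      rw [Equiv.swap_apply_def]
      split_ifs <;> assumption
    refine Finset.card_bij' (fun e _ => (Equiv.swap a b).trans e)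
      (fun e _ => (Equiv.swap a b).trans e) ?_ ?_ ?_ ?_
    · intro e he
      rw [Finset.mem_filter] at he ⊢
      refine ⟨Finset.mem_univ _, fun d hd => ?_⟩
      simpa using he.2 _ (hU d hd)
    · intro e he
      rw [Finset.mem_filter] at he ⊢
      refine ⟨Finset.mem_univ _, fun d hd => ?_⟩
      simpa using he.2 _ (hU d hd)
    · intro e _; ext x; simp
    · intro e _; ext x; simp
  -- Each ordering has exactly one last element of `U`; summing over all orderings gives the claim.
  have hone : ∀ e : X ≃ Fin n, ∑ b ∈ U, (if ∀ d ∈ U, e d ≤ e b then 1 else 0) = 1 := by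
    intro e
    obtain ⟨m, hm, hmax⟩ := U.exists_max_image e ⟨a, ha⟩
    rw [Finset.sum_eq_single_of_mem m hm, if_pos hmax]
    intro b hb hbm
    rw [if_neg]
    intro h
    exact hbm (e.injective (le_antisymm (hmax b hb) (h m hm)))
  calc _ = ∑ b ∈ U, (Finset.univ.filter fun e : X ≃ Fin n => ∀ d ∈ U, e d ≤ e b).card := by
        rw [Finset.sum_congr rfl hsymm, Finset.sum_const, smul_eq_mul, mul_comm]
    _ = ∑ b ∈ U, ∑ e : X ≃ Fin n, (if ∀ d ∈ U, e d ≤ e b then 1 else 0) := by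
        simp only [Finset.card_filter]
    _ = _ := by
        rw [Finset.sum_comm, Finset.sum_congr rfl fun e _ => hone e]
        simp

open scoped Classical in
/-- The Shapley value of a sum of unanimity games. -/
theorem shapley_eq_sum (A : Finset (Finset F)) (hA : ∀ T ∈ A, T ⊆ D) (ξ : Finset F → ℝ)
    (hξ : ∀ D' ⊆ D, ξ D' = (A.filter (· ⊆ D')).card) (α : D) :
    shapley D ξ α = ∑ T ∈ A, if α.1 ∈ T then 1 / (T.card : ℝ) else 0 := by
  have hlt : ∀ e : D ≃ Fin D.card, (Finset.univ.filter fun β : D => e β < e α).map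
      (Function.Embedding.subtype _) ⊆ D := by
    intro e x hx
    obtain ⟨y, _, rfl⟩ := Finset.mem_map.1 hx
    exact y.2
  -- The set `T` is completed by the arrival of `α` if and only if `α` belongs to `T` and comes last
  -- in it.
  have hterm : ∀ e : D ≃ Fin D.card,
      (ξ (insert α.1 ((Finset.univ.filter fun β : D => e β < e α).map
            (Function.Embedding.subtype _)))
        - ξ ((Finset.univ.filter fun β : D => e β < e α).map (Function.Embedding.subtype _))) =
      ∑ T ∈ A, if α.1 ∈ T ∧ ∀ β ∈ T.subtype (· ∈ D), e β ≤ e α then 1 else 0 := by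
    intro e
    rw [hξ _ (hlt e), hξ _ (Finset.insert_subset α.2 (hlt e)), Finset.card_filter,
      Finset.card_filter]
    push_cast
    rw [← Finset.sum_sub_distrib]
    refine Finset.sum_congr rfl fun T hT => ?_
    have h₁ : T ⊆ insert α.1 ((Finset.univ.filter fun β : D => e β < e α).map
        (Function.Embedding.subtype _)) ↔ ∀ β ∈ T.subtype (· ∈ D), e β ≤ e α := by
      constructor
      · intro h β hβ
        rcases Finset.mem_insert.1 (h (Finset.mem_subtype.1 hβ)) with h' | h'
        · rw [Subtype.ext h']
        · obtain ⟨y, hy, hy'⟩ := Finset.mem_map.1 h'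
          obtain rfl : y = β := Subtype.ext hy'
          exact (Finset.mem_filter.1 hy).2.le
      · intro h x hx
        have hle := h ⟨x, hA T hT hx⟩ (Finset.mem_subtype.2 hx)
        rcases hle.lt_or_eq with h' | h'
        · exact Finset.mem_insert_of_mem (Finset.mem_map.2 ⟨⟨x, hA T hT hx⟩, by simpa using h', rfl⟩)
        · rw [← e.injective h']
          exact Finset.mem_insert_self _ _
    have h₂ : T ⊆ (Finset.univ.filter fun β : D => e β < e α).map
        (Function.Embedding.subtype _) ↔ α.1 ∉ T ∧ ∀ β ∈ T.subtype (· ∈ D), e β ≤ e α := by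
      rw [← h₁]
      constructor
      · intro h
        refine ⟨fun hα => ?_, h.trans (Finset.subset_insert _ _)⟩
        obtain ⟨y, hy, hy'⟩ := Finset.mem_map.1 (h hα)
        obtain rfl : y = α := Subtype.ext hy'
        simp at hy
      · rintro ⟨hα, h⟩
        exact (Finset.subset_insert_iff_of_notMem hα).1 h
    rw [if_congr h₁ rfl rfl, if_congr h₂ rfl rfl]
    by_cases hα : α.1 ∈ T <;> by_cases h : ∀ β ∈ T.subtype (· ∈ D), e β ≤ e α <;>
      simp only [hα, h, not_true, not_false_iff, true_and, false_and, if_false] <;> norm_num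
  have hpos : (0 : ℝ) < (Fintype.card (D ≃ Fin D.card) : ℝ) := by
    rw [Nat.cast_pos]
    exact Fintype.card_pos_iff.2 ⟨D.equivFin⟩
  rw [shapley, Finset.sum_congr rfl fun e _ => hterm e, Finset.sum_comm, Finset.sum_div]
  refine Finset.sum_congr rfl fun T hT => ?_
  by_cases hα : α.1 ∈ T
  · have h := card_orderings_last (n := D.card) (T.subtype (· ∈ D)) α (Finset.mem_subtype.2 hα)
    have hc : (T.subtype (· ∈ D)).card = T.card := by
      rw [Finset.card_subtype, Finset.filter_true_of_mem (hA T hT)]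
    rw [hc] at h
    have hT0 : (0 : ℝ) < T.card := Nat.cast_pos.2 (Finset.card_pos.2 ⟨_, hα⟩)
    simp only [hα, true_and, if_true]
    rw [Finset.sum_boole, div_eq_div_iff hpos.ne' hT0.ne', one_mul]
    exact_mod_cast h
  · simp [hα]

end Orderings

/-! ### Minimal supports of signed queries and valuations in the active domain -/

section Supports

variable {S : Schema} {Const Var : Type}

theorem IsSupport.mono {q : UCQneg S Const Var} {D D' T : Database S Const} (h : IsSupport q D' T)
    (hD : D' ⊆ D) : IsSupport q D T :=
  ⟨h.1.trans hD, h.2⟩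

/-- The ambient database enters only through `T ⊆ D`, and a competitor below `T` lies in `D'` as
soon as `T` does. This is what makes the number of minimal supports a sum of unanimity games. -/
theorem isMinimalSupport_iff {q : UCQneg S Const Var} {D D' T : Database S Const} (hD : D' ⊆ D) :
    IsMinimalSupport q D' T ↔ IsMinimalSupport q D T ∧ T ⊆ D' := by
  constructor
  · intro h
    exact ⟨⟨h.1.mono hD, fun U hU hUT => h.2 ⟨hUT.trans h.1.1, hU.2⟩ hUT⟩, h.1.1⟩
  · rintro ⟨h, hT⟩
    exact ⟨⟨hT, h.1.2⟩, fun U hU hUT => h.2 (hU.mono hD) hUT⟩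

open scoped Classical in
theorem shapley_msScore (q : UCQneg S Const Var) (D : Database S Const) (α : D) :
    shapley D (msScore q) α =
      ∑ T ∈ D.powerset.filter (IsMinimalSupport q D),
        if α.1 ∈ T then 1 / (T.card : ℝ) else 0 := by
  refine (shapley_eq_sum (D.powerset.filter (IsMinimalSupport q D)) ?_ _ ?_ α).trans
    (Finset.sum_congr rfl fun T _ => by congr)
  · intro T hT
    exact Finset.mem_powerset.1 (Finset.mem_filter.1 hT).1
  · intro D' hD
    rw [msScore]
    congr 2
    ext T
    simp only [Finset.mem_filter, Finset.mem_powerset, isMinimalSupport_iff hD]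
    constructor
    · rintro ⟨h, h', _⟩
      exact ⟨⟨h.trans hD, h'⟩, h⟩
    · rintro ⟨⟨_, h⟩, h'⟩
      exact ⟨h', h, h'⟩

/-- Forget the sign of a signed fact. -/
def unsign : Fact S.signed Const → Fact S Const
  | ⟨Sum.inl R, c⟩ => ⟨R, c⟩
  | ⟨Sum.inr R, c⟩ => ⟨R, c⟩

theorem plus_ne_minus (f g : Fact S Const) : Atom.plus f ≠ Atom.minus g := fun h =>
  absurd (congrArg Sigma.fst h) (by simp [Atom.plus, Atom.minus])

theorem plus_injective : Injective (Atom.plus : Fact S Const → Fact S.signed Const) :=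
  fun _ _ h => congrArg unsign h

theorem minus_injective : Injective (Atom.minus : Fact S Const → Fact S.signed Const) :=
  fun _ _ h => congrArg unsign h

theorem plus_mem_signedDatabase {D : Database S Const} {f : Fact S Const} :
    Atom.plus f ∈ signedDatabase D ↔ f ∈ D := by
  classical
  simp only [signedDatabase, Finset.mem_union, Finset.mem_image]
  constructor
  · rintro (⟨g, h, e⟩ | ⟨g, _, e⟩)
    · rwa [← plus_injective e]
    · exact absurd e.symm (plus_ne_minus _ _)
  · exact fun h => Or.inl ⟨f, h, rfl⟩

theorem minus_mem_signedDatabase {D : Database S Const} {f : Fact S Const} :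
    Atom.minus f ∈ signedDatabase D ↔ f ∉ D ∧ ∀ i, f.2 i ∈ activeDomain D := by
  classical
  simp only [signedDatabase, Finset.mem_union, Finset.mem_image]
  constructor
  · rintro (⟨g, _, e⟩ | ⟨g, h, e⟩)
    · exact absurd e (plus_ne_minus _ _)
    · rw [← minus_injective e]
      simpa [and_comm] using h
  · exact fun h => Or.inr ⟨f, by simpa [and_comm] using h, rfl⟩

open scoped Classical in
-- The signed database is never written down: membership of a negative fact is tested through its
-- absence from the facts and the presence of its constants in the active domain.
theorem valid_iff {facts : List (Fact S Const)} {L : List Const}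
    (hL : ∀ c, c ∈ L ↔ c ∈ activeDomain facts.toFinset) (p : CQneg S Const Var) (μ : Var → Const) :
    Valid facts L p μ ↔ cover p.signed μ ⊆ signedDatabase facts.toFinset ∧
      ∀ t ∈ p.ineq, t.1.eval μ ≠ t.2.eval μ := by
  have h₁ : ∀ A ∈ p.pos, Atom.eval μ A ∈ facts ↔
      Atom.eval μ (Atom.plus A) ∈ signedDatabase facts.toFinset := fun A _ => by
    rw [show Atom.eval μ (Atom.plus A) = Atom.plus (Atom.eval μ A) from rfl,
      plus_mem_signedDatabase, List.mem_toFinset]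
  have h₂ : ∀ A ∈ p.neg, (Atom.eval μ A ∉ facts ∧ ∀ t ∈ List.ofFn A.2, t.eval μ ∈ L) ↔
      Atom.eval μ (Atom.minus A) ∈ signedDatabase facts.toFinset := fun A _ => by
    rw [show Atom.eval μ (Atom.minus A) = Atom.minus (Atom.eval μ A) from rfl,
      minus_mem_signedDatabase, List.mem_toFinset]
    simp [List.mem_ofFn, hL, Atom.eval]
  have h₃ : cover p.signed μ ⊆ signedDatabase facts.toFinset ↔
      (∀ A ∈ p.pos, Atom.eval μ (Atom.plus A) ∈ signedDatabase facts.toFinset) ∧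
      ∀ A ∈ p.neg, Atom.eval μ (Atom.minus A) ∈ signedDatabase facts.toFinset := by
    simp only [cover, CQneg.signed, Finset.subset_iff, List.mem_toFinset, List.mem_map,
      List.mem_append]
    constructor
    · intro h
      exact ⟨fun A hA => h ⟨_, Or.inl ⟨A, hA, rfl⟩, rfl⟩, fun A hA => h ⟨_, Or.inr ⟨A, hA, rfl⟩, rfl⟩⟩
    · rintro ⟨h, h'⟩ _ ⟨_, ⟨A, hA, rfl⟩ | ⟨A, hA, rfl⟩, rfl⟩
      · exact h A hA
      · exact h' A hA
  rw [h₃, and_assoc, Valid]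
  exact and_congr (forall₂_congr h₁) (and_congr (forall₂_congr h₂) Iff.rfl)

/-- The signed query has no negated atoms, so its atoms hold in `T` if and only if their image is
contained in `T`. -/
theorem models_signed_iff {q : UCQneg S Const Var} {T : Database S.signed Const} :
    Models T q.signed ↔ ∃ p ∈ q, ∃ μ : Var → Const, cover p.signed μ ⊆ T ∧
      ∀ t ∈ p.ineq, t.1.eval μ ≠ t.2.eval μ := by
  simp only [Models, UCQneg.signed, List.mem_map, exists_exists_and_eq_and, CQneg.SatisfiedBy]
  refine exists_congr fun p => and_congr_right fun _ => exists_congr fun μ => ?_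
  refine and_congr ?_ ?_
  · simp only [cover, Finset.subset_iff, List.mem_toFinset, List.mem_map, forall_exists_index,
      and_imp, forall_apply_eq_imp_iff₂]
  · simp [CQneg.signed]

theorem Term.eval_congr {μ μ' : Var → Const} {t : Term Const Var}
    (h : ∀ x, t = Term.var x → μ x = μ' x) : t.eval μ = t.eval μ' := by
  rcases t with c | x
  · rfl
  · exact h x rfl

theorem Atom.eval_congr {μ μ' : Var → Const} {A : Atom S (Term Const Var)}
    (h : ∀ x, A.HasVar x → μ x = μ' x) : Atom.eval μ A = Atom.eval μ' A := by
  simp only [Atom.eval]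
  congr 1
  funext i
  exact Term.eval_congr fun x hx => h x ⟨i, hx⟩

/-- By safety, the variables of the positive atoms include those of the negated ones. -/
theorem cover_signed_congr {p : CQneg S Const Var} {μ μ' : Var → Const}
    (h : ∀ A ∈ p.pos, ∀ x, A.HasVar x → μ x = μ' x) : cover p.signed μ = cover p.signed μ' := by
  classical
  rw [cover, cover]
  congr 1
  refine List.map_congr_left fun A hA => ?_
  rcases List.mem_append.1 hA with hA | hA
  · obtain ⟨B, hB, rfl⟩ := List.mem_map.1 hA
    exact Atom.eval_congr (S := S.signed) fun x hx => h B hB x hx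
  · obtain ⟨B, hB, rfl⟩ := List.mem_map.1 hA
    refine Atom.eval_congr (S := S.signed) fun x hx => ?_
    obtain ⟨B', hB', hx'⟩ := p.safe_neg B hB x hx
    exact h B' hB' x hx'

/-- The type `Var` may be infinite; the loops of the programs run only over the finitely many
variables in `W`. -/
theorem exists_finset_vars (q : UCQneg S Const Var) :
    ∃ W : Finset Var, ∀ p ∈ q, ∀ A ∈ p.pos, ∀ x, A.HasVar x → x ∈ W := by
  classical
  have hA : ∀ A : Atom S (Term Const Var), ∃ W : Finset Var, ∀ x, A.HasVar x → x ∈ W := by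
    intro A
    have hf : {x | A.HasVar x}.Finite := by
      refine (Set.finite_range A.2).preimage (f := Term.var) ?_ |>.subset ?_
      · intro x _ y _ h
        exact Term.var.inj h
      · rintro x ⟨i, hi⟩
        exact ⟨i, hi⟩
    exact ⟨hf.toFinset, fun x hx => hf.mem_toFinset.2 hx⟩
  choose V hV using hA
  refine ⟨q.toFinset.biUnion fun p => p.pos.toFinset.biUnion V, fun p hp A hA x hx => ?_⟩
  simp only [Finset.mem_biUnion, List.mem_toFinset]
  exact ⟨p, hp, A, hA, hV A x hx⟩

open scoped Classical in
-- A variable of a positive atom takes a value that occurs in a fact of the database, hence in the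
-- active domain. Any other variable of `W` with a value outside `L` may be reset to `c₁`: by safety
-- this changes neither the cover nor the inequalities. So searching the active domain misses no
-- support.
theorem exists_valid {facts : List (Fact S Const)} {L : List Const}
    (hL : ∀ c, c ∈ L ↔ c ∈ activeDomain facts.toFinset) {c₁ : Const} (hc₁ : c₁ ∈ L) (c₀ : Const)
    {W : Finset Var} {p : CQneg S Const Var} (hW : ∀ A ∈ p.pos, ∀ x, A.HasVar x → x ∈ W)
    {μ : Var → Const} (hμ : Valid facts L p μ) :
    ∃ ν : W → Const, (∀ x, ν x ∈ L) ∧ Valid facts L p (Cmd.val c₀ ν) ∧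
      cover p.signed (Cmd.val c₀ ν) = cover p.signed μ := by
  refine ⟨fun x => if μ x ∈ L then μ x else c₁, fun x => ?_, ?_⟩
  · by_cases h : μ x ∈ L <;> simp [h, hc₁]
  set ν : W → Const := fun x => if μ x ∈ L then μ x else c₁ with hν
  have key : ∀ A ∈ p.pos, ∀ x, A.HasVar x → Cmd.val c₀ ν x = μ x := by
    intro A hA x hx
    have hxW := hW A hA x hx
    have hxL : μ x ∈ L := by
      rw [hL, activeDomain, Finset.mem_biUnion]
      refine ⟨_, List.mem_toFinset.2 (hμ.1 A hA), ?_⟩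
      obtain ⟨i, hi⟩ := hx
      exact Finset.mem_image.2 ⟨i, Finset.mem_univ _, by simp [Atom.eval, hi, Term.eval]⟩
    simp [Cmd.val, hxW, hν, hxL]
  have hcov := cover_signed_congr key
  refine ⟨?_, hcov⟩
  rw [valid_iff hL] at hμ ⊢
  rw [hcov]
  refine ⟨hμ.1, fun t ht => ?_⟩
  have e : ∀ u : Term Const Var, (u = t.1 ∨ u = t.2) → u.eval (Cmd.val c₀ ν) = u.eval μ := by
    intro u hu
    refine Term.eval_congr fun x hx => ?_
    obtain ⟨B, hB, hx'⟩ := p.safe_ineq t ht x (by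
      rcases hu with rfl | rfl
      · exact Or.inl hx
      · exact Or.inr hx)
    exact key B hB x hx'
  rw [e _ (Or.inl rfl), e _ (Or.inr rfl)]
  exact hμ.2 t ht

end Supports
end SignedShapley

namespace SignedShapley

open Function

/-! ### Counting minimal supports through canonical valuations -/

variable {S : Schema} {Const Var : Type}

open scoped Classical in
/-- Summation over an image, with each value represented by the preimage of least rank. -/
theorem sum_image_least {ι β R : Type*} [DecidableEq β] [LinearOrder R] (A : Finset ι) (c : ι → β) (r : ι → R)
    (hr : Injective r) (f : β → ℝ) :
    ∑ b ∈ A.image c, f b =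
      ∑ x ∈ A.filter (fun x => ∀ y ∈ A, c y = c x → ¬r y < r x), f (c x) := by
  rw [← Finset.sum_image (s := A.filter (fun x => ∀ y ∈ A, c y = c x → ¬r y < r x)) (g := c) (f := f)]
  · refine Finset.sum_congr ?_ fun _ _ => rfl
    ext b
    rw [Finset.mem_image, Finset.mem_image]
    constructor
    · rintro ⟨x, hx, rfl⟩
      obtain ⟨m, hm, hmin⟩ := (A.filter (fun y => c y = c x)).exists_min_image r
        ⟨x, Finset.mem_filter.2 ⟨hx, rfl⟩⟩
      rw [Finset.mem_filter] at hm
      refine ⟨m, Finset.mem_filter.2 ⟨hm.1, fun y hy hyc => not_lt.2 (hmin y ?_)⟩, hm.2⟩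
      exact Finset.mem_filter.2 ⟨hy, hyc.trans hm.2⟩
    · rintro ⟨x, hx, rfl⟩
      exact ⟨x, (Finset.mem_filter.1 hx).1, rfl⟩
  · intro x hx y hy hxy
    have hx' := Finset.mem_filter.1 (Finset.mem_coe.1 hx)
    have hy' := Finset.mem_filter.1 (Finset.mem_coe.1 hy)
    exact hr (le_antisymm (not_lt.1 (hx'.2 y hy'.1 hxy.symm)) (not_lt.1 (hy'.2 x hx'.1 hxy)))

section

variable (c₀ : Const) {W : Finset Var} (q : UCQneg S Const Var) (facts : List (Fact S Const))
  (L : List Const)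

/-- The set of facts of a disjunct and a valuation of the variables. -/
noncomputable def coverOf (x : Fin q.length × (W → Const)) : Finset (Fact S.signed Const) :=
  cover (q.get x.1).signed (Cmd.val c₀ x.2)

/-- A disjunct and a valuation of the variables in the active domain that yield a support. -/
def IsCandidate (x : Fin q.length × (W → Const)) : Prop :=
  (∀ w, x.2 w ∈ L) ∧ Valid facts L (q.get x.1) (Cmd.val c₀ x.2)

open scoped Classical in
-- The cover of a candidate is a support, and every support contains the cover of a candidate.
-- Minimal supports are therefore the covers that are minimal among the covers of candidates.
theorem isMinimalSupport_signed_iff {facts} {L}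
    (hL : ∀ c, c ∈ L ↔ c ∈ activeDomain facts.toFinset) {c₁ : Const} (hc₁ : c₁ ∈ L)
    (hW : ∀ p ∈ q, ∀ A ∈ p.pos, ∀ x, A.HasVar x → x ∈ W) (T : Database S.signed Const) :
    IsMinimalSupport q.signed (signedDatabase facts.toFinset) T ↔
      ∃ x : Fin q.length × (W → Const), (IsCandidate c₀ q facts L x ∧
        ∀ y : Fin q.length × (W → Const), IsCandidate c₀ q facts L y →
          coverOf c₀ q y ⊆ coverOf c₀ q x → coverOf c₀ q x ⊆ coverOf c₀ q y) ∧
        coverOf c₀ q x = T := by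
  have hsup : ∀ x : Fin q.length × (W → Const), IsCandidate c₀ q facts L x →
      IsSupport q.signed (signedDatabase facts.toFinset) (coverOf c₀ q x) := by
    intro x hx
    have h := (valid_iff hL _ _).1 hx.2
    exact ⟨h.1, models_signed_iff.2 ⟨_, List.get_mem q x.1, _, le_rfl, h.2⟩⟩
  have hcand : ∀ U, IsSupport q.signed (signedDatabase facts.toFinset) U →
      ∃ x : Fin q.length × (W → Const), IsCandidate c₀ q facts L x ∧ coverOf c₀ q x ⊆ U := by
    intro U hU
    obtain ⟨p, hp, μ, h, h'⟩ := models_signed_iff.1 hU.2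
    obtain ⟨i, rfl⟩ := List.get_of_mem hp
    obtain ⟨ν, h₁, h₂, h₃⟩ := exists_valid hL hc₁ c₀ (hW _ hp)
      ((valid_iff hL _ _).2 ⟨h.trans hU.1, h'⟩)
    exact ⟨(i, ν), ⟨h₁, h₂⟩, h₃.le.trans h⟩
  constructor
  · intro hT
    obtain ⟨x, hx, hxT⟩ := hcand T hT.1
    have e : coverOf c₀ q x = T := le_antisymm hxT (hT.2 (hsup x hx) hxT)
    refine ⟨x, ⟨hx, fun y hy hyx => ?_⟩, e⟩
    rw [e] at hyx ⊢
    exact hT.2 (hsup y hy) hyx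
  · rintro ⟨x, ⟨hx, hmin⟩, rfl⟩
    refine ⟨hsup x hx, fun U hU hUx => ?_⟩
    obtain ⟨y, hy, hyU⟩ := hcand U hU
    exact (hmin y hy (hyU.trans hUx)).trans hyU

variable (enc : Computability.Encoding Const Bool)

/-- The rank by which one of the representations of a minimal support is selected. -/
noncomputable def candidateRank (x : Fin q.length × (W → Const)) :
    Fin q.length ×ₗ List (InSymbol S.Rel) :=
  toLex (x.1, Cmd.rankWord enc x.2)

theorem candidateRank_injective : Injective (candidateRank (W := W) q enc) := by
  rintro ⟨i, ν⟩ ⟨i', ν'⟩ h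
  have h' := toLex.injective h
  rw [Prod.mk.injEq] at h' ⊢
  exact ⟨h'.1, Cmd.rankWord_injective enc h'.2⟩

/-- This links the form that programs can decide with the form of `sum_image_least`: mutual
inclusion of covers becomes equality, and the two comparisons become one in a lexicographic product.
-/
theorem canonical_iff (ctx : Ctx S Const) (i : Fin q.length) (s : ℕ) (ν : W → Const)
    (hν : ∀ w, ν w ∈ ctx.L) :
    Cmd.Canonical c₀ enc q ctx i s ν ↔
      ((IsCandidate c₀ q ctx.facts ctx.L (i, ν) ∧
        ∀ y : Fin q.length × (W → Const), IsCandidate c₀ q ctx.facts ctx.L y →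
          coverOf c₀ q y ⊆ coverOf c₀ q (i, ν) → coverOf c₀ q (i, ν) ⊆ coverOf c₀ q y) ∧
      ∀ y : Fin q.length × (W → Const), IsCandidate c₀ q ctx.facts ctx.L y →
        coverOf c₀ q y = coverOf c₀ q (i, ν) →
        ¬candidateRank q enc y < candidateRank q enc (i, ν)) ∧
      (ctx.α ∈ coverOf c₀ q (i, ν) ∧ (coverOf c₀ q (i, ν)).card = s) := by
  have hlt : ∀ y : Fin q.length × (W → Const), candidateRank q enc y < candidateRank q enc (i, ν) ↔
      (y.1 < i ∨ y.1 = i ∧ Cmd.rankWord (Rel := S.Rel) enc y.2 < Cmd.rankWord enc ν) :=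
    fun y => Prod.Lex.toLex_lt_toLex
  simp only [hlt, Cmd.Canonical, IsCandidate, coverOf, List.mem_finRange, forall_true_left,
    Prod.forall, hν, implies_true, true_and]
  constructor
  · rintro ⟨⟨h₁, h₂⟩, h₃, h₄⟩
    refine ⟨⟨⟨h₁, fun i' ν' h h' => ?_⟩, fun i' ν' h h' hr => ?_⟩, h₃⟩
    · by_contra hc
      exact h₂ i' ⟨ν', h.1, h.2, h', hc⟩
    · exact h₄ i' ⟨ν', h.1, h.2, ⟨h'.le, h'.ge⟩, hr⟩
  · rintro ⟨⟨⟨h₁, h₂⟩, h₄⟩, h₃⟩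
    refine ⟨⟨h₁, ?_⟩, h₃, ?_⟩
    · rintro i' ⟨ν', h, h', hs, hn⟩
      exact hn (h₂ i' ν' ⟨h, h'⟩ hs)
    · rintro i' ⟨ν', h, h', ⟨hs, hn⟩, hr⟩
      exact h₄ i' ν' ⟨h, h'⟩ (le_antisymm hs hn) hr

theorem card_coverOf_le {k : ℕ} (hk : ∀ p ∈ q, p.signed.pos.length ≤ k)
    (x : Fin q.length × (W → Const)) : (coverOf c₀ q x).card ≤ k := by
  rw [coverOf, cover]
  refine le_trans (le_trans (@List.toFinset_card_le _ (_) _) ?_) (hk _ (List.get_mem q x.1))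
  rw [List.length_map]

open scoped Classical in
/-- The number that the programs compute determines the Shapley value. -/
theorem total_div_factorial (ctx : Ctx S Const)
    (hL : ∀ c, c ∈ ctx.L ↔ c ∈ activeDomain ctx.facts.toFinset) {c₁ : Const} (hc₁ : c₁ ∈ ctx.L)
    (hW : ∀ p ∈ q, ∀ A ∈ p.pos, ∀ x, A.HasVar x → x ∈ W) {k : ℕ}
    (hk : ∀ p ∈ q, p.signed.pos.length ≤ k)
    (hα : ctx.α ∈ signedDatabase ctx.facts.toFinset) :
    (Cmd.total c₀ W enc q (fun s => k.factorial / s) (List.range (k + 1)) ctx : ℝ) / k.factorial =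
      shapley (signedDatabase ctx.facts.toFinset) (msScore q.signed) ⟨ctx.α, hα⟩ := by
  set E := signedDatabase ctx.facts.toFinset with hE
  set V := Fintype.piFinset fun _ : W => ctx.L.toFinset with hV
  have hmemV : ∀ ν, ν ∈ V ↔ ∀ w, ν w ∈ ctx.L := fun ν => by simp [V]
  set P : Finset (Fin q.length × (W → Const)) := Finset.univ ×ˢ V with hP
  set A := P.filter fun x => IsCandidate c₀ q ctx.facts ctx.L x ∧
        ∀ y : Fin q.length × (W → Const), IsCandidate c₀ q ctx.facts ctx.L y →
          coverOf c₀ q y ⊆ coverOf c₀ q x → coverOf c₀ q x ⊆ coverOf c₀ q y with hA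
  have hMS : E.powerset.filter (IsMinimalSupport q.signed E) = A.image (coverOf c₀ q) := by
    ext T
    rw [Finset.mem_filter, Finset.mem_powerset, Finset.mem_image,
      isMinimalSupport_signed_iff c₀ q hL hc₁ hW]
    constructor
    · rintro ⟨_, x, hx, e⟩
      refine ⟨x, Finset.mem_filter.2 ⟨?_, hx⟩, e⟩
      exact Finset.mem_product.2 ⟨Finset.mem_univ _, (hmemV _).2 hx.1.1⟩
    · rintro ⟨x, hx, rfl⟩
      have hx' := (Finset.mem_filter.1 hx).2
      exact ⟨((valid_iff hL _ _).1 hx'.1.2).1, x, hx', rfl⟩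
  have hcan : ∀ i s, ∀ ν ∈ V, Cmd.Canonical c₀ enc q ctx i s ν ↔
      ((i, ν) ∈ A.filter (fun x => ∀ y ∈ A, coverOf c₀ q y = coverOf c₀ q x →
        ¬candidateRank q enc y < candidateRank q enc x) ∧ ctx.α ∈ coverOf c₀ q (i, ν)) ∧
        (coverOf c₀ q (i, ν)).card = s := by
    intro i s ν hν
    rw [canonical_iff c₀ q enc ctx i s ν ((hmemV ν).1 hν), ← and_assoc]
    refine and_congr_left fun _ => and_congr_left fun _ => ?_
    rw [Finset.mem_filter, Finset.mem_filter, Finset.mem_product, and_iff_right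
      (⟨Finset.mem_univ _, hν⟩ : _ ∧ _)]
    refine and_congr_right fun h => ⟨fun h' y hy => h' y (Finset.mem_filter.1 hy).2.1, ?_⟩
    -- A candidate with the same cover as a minimal one is itself minimal, so being least among all
    -- candidates and being least in `A` agree.
    intro h' y hy e
    refine h' y (Finset.mem_filter.2 ⟨Finset.mem_product.2 ⟨Finset.mem_univ _,
      (hmemV _).2 hy.1⟩, hy, fun z hz hzy => ?_⟩) e
    rw [e] at hzy ⊢
    exact h.2 z hz hzy
  rw [shapley_msScore, hMS, sum_image_least _ _ _ (candidateRank_injective q enc)]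
  set A' := A.filter (fun x => ∀ y ∈ A, coverOf c₀ q y = coverOf c₀ q x →
        ¬candidateRank q enc y < candidateRank q enc x) with hA'
  have hsub : A' ⊆ P := (Finset.filter_subset _ _).trans (Finset.filter_subset _ _)
  have hrhs : ∑ x ∈ A', (if ctx.α ∈ coverOf c₀ q x then 1 / ((coverOf c₀ q x).card : ℝ) else 0) =
      ∑ i, ∑ ν ∈ V, if (i, ν) ∈ A' ∧ ctx.α ∈ coverOf c₀ q (i, ν) then
        1 / ((coverOf c₀ q (i, ν)).card : ℝ) else 0 := by
    rw [← Finset.sum_product' (f := fun i ν => if (i, ν) ∈ A' ∧ ctx.α ∈ coverOf c₀ q (i, ν) then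
        1 / ((coverOf c₀ q (i, ν)).card : ℝ) else 0), ← hP, ← Finset.sum_subset hsub]
    · exact Finset.sum_congr rfl fun x hx => by simp [hx]
    · intro x _ hx
      simp [hx]
  have hlhs : Cmd.total c₀ W enc q (fun s => k.factorial / s) (List.range (k + 1)) ctx =
      ∑ i, ∑ s ∈ Finset.range (k + 1), k.factorial / s *
        (V.filter (Cmd.Canonical c₀ enc q ctx i s)).card := by
    rw [Cmd.total, ← Fin.sum_univ_def]
    exact Finset.sum_congr rfl fun i _ => rfl
  refine Eq.trans ?_ (hrhs.symm.trans (Finset.sum_congr rfl fun x _ => by congr))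
  rw [hlhs, Nat.cast_sum, Finset.sum_div]
  refine Finset.sum_congr rfl fun i _ => ?_
  rw [Nat.cast_sum, Finset.sum_div]
  have hs : ∀ s ∈ Finset.range (k + 1), ((k.factorial / s *
      (V.filter (Cmd.Canonical c₀ enc q ctx i s)).card : ℕ) : ℝ) / k.factorial =
      ∑ ν ∈ V, if Cmd.Canonical c₀ enc q ctx i s ν then
        ((k.factorial / s : ℕ) : ℝ) / k.factorial else 0 := by
    intro s _
    rw [← Finset.sum_filter, Finset.sum_const, nsmul_eq_mul, Nat.cast_mul]
    ring
  rw [Finset.sum_congr rfl hs, Finset.sum_comm]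
  refine Finset.sum_congr rfl fun ν hν => ?_
  have hc := card_coverOf_le c₀ q hk (i, ν)
  -- Of all sizes, only that of the cover contributes.
  rw [Finset.sum_eq_single_of_mem (coverOf c₀ q (i, ν)).card (Finset.mem_range.2 (by omega))]
  · rw [if_congr ((hcan i _ ν hν).trans (and_iff_left rfl)) rfl rfl]
    by_cases h : (i, ν) ∈ A' ∧ ctx.α ∈ coverOf c₀ q (i, ν)
    · rw [if_pos h, if_pos h]
      have h0 : 0 < (coverOf c₀ q (i, ν)).card := Finset.card_pos.2 ⟨_, h.2⟩
      have hk0 : (k.factorial : ℝ) ≠ 0 := Nat.cast_ne_zero.2 k.factorial_ne_zero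
      have hc0 : ((coverOf c₀ q (i, ν)).card : ℝ) ≠ 0 := Nat.cast_ne_zero.2 h0.ne'
      -- The cover contains `α` and has at most `k` elements, so its size divides `k!` and the
      -- natural division is exact. The junk weight of size `0` is never used.
      rw [Nat.cast_div (Nat.dvd_factorial h0 hc) hc0]
      field_simp
    · rw [if_neg h, if_neg h]
  · intro s _ hs
    rw [if_neg]
    intro h
    exact hs ((hcan i s ν hν).1 h).2.symm

end

end SignedShapley

namespace SignedShapley

open Function

/-! ### The machine -/

variable {S : Schema} {Const Var : Type}

instance : Inhabited OutSymbol := ⟨OutSymbol.slash⟩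

open scoped Classical in
theorem mem_domList_iff (F : List (Fact S Const)) (c : Const) :
    c ∈ Cmd.domList F ↔ c ∈ activeDomain F.toFinset := by
  simp [Cmd.mem_domList, activeDomain]

/-- Arities are positive, so `α` has an argument, and this lies in the active domain because `α ∈
D^±`. -/
theorem Input.exists_mem_domList (I : Input S Const) : ∃ c, c ∈ Cmd.domList I.facts := by
  classical
  simp only [mem_domList_iff]
  obtain ⟨F, _, ⟨R | R, a⟩, h⟩ := I
  · have h' := plus_mem_signedDatabase (S := S) (f := ⟨R, a⟩).1 h
    exact ⟨a ⟨0, S.arity_pos R⟩, Finset.mem_biUnion.2 ⟨_, h', Finset.mem_image_of_mem _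
      (Finset.mem_univ _)⟩⟩
  · have h' := minus_mem_signedDatabase (S := S) (f := ⟨R, a⟩).1 h
    exact ⟨_, h'.2 ⟨0, S.arity_pos R⟩⟩

/-- The context of an input. -/
noncomputable def Input.ctx (I : Input S Const) : Ctx S Const :=
  ⟨I.facts, I.α, Cmd.domList I.facts, Cmd.domList_nodup I.facts⟩

namespace Cmd

/-- The stacks but the counter. -/
noncomputable def scratch (J : Type) [Fintype J] : List (WK J) :=
  letI := Fintype.ofFinite (WK J)
  (Finset.univ.erase WK.cnt).toList

theorem mem_scratch {J : Type} [Fintype J] {k : WK J} : k ∈ scratch J ↔ k ≠ WK.cnt := by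
  simp [scratch]

/-- A polynomial bound for the running time, if counting takes time `p`. -/
noncomputable def timeBound (J : Type) [Fintype J] (M : ℕ) (p : Polynomial ℕ) : Polynomial ℕ :=
  let X1 : Polynomial ℕ := Polynomial.X + 1
  (10 * X1 + 4 + (X1 * (X1 * (4 * (30 * X1)) + 60 * X1 + 30) +
      (((Finset.univ : Finset J).toList.length : Polynomial ℕ) * (30 * X1) + 1)) +
    (p + ((((scratch J).length : Polynomial ℕ) * (4 * X1) + 1) +
      (9 * p * p + 25 * p + 12 * (M : Polynomial ℕ) + 30))) +
    (9 * p * p + 25 * p + 12 * (M : Polynomial ℕ) + 30) + 1).comp (2 * Polynomial.X)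

variable {J : Type} [Fintype J] {M : ℕ} {enc : Computability.Encoding Const Bool}

theorem Counts.exists_exec {N : Ctx S Const → ℕ} (hM : 0 < M)
    (hN : Counts (J := J) M enc fun ctx _ => N ctx) :
    ∃ (c : Cmd (WK J) (InSymbol S.Rel) (Reg (InSymbol S.Rel) M)) (p : Polynomial ℕ),
      ∀ (I : Input S Const) v, ∃ v' res t, Exec c v
        (update (fun _ => []) WK.facts (encodeInput enc I)) v'
        (update (fun _ => []) WK.t2 res) t ∧
        t + res.length + 1 ≤ p.eval (encodeInput enc I).length ∧
        res.reverse.map outSymbol = encodeRat ((N I.ctx : ℚ) / M) := by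
  obtain ⟨c, p, hc⟩ := hN
  refine ⟨seq (prepare (Finset.univ : Finset J).toList) (seq c (seq (clearAll (scratch J)) finish)),
    timeBound J M p, fun I v => ?_⟩
  set n := 2 * (encodeInput enc I).length with hn
  obtain ⟨d, hd⟩ := I.exists_mem_domList
  obtain ⟨d, L, hL⟩ := List.exists_cons_of_ne_nil (List.ne_nil_of_mem hd)
  obtain ⟨v₁, T, c₁, hT, hloop, hcnt⟩ := prepare_exec (n := n) enc (Finset.univ : Finset J).toList
    (Finset.nodup_toList _) (by simp) I.α I.facts d L hL le_rfl v
  obtain ⟨v₂, c₂⟩ := hc _ _ n T v₁ hT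
  rw [hcnt, List.append_nil] at c₂
  -- The counter is empty at first, so its final length is bounded by the running time. This
  -- justifies counting in unary.
  have hNp : N I.ctx ≤ p.eval n := by
    have := c₂.length_le WK.cnt
    rw [update_self, hcnt, List.length_replicate] at this
    simpa [Input.ctx] using this
  obtain ⟨v₃, T₃, c₃, h₁, h₂⟩ := clearAll_exec (n := n) (scratch J) v₂
    (update T WK.cnt (List.replicate (N I.ctx) InSymbol.sep)) (by
      intro k hk
      rw [update_of_ne (mem_scratch.1 hk)]
      rcases k with _ | s | _ | _ | _ | _ | _ | _ | _
      · exact hT.facts_le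
      · exact hT.src_le s
      · exact hT.dom_le
      · simp [hloop]
      · simp [hcnt]
      · simp [hT.clean.t1]
      · simp [hT.clean.t2]
      · simp [hT.clean.t3]
      · simp [hT.clean.t4])
  have e₃ : T₃ = update (fun _ => []) WK.cnt (List.replicate (N I.ctx) InSymbol.sep) := by
    funext k
    by_cases hk : k = WK.cnt
    · subst hk; rw [h₂ _ (by simp [mem_scratch])]; simp
    · rw [h₁ k (mem_scratch.2 hk)]; simp [hk]
  rw [e₃] at c₃
  obtain ⟨v₄, res, c₄, hres⟩ := finish_exec (J := J) hM (N I.ctx) v₃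
  refine ⟨v₄, res, _, c₁.seq (c₂.seq (c₃.seq c₄)), ?_, hres⟩
  -- The output, too, is no longer than the time spent on writing it; it enters the bound since the
  -- machine still has to move it.
  have hlen := c₄.length_le WK.t2
  rw [update_self, update_of_ne (by simp), List.length_nil, zero_add] at hlen
  have hsq : 9 * N I.ctx * N I.ctx ≤ 9 * p.eval n * p.eval n := by gcongr
  have e : (timeBound J M p).eval (encodeInput enc I).length =
      (10 * (n + 1) + 4 + ((n + 1) * (stepTime n + 30) +
        ((Finset.univ : Finset J).toList.length * (30 * (n + 1)) + 1)) +
      (p.eval n + (((scratch J).length * (4 * (n + 1)) + 1) +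
        (9 * p.eval n * p.eval n + 25 * p.eval n + 12 * M + 30))) +
      (9 * p.eval n * p.eval n + 25 * p.eval n + 12 * M + 30) + 1) := by
    simp [timeBound, stepTime, hn]
  rw [e]
  omega

theorem Counts.computable {N : Ctx S Const → ℕ} (hM : 0 < M)
    (hN : Counts (J := J) M enc fun ctx _ => N ctx) :
    Nonempty (Turing.TM2ComputableInPolyTime (encodeInput enc) encodeRat
      fun I : Input S Const => (N I.ctx : ℚ) / M) := by
  obtain ⟨c, p, h⟩ := hN.exists_exec hM
  let _ : Fintype (WK J) := Fintype.ofFinite _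
  let _ : Fintype (Reg (InSymbol S.Rel) M) := Fintype.ofFinite _
  let m := machine OutSymbol c WK.facts WK.t2 ⟨false, none, none, 0, 0⟩ setA
    fun v => v.a.map outSymbol
  have key : ∀ I : Input S Const, Nonempty (Turing.TM2OutputsInTime m (encodeInput enc I)
      (some (encodeRat ((N I.ctx : ℚ) / M))) (p.eval (encodeInput enc I).length)) := by
    intro I
    obtain ⟨v', res, t, hc, ht, hres⟩ := h I ⟨false, none, none, 0, 0⟩
    rw [← hres]
    obtain ⟨hs⟩ := machine_outputs OutSymbol (tr := outSymbol) (rd := setA)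
      (get := fun v => v.a.map outSymbol) (fun _ _ => rfl) hc
    exact ⟨⟨hs.1, hs.2.trans ht⟩⟩
  exact ⟨{ tm := m
           inputAlphabet := Equiv.refl (InSymbol S.Rel)
           outputAlphabet := Equiv.refl OutSymbol
           time := p
           outputsFun := fun I => by
            have e₁ : List.map (Equiv.refl (InSymbol S.Rel)).invFun (encodeInput enc I) =
              encodeInput enc I := List.map_id _
            have e₂ : List.map (Equiv.refl OutSymbol).invFun (encodeRat ((N I.ctx : ℚ) / M)) =
              encodeRat ((N I.ctx : ℚ) / M) := List.map_id _
            exact Classical.choice (e₁.symm ▸ e₂.symm ▸ key I) }⟩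

end Cmd

end SignedShapley

theorem mainTheorem1 (S : SignedShapley.Schema) (Const Var : Type) [Infinite Const]
    (enc : Computability.Encoding Const Bool) (q : SignedShapley.UCQneg S Const Var) :
    ∃ value : SignedShapley.Input S Const → ℚ,
      (∀ I : SignedShapley.Input S Const,
        (value I : ℝ) =
          SignedShapley.shapley (SignedShapley.signedDatabase I.database)
            (SignedShapley.msScore (SignedShapley.UCQneg.signed q)) ⟨I.α, I.mem⟩) ∧
      Nonempty (Turing.TM2ComputableInPolyTime (SignedShapley.encodeInput enc)
        SignedShapley.encodeRat value) := by
  classical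
  obtain ⟨c₀⟩ : Nonempty Const := inferInstance
  obtain ⟨W, hW⟩ := SignedShapley.exists_finset_vars q
  -- Any common bound for the numbers of atoms of the disjuncts would do, since it bounds the sizes
  -- of the minimal supports.
  set k := (q.map fun p => p.signed.pos.length).sum with hk
  have hkp : ∀ p ∈ q, p.signed.pos.length ≤ k := fun p hp =>
    List.le_sum_of_mem (List.mem_map.2 ⟨p, hp, rfl⟩)
  refine ⟨fun I => (SignedShapley.Cmd.total c₀ W enc q (fun s => k.factorial / s)
    (List.range (k + 1)) I.ctx : ℚ) / (k.factorial : ℕ), fun I => ?_,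
    (SignedShapley.Cmd.Counts.total c₀ q _ _).computable k.factorial_pos⟩
  obtain ⟨c₁, hc₁⟩ := I.exists_mem_domList
  have h := SignedShapley.total_div_factorial c₀ q enc I.ctx
    (fun c => (SignedShapley.mem_domList_iff I.facts c).trans (by congr!)) hc₁ hW hkp
    (by convert I.mem using 0; congr!)
  push_cast
  rw [h]
  rfl
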